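/- **Direct map.** For $q\in\mathcal S(\mathbb R)$ and $\lambda\in\mathbb R$ let $n^\pm(\cdot,\lambda)$ be the $2\times2$ matrix solutions of $$\frac{dn^\pm}{dx}=-i\lambda[\sigma,n^\pm]+\begin{pmatrix}0&q\\ \lambda\bar q&0\end{pmatrix}n^\pm+\begin{pmatrix}-\frac i2|q|^2&0\\0&\frac i2|q|^2\end{pmatrix}n^\pm,\qquad \lim_{x\to\pm\infty}n^\pm(x,\lambda)=\mathbf 1,\qquad \sigma=\begin{pmatrix}1&0\\0&-1\end{pmatrix},$$ and let the scattering data $\alpha,\beta:\mathbb R\to\mathbb C$ be determined by $$n^+(x,\lambda)=n^-(x,\lambda)\,e^{-i\lambda x\,\mathrm{ad}\,\sigma}\begin{pmatrix}\alpha(\lambda)&\beta(\lambda)\\ \lambda\overline{\beta(\lambda)}&\overline{\alpha(\lambda)}\end{pmatrix},\qquad e^{i\theta\,\mathrm{ad}\,\sigma}\begin{pmatrix}a&b\\c&d\end{pmatrix}=\begin{pmatrix}a&e^{2i\theta}b\\e^{-2i\theta}c&d\end{pmatrix}.$$ Put $\mathcal Rq=\beta/\alpha$. Let $\mathcal S(\mathbb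 R)\cap U$ be the set of $q\in\mathcal S(\mathbb R)$ for which $\alpha$ has no zero on $\mathbb R$ and extends to a function that is continuous on $\{\operatorname{Im}z\le0\}$, and analytic and without zeros on $\{\operatorname{Im}z<0\}$. **Inverse map.** For $\rho:\mathbb R\to\mathbb C$ consider, for each $x\in\mathbb R$, the Riemann–Hilbert problem of finding a row vector $h\in L^2(\mathbb R)^2$ such that $N_\pm=(1,0)+C^\pm h$ satisfy, for a.e. $\lambda\in\mathbb R$, $$N_+(\lambda)=N_-(\lambda)\,e^{-i\lambda x\,\mathrm{ad}\,\sigma}\begin{pmatrix}1-\lambda|\rho(\lambda)|^2&\rho(\lambda)\\-\lambda\overline{\rho(\lambda)}&1\end{pmatrix},$$ where $C^\pm$ are the Cauchy projectors of $\mathbb R$ (the boundary values, from $\pm\operatorname{Im}z>0$, of the Cauchy integral $(Ch)(z)=\frac1{2\pi i}\int_{\mathbb R}\frac{h(s)}{s-z}\,ds$). With $N(x,z)=(1,0)+(Ch)(z)$ put $(\mathcal I\rho)(x)=2i\lim_{z\to\infty,\;z\in\mathbb C\setminus\mathbb R}zN_{12}(x,z)$, where $N_{12}$ is the second entry of $N$.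 **Theorem.** Let $q_0\in\mathcal S(\mathbb R)\cap U$. Then the scattering data of $q_0$ exist and are unique; for every $t\in\mathbb R$ the function $\mathcal I\big(e^{-4i(\cdot)^2t}\,\mathcal Rq_0\big)$ is well defined on $\mathbb R$ (for each $x$ the Riemann–Hilbert problem is solvable, the limit exists for a solution, and its value is uniquely determined); and $$q(x,t)=\mathcal I\big(e^{-4i(\cdot)^2t}(\mathcal Rq_0)(\cdot)\big)(x)$$ is a classical solution on $\mathbb R\times\mathbb R$ of the Gerdjikov–Ivanov form of the derivative nonlinear Schrödinger equation $$iq_t+q_{xx}+iq^2\bar q_x+\tfrac12|q|^4q=0,$$ that is, $q,q_x,q_{xx},q_t$ exist and are jointly continuous, and the equation holds at every $(x,t)$. -/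

import Mathlib

open Filter Topology MeasureTheory Complex
open scoped SchwartzMap FourierTransform ComplexConjugate

noncomputable section

namespace DNLS

/-- The action `e^{iθ ad σ}`, `σ = diag(1,-1)`, on `2 × 2` matrices:
`(a, b; c, d) ↦ (a, e^{2iθ} b; e^{-2iθ} c, d)`. -/
def adExp (θ : ℝ) (A : Matrix (Fin 2) (Fin 2) ℂ) : Matrix (Fin 2) (Fin 2) ℂ :=
  !![A 0 0, exp (2 * I * θ) * A 0 1; exp (-(2 * I * θ)) * A 1 0, A 1 1]

/-! ### The direct scattering map -/

/-- The Pauli matrix `σ = diag(1,-1)`. -/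
def sigma : Matrix (Fin 2) (Fin 2) ℂ := !![1, 0; 0, -1]

/-- The right-hand side of the linear spectral problem in the variable `l = ζ²`:
`-i l [σ, n] + (0, q; l q̄, 0) n + P n` with `P = diag(-(i/2)|q|², (i/2)|q|²)`. -/
def spectralRHS (q : ℝ → ℂ) (l x : ℝ) (n : Matrix (Fin 2) (Fin 2) ℂ) :
    Matrix (Fin 2) (Fin 2) ℂ :=
  (-(I * l)) • (sigma * n - n * sigma)
    + !![0, q x; l * conj (q x), 0] * n
    + !![-(I / 2) * (‖q x‖ : ℂ) ^ 2, 0; 0, (I / 2) * (‖q x‖ : ℂ) ^ 2] * n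

/-- `n` is the normalized Jost solution at the spectral parameter `l`, with limit the identity
matrix along `F` (`F = atTop` for `n⁺`, `F = atBot` for `n⁻`). -/
def IsJost (q : ℝ → ℂ) (F : Filter ℝ) (l : ℝ) (n : ℝ → Matrix (Fin 2) (Fin 2) ℂ) : Prop :=
  (∀ x i j, HasDerivAt (fun y => n y i j) (spectralRHS q l x (n x) i j) x) ∧
    Tendsto n F (𝓝 1)

/-- `α`, `β` are the scattering data of `q`: for every real `l` the Jost solutions are related by
`n⁺(x,l) = n⁻(x,l) e^{-ilx ad σ} (α, β; l β̄, ᾱ)`. -/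
def IsScatteringData (q : ℝ → ℂ) (α β : ℝ → ℂ) : Prop :=
  ∀ l : ℝ, ∃ np nm : ℝ → Matrix (Fin 2) (Fin 2) ℂ,
    IsJost q atTop l np ∧ IsJost q atBot l nm ∧
      ∀ x, np x = nm x * adExp (-(l * x)) !![α l, β l; l * conj (β l), conj (α l)]

/-- The pair `(α, β)` of scattering data of `q`. -/
def scatteringData (q : ℝ → ℂ) : (ℝ → ℂ) × (ℝ → ℂ) :=
  Classical.epsilon fun p => IsScatteringData q p.1 p.2

/-- The direct scattering map `𝓡 q = ρ = β / α`. -/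
def directScattering (q : ℝ → ℂ) : ℝ → ℂ := fun l =>
  (scatteringData q).2 l / (scatteringData q).1 l

/-- The set `𝓢(ℝ) ∩ U`: Schwartz functions whose scattering datum `α` has no zero on the real line
and has an analytic extension without zeros to the open lower half-plane (continuous up to the real
line, where it equals `α`). -/
def schwartzU : Set 𝓢(ℝ, ℂ) :=
  {q | (∀ l, (scatteringData q).1 l ≠ 0) ∧
    ∃ F : ℂ → ℂ, DiffContOnCl ℂ F {z | z.im < 0} ∧
      (∀ l : ℝ, F l = (scatteringData q).1 l) ∧ ∀ z, z.im < 0 → F z ≠ 0}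

/-! ### The inverse scattering map -/

/-- The complex Lebesgue space `L²(ℝ)`. -/
abbrev L2 : Type := Lp ℂ 2 (volume : Measure ℝ)

/-- The Cauchy integral `(Ch)(z) = (2πi)⁻¹ ∫ h(s) / (s - z) ds`, for `z` off the real line. -/
def cauchyIntegral (h : L2) (z : ℂ) : ℂ :=
  (2 * Real.pi * I)⁻¹ * ∫ s : ℝ, h s / ((s : ℂ) - z)

/-- Multiplication by the indicator function of a measurable set, on `L²(ℝ)`. -/
def restrictL2 (S : Set ℝ) (hS : MeasurableSet S) (f : L2) : L2 :=
  ((Lp.memLp f).indicator hS).toLp (S.indicator f)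

/-- The Cauchy projector `C⁺` of the real line (the boundary value of the Cauchy integral from the
upper half-plane), defined through the Fourier transform: it keeps the part of `f` composed of the
exponentials `e^{2πiξs}` with `ξ > 0`. -/
def cauchyPlus (f : L2) : L2 := 𝓕⁻ (restrictL2 (Set.Ioi 0) measurableSet_Ioi (𝓕 f))

/-- The Cauchy projector `C⁻` of the real line (the boundary value of the Cauchy integral from the
lower half-plane), defined through the Fourier transform: it is minus the part of `f` composed of
the exponentials `e^{2πiξs}` with `ξ < 0`; so `C⁺ - C⁻` is the identity. -/
def cauchyMinus (f : L2) : L2 := -𝓕⁻ (restrictL2 (Set.Iio 0) measurableSet_Iio (𝓕 f))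

/-- The row vector `e₁ = (1, 0)`. -/
def e1 : Fin 2 → ℂ := ![1, 0]

/-- The jump matrix `J = (1 - l|ρ|², ρ; -l ρ̄, 1)`. -/
def jump (ρ : ℝ → ℂ) (l : ℝ) : Matrix (Fin 2) (Fin 2) ℂ :=
  !![1 - l * (‖ρ l‖ : ℂ) ^ 2, ρ l; -(l * conj (ρ l)), 1]

/-- `h` is the density of a solution of the row-wise Riemann-Hilbert problem with data `ρ` at the
point `x`: the boundary values `N_± = e₁ + C^± h` satisfy
`N₊(l) = N₋(l) e^{-ilx ad σ} J(l)` for almost every real `l`. -/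
def IsRHPSolution (ρ : ℝ → ℂ) (x : ℝ) (h : Fin 2 → L2) : Prop :=
  ∀ᵐ l : ℝ, (fun j => e1 j + cauchyPlus (h j) l) =
    Matrix.vecMul (fun j => e1 j + cauchyMinus (h j) l) (adExp (-(l * x)) (jump ρ l))

/-- The function `N(z) = e₁ + (Ch)(z)`, analytic off the real line, with the boundary values
`N_± = e₁ + C^± h`. -/
def rhpFunction (h : Fin 2 → L2) (z : ℂ) : Fin 2 → ℂ := fun j => e1 j + cauchyIntegral (h j) z

/-- `q` is obtained from `ρ` by inverse scattering: for every `x`, there is a solution `N(x,·)` of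
the Riemann-Hilbert problem with `q(x) = 2i lim z N₁₂(x,z)` as `z → ∞` in `ℂ \ ℝ`. -/
def IsInverseScattering (ρ q : ℝ → ℂ) : Prop :=
  ∀ x, ∃ h, IsRHPSolution ρ x h ∧
    Tendsto (fun z : ℂ => 2 * I * (z * rhpFunction h z 1))
      (Bornology.cobounded ℂ ⊓ 𝓟 {z : ℂ | z.im ≠ 0}) (𝓝 (q x))

/-- The inverse scattering map `𝓘`. -/
def inverseScattering (ρ : ℝ → ℂ) : ℝ → ℂ := Classical.epsilon (IsInverseScattering ρ)

/-- The time evolution of the scattering data, `ρ ↦ e^{-4i l² t} ρ`. -/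
def evolve (t : ℝ) (ρ : ℝ → ℂ) : ℝ → ℂ := fun l => exp (-(4 * I * (l : ℂ) ^ 2 * t)) * ρ l

/-! ### Classical solutions -/

/-- `q(x,t)` is a classical solution on `ℝ × ℝ` of
`i q_t + q_xx + i q² (q̄)_x + (1/2) |q|⁴ q = 0`: the function and its derivatives `q_x`, `q_xx`,
`q_t` exist and are jointly continuous, and the equation holds at every point. -/
def IsClassicalSolution (q : ℝ → ℝ → ℂ) : Prop :=
  ∃ qx qxx qt : ℝ → ℝ → ℂ,
    Continuous (Function.uncurry q) ∧ Continuous (Function.uncurry qx) ∧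
    Continuous (Function.uncurry qxx) ∧ Continuous (Function.uncurry qt) ∧
    (∀ x t, HasDerivAt (fun y => q y t) (qx x t) x) ∧
    (∀ x t, HasDerivAt (fun y => qx y t) (qxx x t) x) ∧
    (∀ x t, HasDerivAt (fun s => q x s) (qt x t) t) ∧
    ∀ x t, I * qt x t + qxx x t + I * q x t ^ 2 * conj (qx x t)
      + (1 / 2) * (‖q x t‖ : ℂ) ^ 4 * q x t = 0

end DNLS

end

open Filter Topology MeasureTheory Complex
open scoped SchwartzMap FourierTransform ComplexConjugate BoundedContinuousFunction

noncomputable section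

namespace DNLS

/-! ### The Cauchy kernels -/

/-! Direct side. The gauge built into `jostMatrix` removes the factor `λ` from the spectral problem:
only the phases `e^{±2iλx}` still depend on `λ`, and the coefficients are dominated by one
integrable function. Hence the Jost solutions come from a contraction on the whole line, bounded and
Lipschitz in `λ` uniformly (`IsAdmissible.exists_family`). Their limits at `-∞` contain `β` and `ᾱ`.
Integration by parts turns `λβ` into an oscillatory integral of the same type (`exists_mul_oscInt`),
so all `λ^k β` are bounded and Lipschitz. Constancy of the determinant gives `|α|² - λ|β|² = 1`, so
`|α|` is bounded below once `α` has no real zero, and `ρ = β/α` inherits the decay of `β`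
(`rapid_directScattering`).

Inverse side. The triangular factorization of the jump matrix reduces the Riemann–Hilbert problem to
one equation for `f = N₁₁₋ - 1`, namely `T f = -C⁻(λρ̄ C⁺ρ)` with `T = 1 + C⁻ λρ̄ C⁺ ρ`, where `ρ`
carries the phase in `x` and `t`. A Hankel operator whose symbol vanishes at infinity is compact
(`isCompactOperator_hankel`), so `T` is invertible as soon as it is injective. Injectivity is
`eq_zero_of_hankel`: if `T f = 0` and `g = C⁺(ρf)`, then the real function `|f|² - λ|g|²` is a
combination of products of boundary values from the upper half-plane. Being real, it is zero. So `f`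
vanishes for `λ < 0`, and a Hardy function vanishing on a half-line is zero.

Evolution. The potential is `-2i k₀`, where `k_j` is the `j`-th moment of `N₁₁₋ρ`. Differentiating
the phase in `x` or `t` multiplies `ρ` by `-2iλ` or `-4iλ²`; moving a power of `λ` through `C^±`
costs a rank-one term, which is a moment (`IsMulX.mul_Cp`). Thus `f_x` and `f_t` are combinations,
with moments as coefficients, of explicit solutions `a`, `b` of `T a = -C⁻(λρ̄)` and `T b =
-C⁻(λ²ρ̄)`. Taking moments gives formulas for the derivatives of `k₀`. With the first-order term of
`det N = 1` (`thS_add_conj`), the differential equation becomes a polynomial identity in the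
moments.

The limit defining the potential is taken over all `z` off the real line, so it also needs Cauchy
integrals bounded up to the line; Lipschitz weights provide this (`exists_norm_pair_hS_le`). -/

/-- The Cauchy kernel `s ↦ (s - w)⁻¹` on the real line. -/
def ker (w : ℂ) (s : ℝ) : ℂ := ((s : ℂ) - w)⁻¹

lemma ofReal_sub_ne_zero {w : ℂ} (hw : w.im ≠ 0) (s : ℝ) : (s : ℂ) - w ≠ 0 := by
  intro h
  apply hw
  have := congrArg Complex.im h
  simpa using this

lemma continuous_ker {w : ℂ} (hw : w.im ≠ 0) : Continuous (ker w) :=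
  (continuous_ofReal.sub continuous_const).inv₀ (ofReal_sub_ne_zero hw)

lemma abs_im_le_norm_sub (w : ℂ) (s : ℝ) : |w.im| ≤ ‖(s : ℂ) - w‖ := by
  have := Complex.abs_im_le_norm ((s : ℂ) - w)
  simpa using this

lemma norm_ker_le (w : ℂ) (hw : w.im ≠ 0) (s : ℝ) : ‖ker w s‖ ≤ |w.im|⁻¹ := by
  rw [ker, norm_inv]
  exact inv_anti₀ (abs_pos.2 hw) (abs_im_le_norm_sub w s)

lemma conj_ker (w : ℂ) (s : ℝ) : conj (ker w s) = ker (conj w) s := by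
  simp [ker]

lemma normSq_sub_eq (w : ℂ) (s : ℝ) : ‖(s : ℂ) - w‖ ^ 2 = (s - w.re) ^ 2 + w.im ^ 2 := by
  rw [← Complex.normSq_eq_norm_sq, Complex.normSq_apply]
  simp
  ring

lemma integrable_sq_ker {w : ℂ} (hw : w.im ≠ 0) : Integrable fun s : ℝ => ‖ker w s‖ ^ 2 := by
  have h1 : Integrable fun s : ℝ => (1 + s ^ 2)⁻¹ := integrable_inv_one_add_sq
  have h2 := ((h1.comp_div (R := w.im) hw).comp_sub_right w.re).const_mul ((w.im ^ 2)⁻¹)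
  refine h2.congr (Eventually.of_forall fun s => ?_)
  have h0 : w.im ^ 2 ≠ 0 := pow_ne_zero 2 hw
  have h3 : ‖ker w s‖ ^ 2 = ((s - w.re) ^ 2 + w.im ^ 2)⁻¹ := by
    rw [ker, norm_inv, inv_pow, normSq_sub_eq]
  simp only [h3]
  rw [← mul_inv]
  congr 1
  field_simp
  ring

lemma memLp_ker {w : ℂ} (hw : w.im ≠ 0) : MemLp (ker w) 2 (volume : Measure ℝ) :=
  (memLp_two_iff_integrable_sq_norm (continuous_ker hw).aestronglyMeasurable).2
    (integrable_sq_ker hw)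

/-- The Cauchy kernel as an element of `L²(ℝ)`. -/
def kerL (w : ℂ) (hw : w.im ≠ 0) : L2 := (memLp_ker hw).toLp (ker w)

lemma coeFn_kerL (w : ℂ) (hw : w.im ≠ 0) : kerL w hw =ᵐ[volume] ker w := MemLp.coeFn_toLp _

/-- Partial fractions. They keep products of kernels inside the span of the kernels. -/
lemma ker_mul_ker {a b : ℂ} (ha : a.im ≠ 0) (hb : b.im ≠ 0) (hab : a ≠ b) (s : ℝ) :
    ker a s * ker b s = (a - b)⁻¹ * (ker a s - ker b s) := by
  have h1 := ofReal_sub_ne_zero ha s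
  have h2 := ofReal_sub_ne_zero hb s
  have h3 := sub_ne_zero.2 hab
  unfold ker
  field_simp
  ring

/-! ### Fourier representation of the Cauchy kernels -/

/-- The Fourier transform of the Cauchy kernel. -/
def kerHat (w : ℂ) : ℝ → ℂ :=
  if w.im < 0 then (Set.Ioi 0).indicator fun ξ => -(2 * Real.pi * I) * exp (-(2 * Real.pi * I * w) * ξ)
  else (Set.Iio 0).indicator fun ξ => (2 * Real.pi * I) * exp (-(2 * Real.pi * I * w) * ξ)

lemma integrableOn_exp_mul_Iio {a : ℂ} (ha : 0 < a.re) :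
    IntegrableOn (fun x : ℝ => exp (a * x)) (Set.Iio 0) :=
  (integrableOn_exp_mul_complex_Iic ha 0).mono_set Set.Iio_subset_Iic_self

lemma re_two_pi_I_mul (w : ℂ) : (2 * Real.pi * I * w : ℂ).re = -(2 * Real.pi * w.im) := by
  simp

lemma integrable_kerHat {w : ℂ} (hw : w.im ≠ 0) : Integrable (kerHat w) := by
  unfold kerHat
  split_ifs with h
  · rw [integrable_indicator_iff measurableSet_Ioi]
    refine (integrableOn_exp_mul_complex_Ioi ?_ 0).const_mul _
    rw [neg_re, re_two_pi_I_mul]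
    nlinarith [Real.pi_pos]
  · rw [integrable_indicator_iff measurableSet_Iio]
    refine (integrableOn_exp_mul_Iio ?_).const_mul _
    rw [neg_re, re_two_pi_I_mul]
    have : 0 < w.im := lt_of_le_of_ne (not_lt.1 h) hw.symm
    have := mul_pos Real.pi_pos this
    linarith

lemma norm_kerHat_le {w : ℂ} (ξ : ℝ) : ‖kerHat w ξ‖ ≤ 2 * Real.pi := by
  have hp := Real.pi_pos
  have h1 : ‖(2 * Real.pi * I : ℂ)‖ = 2 * Real.pi := by
    simp [abs_of_pos hp]
  have key : ∀ ξ : ℝ, 0 ≤ -(w.im * ξ) → ‖exp (-(2 * Real.pi * I * w) * ξ)‖ ≤ 1 := by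
    intro ξ h
    rw [Complex.norm_exp, Real.exp_le_one_iff, Complex.re_mul_ofReal, neg_re, re_two_pi_I_mul]
    nlinarith
  unfold kerHat
  split_ifs with h <;> rw [Set.indicator_apply] <;> split_ifs with h2
  · rw [norm_mul, norm_neg, h1]
    have h2' : 0 < ξ := h2
    have := key ξ (by nlinarith)
    nlinarith
  · simp; positivity
  · rw [norm_mul, h1]
    have h2' : ξ < 0 := h2
    have := key ξ (by nlinarith)
    nlinarith
  · simp; positivity

lemma memLp_kerHat {w : ℂ} (hw : w.im ≠ 0) : MemLp (kerHat w) 2 (volume : Measure ℝ) := by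
  have hi := integrable_kerHat hw
  refine (memLp_two_iff_integrable_sq_norm hi.aestronglyMeasurable).2 ?_
  simp_rw [pow_two]
  exact hi.norm.bdd_mul (c := 2 * Real.pi) hi.aestronglyMeasurable.norm
    (Eventually.of_forall fun ξ => by simpa using norm_kerHat_le ξ)

/-- The transform is computed in the inverse direction because `kerHat w` is integrable, whereas
`ker w` is only square-integrable. -/
lemma fourierInv_kerHat {w : ℂ} (hw : w.im ≠ 0) (s : ℝ) : 𝓕⁻ (kerHat w) s = ker w s := by
  have hp : (Real.pi : ℂ) ≠ 0 := by exact_mod_cast Real.pi_ne_zero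
  have hs := ofReal_sub_ne_zero hw s
  have hre : (2 * Real.pi * I * ((s : ℂ) - w)).re = 2 * Real.pi * w.im := by
    rw [re_two_pi_I_mul]; simp
  rw [Real.fourierInv_eq']
  unfold kerHat
  split_ifs with h
  · have : (fun v : ℝ => exp (↑(2 * Real.pi * inner ℝ v s) * I) • (Set.Ioi (0 : ℝ)).indicator
        (fun ξ : ℝ => -(2 * Real.pi * I) * exp (-(2 * Real.pi * I * w) * ξ)) v)
        = (Set.Ioi (0 : ℝ)).indicator
          (fun ξ : ℝ => -(2 * Real.pi * I) * exp ((2 * Real.pi * I * ((s : ℂ) - w)) * ξ)) := by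
      funext v
      by_cases hv : v ∈ Set.Ioi (0 : ℝ)
      · rw [Set.indicator_of_mem hv, Set.indicator_of_mem hv, smul_eq_mul, mul_left_comm,
          ← Complex.exp_add]
        congr 2
        simp
        ring
      · rw [Set.indicator_of_notMem hv, Set.indicator_of_notMem hv, smul_zero]
    rw [this, integral_indicator measurableSet_Ioi, integral_const_mul,
      integral_exp_mul_complex_Ioi (by rw [hre]; nlinarith [Real.pi_pos])]
    simp only [ofReal_zero, mul_zero, Complex.exp_zero, ker]
    field_simp
  · have hw' : 0 < w.im := lt_of_le_of_ne (not_lt.1 h) hw.symm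
    have : (fun v : ℝ => exp (↑(2 * Real.pi * inner ℝ v s) * I) • (Set.Iio (0 : ℝ)).indicator
        (fun ξ : ℝ => (2 * Real.pi * I) * exp (-(2 * Real.pi * I * w) * ξ)) v)
        = (Set.Iio (0 : ℝ)).indicator
          (fun ξ : ℝ => (2 * Real.pi * I) * exp ((2 * Real.pi * I * ((s : ℂ) - w)) * ξ)) := by
      funext v
      by_cases hv : v ∈ Set.Iio (0 : ℝ)
      · rw [Set.indicator_of_mem hv, Set.indicator_of_mem hv, smul_eq_mul, mul_left_comm,
          ← Complex.exp_add]
        congr 2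
        simp
        ring
      · rw [Set.indicator_of_notMem hv, Set.indicator_of_notMem hv, smul_zero]
    rw [this, integral_indicator measurableSet_Iio, integral_const_mul,
      ← integral_Iic_eq_integral_Iio,
      integral_exp_mul_complex_Iic (by rw [hre]; have := mul_pos Real.pi_pos hw'; linarith)]
    simp only [ofReal_zero, mul_zero, Complex.exp_zero, ker]
    field_simp

/-- On `L¹ ∩ L²`, the inverse Fourier transform on `L²` is given by the integral. -/
lemma fourierInv_toLp {f g : ℝ → ℂ} (hf1 : Integrable f) (hf : MemLp f 2 volume)
    (hg : MemLp g 2 volume) (hfg : ∀ s, 𝓕⁻ f s = g s) : 𝓕⁻ (hf.toLp f : L2) = hg.toLp g := by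
  -- `L²` embeds injectively into tempered distributions, where the transform is defined by duality;
  -- so it suffices to pair both sides with a Schwartz function.
  have hinj : Function.Injective (Lp.toTemperedDistributionCLM (E := ℝ) ℂ volume 2) :=
    LinearMap.ker_eq_bot.1 Lp.ker_toTemperedDistributionCLM_eq_bot
  apply hinj
  ext φ
  rw [Lp.toTemperedDistributionCLM_apply, Lp.toTemperedDistributionCLM_apply,
    ← Lp.fourierInv_toTemperedDistribution_eq, TemperedDistribution.fourierInv_apply,
    Lp.toTemperedDistribution_apply, Lp.toTemperedDistribution_apply]
  have h1 : ∫ x, (𝓕⁻ φ) x • (hf.toLp f : L2) x = ∫ x, (𝓕⁻ φ) x • f x :=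
    integral_congr_ae (by filter_upwards [hf.coeFn_toLp] with x hx; rw [hx])
  have h2 : ∫ x, φ x • (hg.toLp g : L2) x = ∫ x, φ x • 𝓕⁻ f x :=
    integral_congr_ae (by filter_upwards [hg.coeFn_toLp] with x hx; rw [hx, hfg])
  rw [h1, h2]
  have hL : Continuous fun p : ℝ × ℝ => ((-innerₗ ℝ : ℝ →ₗ[ℝ] ℝ →ₗ[ℝ] ℝ) p.1) p.2 := by
    simp only [LinearMap.neg_apply, innerₗ_apply_apply]
    exact continuous_inner.neg
  -- The multiplication formula, taken for the form `-innerₗ ℝ` so that it concerns the inverse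
  -- transform; the form is symmetric, hence equal to its flip.
  have h := VectorFourier.integral_fourierIntegral_smul_eq_flip (L := -innerₗ ℝ)
    Real.continuous_fourierChar hL φ.integrable hf1 (μ := volume) (ν := volume)
  have hflip : (-innerₗ ℝ : ℝ →ₗ[ℝ] ℝ →ₗ[ℝ] ℝ).flip = -innerₗ ℝ := by
    ext
    simp
  rw [hflip] at h
  rw [SchwartzMap.fourierInv_coe]
  exact h

/-! ### Bounded operators on `L²(ℝ)` -/

lemma restrictL2_coeFn (S : Set ℝ) (hS : MeasurableSet S) (f : L2) :
    restrictL2 S hS f =ᵐ[volume] S.indicator f := MemLp.coeFn_toLp _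

/-- Restriction to a measurable set, as a bounded operator. -/
def restrictCLM (S : Set ℝ) (hS : MeasurableSet S) : L2 →L[ℂ] L2 :=
  LinearMap.mkContinuous
    { toFun := restrictL2 S hS
      map_add' := fun f g => by
        apply Lp.ext
        filter_upwards [restrictL2_coeFn S hS (f + g), restrictL2_coeFn S hS f,
          restrictL2_coeFn S hS g, Lp.coeFn_add f g,
          Lp.coeFn_add (restrictL2 S hS f) (restrictL2 S hS g)] with s h1 h2 h3 h4 h5
        rw [h1, h5, Pi.add_apply, h2, h3]
        by_cases hs : s ∈ S
        · simp only [Set.indicator_of_mem hs, h4, Pi.add_apply]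
        · simp [hs]
      map_smul' := fun c f => by
        apply Lp.ext
        filter_upwards [restrictL2_coeFn S hS (c • f), restrictL2_coeFn S hS f,
          Lp.coeFn_smul c f, Lp.coeFn_smul c (restrictL2 S hS f)] with s h1 h2 h3 h4
        rw [h1, RingHom.id_apply, h4, Pi.smul_apply, h2]
        by_cases hs : s ∈ S
        · simp only [Set.indicator_of_mem hs, h3, Pi.smul_apply]
        · simp [hs] } 1 fun f => by
    apply Lp.norm_le_mul_norm_of_ae_le_mul
    filter_upwards [restrictL2_coeFn S hS f] with s hs
    simp only [LinearMap.coe_mk, AddHom.coe_mk]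
    rw [hs, one_mul]
    exact norm_indicator_le_norm_self _ _

lemma inner_restrictL2 (S : Set ℝ) (hS : MeasurableSet S) (f g : L2) :
    inner ℂ (restrictL2 S hS f) g = inner ℂ f (restrictL2 S hS g) := by
  rw [L2.inner_def, L2.inner_def]
  apply integral_congr_ae
  filter_upwards [restrictL2_coeFn S hS f, restrictL2_coeFn S hS g] with s h1 h2
  rw [h1, h2]
  by_cases hs : s ∈ S <;> simp [hs]

/-- The Cauchy projector `C⁺` as a bounded operator. -/
def Cp : L2 →L[ℂ] L2 :=
  ((Lp.fourierTransformₗᵢ ℝ ℂ).symm.toLinearIsometry.toContinuousLinearMap).comp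
    ((restrictCLM (Set.Ioi 0) measurableSet_Ioi).comp
      (Lp.fourierTransformₗᵢ ℝ ℂ).toLinearIsometry.toContinuousLinearMap)

/-- The Cauchy projector `C⁻` as a bounded operator. -/
def Cm : L2 →L[ℂ] L2 :=
  -((Lp.fourierTransformₗᵢ ℝ ℂ).symm.toLinearIsometry.toContinuousLinearMap).comp
    ((restrictCLM (Set.Iio 0) measurableSet_Iio).comp
      (Lp.fourierTransformₗᵢ ℝ ℂ).toLinearIsometry.toContinuousLinearMap)

lemma Cp_apply (f : L2) : Cp f = cauchyPlus f := rfl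

lemma Cm_apply (f : L2) : Cm f = cauchyMinus f := rfl

/-- By Plancherel, `C⁺` is unitarily equivalent to multiplication by an indicator function, hence
self-adjoint. -/
lemma inner_Cp (f g : L2) : inner ℂ (Cp f) g = inner ℂ f (Cp g) := by
  rw [Cp_apply, Cp_apply, cauchyPlus, cauchyPlus, ← Lp.inner_fourier_eq,
    ← Lp.inner_fourier_eq f, FourierTransform.fourier_fourierInv_eq,
    FourierTransform.fourier_fourierInv_eq, inner_restrictL2]

lemma fourier_kerL {w : ℂ} (hw : w.im ≠ 0) :
    𝓕 (kerL w hw) = (memLp_kerHat hw).toLp (kerHat w) := by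
  rw [kerL, ← fourierInv_toLp (integrable_kerHat hw) (memLp_kerHat hw) (memLp_ker hw)
    (fourierInv_kerHat hw), FourierTransform.fourier_fourierInv_eq]

lemma restrictL2_kerHat {w : ℂ} (hw : w.im ≠ 0) (S : Set ℝ) (hS : MeasurableSet S)
    (h : ∀ ξ, kerHat w ξ ≠ 0 → ξ ∈ S) :
    restrictL2 S hS ((memLp_kerHat hw).toLp (kerHat w)) = (memLp_kerHat hw).toLp (kerHat w) := by
  apply Lp.ext
  filter_upwards [restrictL2_coeFn S hS ((memLp_kerHat hw).toLp (kerHat w)),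
    (memLp_kerHat hw).coeFn_toLp] with ξ h1 h2
  rw [h1]
  by_cases hs : ξ ∈ S
  · simp [hs]
  · rw [Set.indicator_of_notMem hs, h2]
    by_contra h0
    exact hs (h ξ (Ne.symm h0))

lemma restrictL2_kerHat_eq_zero {w : ℂ} (hw : w.im ≠ 0) (S : Set ℝ) (hS : MeasurableSet S)
    (h : ∀ ξ, ξ ∈ S → kerHat w ξ = 0) :
    restrictL2 S hS ((memLp_kerHat hw).toLp (kerHat w)) = 0 := by
  apply Lp.ext
  filter_upwards [restrictL2_coeFn S hS ((memLp_kerHat hw).toLp (kerHat w)),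
    (memLp_kerHat hw).coeFn_toLp, Lp.coeFn_zero ℂ 2 (volume : Measure ℝ)] with ξ h1 h2 h3
  rw [h1, h3]
  by_cases hs : ξ ∈ S
  · simp [hs, h2, h ξ hs]
  · simp [hs]

lemma kerHat_of_neg {w : ℂ} (hw : w.im < 0) {ξ : ℝ} (h : ¬ 0 < ξ) : kerHat w ξ = 0 := by
  simp [kerHat, hw, h]

lemma kerHat_of_pos {w : ℂ} (hw : 0 < w.im) {ξ : ℝ} (h : ¬ ξ < 0) : kerHat w ξ = 0 := by
  rw [kerHat, if_neg (not_lt.2 hw.le)]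
  exact Set.indicator_of_notMem (s := Set.Iio (0 : ℝ)) h _

/-- A pole in the lower half-plane means analyticity in the upper one; on the Fourier side the
kernel lives on `ξ > 0`. The action of `C⁺` and `C⁻` on the two types of kernels determines both
projectors by density. -/
lemma Cp_kerL_of_neg {w : ℂ} (hw : w.im < 0) : Cp (kerL w hw.ne) = kerL w hw.ne := by
  have h : ∀ ξ, kerHat w ξ ≠ 0 → ξ ∈ Set.Ioi (0 : ℝ) := fun ξ h => by
    by_contra h0
    exact h (kerHat_of_neg hw h0)
  rw [Cp_apply, cauchyPlus, fourier_kerL hw.ne, restrictL2_kerHat hw.ne _ _ h, ← fourier_kerL hw.ne,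
    FourierTransform.fourierInv_fourier_eq]

lemma Cp_kerL_of_pos {w : ℂ} (hw : 0 < w.im) : Cp (kerL w hw.ne') = 0 := by
  rw [Cp_apply, cauchyPlus, fourier_kerL hw.ne', restrictL2_kerHat_eq_zero hw.ne' _ measurableSet_Ioi
    fun ξ h => kerHat_of_pos hw (not_lt.2 (le_of_lt h))]
  exact (Lp.fourierTransformₗᵢ ℝ ℂ).symm.map_zero

lemma Cm_kerL_of_neg {w : ℂ} (hw : w.im < 0) : Cm (kerL w hw.ne) = 0 := by
  rw [Cm_apply, cauchyMinus, fourier_kerL hw.ne, restrictL2_kerHat_eq_zero hw.ne _ measurableSet_Iio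
    fun ξ h => kerHat_of_neg hw (not_lt.2 (le_of_lt h)), neg_eq_zero]
  exact (Lp.fourierTransformₗᵢ ℝ ℂ).symm.map_zero

lemma Cm_kerL_of_pos {w : ℂ} (hw : 0 < w.im) : Cm (kerL w hw.ne') = -kerL w hw.ne' := by
  have h : ∀ ξ, kerHat w ξ ≠ 0 → ξ ∈ Set.Iio (0 : ℝ) := fun ξ h => by
    by_contra h0
    exact h (kerHat_of_pos hw h0)
  rw [Cm_apply, cauchyMinus, fourier_kerL hw.ne', restrictL2_kerHat hw.ne' _ _ h, ← fourier_kerL hw.ne',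
    FourierTransform.fourierInv_fourier_eq]

/-- The bilinear pairing `(u, v) ↦ ∫ u v` on `L²(ℝ)`. -/
def pair : L2 →L[ℂ] L2 →L[ℂ] ℂ :=
  ContinuousLinearMap.lpPairing volume 2 2 (ContinuousLinearMap.mul ℂ ℂ)

lemma pair_apply (u v : L2) : pair u v = ∫ s, u s * v s :=
  ContinuousLinearMap.lpPairing_eq_integral _ _ _

lemma pair_comm (u v : L2) : pair u v = pair v u := by
  simp_rw [pair_apply, mul_comm]

lemma integrable_mul_L2 (u v : L2) : Integrable fun s => u s * v s :=
  MemLp.integrable_mul (Lp.memLp u) (Lp.memLp v)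

/-- Complex conjugation on `L²(ℝ)`. -/
def conjFun (f : L2) : L2 := ((Lp.memLp f).star).toLp (star ⇑f)

lemma conjFun_coeFn (f : L2) : ∀ᵐ s, conjFun f s = conj (f s) := by
  filter_upwards [(Lp.memLp f).star.coeFn_toLp] with s h
  rw [conjFun, h]
  rfl

/-- Complex conjugation on `L²(ℝ)` as a bounded semilinear map. -/
def conjL : L2 →SL[starRingEnd ℂ] L2 :=
  LinearMap.mkContinuous
    { toFun := conjFun
      map_add' := fun f g => by
        apply Lp.ext
        filter_upwards [conjFun_coeFn (f + g), conjFun_coeFn f, conjFun_coeFn g,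
          Lp.coeFn_add f g, Lp.coeFn_add (conjFun f) (conjFun g)] with s h1 h2 h3 h4 h5
        rw [h1, h5, Pi.add_apply, h2, h3, h4, Pi.add_apply, map_add]
      map_smul' := fun c f => by
        apply Lp.ext
        filter_upwards [conjFun_coeFn (c • f), conjFun_coeFn f, Lp.coeFn_smul c f,
          Lp.coeFn_smul (conj c) (conjFun f)] with s h1 h2 h3 h4
        rw [h1, h4, Pi.smul_apply, h2, h3, Pi.smul_apply, smul_eq_mul, smul_eq_mul, map_mul] } 1
    fun f => by
      apply Lp.norm_le_mul_norm_of_ae_le_mul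
      filter_upwards [conjFun_coeFn f] with s h
      simp only [LinearMap.coe_mk, AddHom.coe_mk]
      rw [h, one_mul, RCLike.norm_conj]

lemma conjL_coeFn (f : L2) : ∀ᵐ s, conjL f s = conj (f s) := conjFun_coeFn f

lemma inner_eq_pair (u v : L2) : inner ℂ u v = pair (conjL u) v := by
  rw [L2.inner_def, pair_apply]
  apply integral_congr_ae
  filter_upwards [conjL_coeFn u] with s h
  rw [h, RCLike.inner_apply, mul_comm]

lemma conjL_conjL (u : L2) : conjL (conjL u) = u := by
  apply Lp.ext
  filter_upwards [conjL_coeFn (conjL u), conjL_coeFn u] with s h1 h2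
  rw [h1, h2, Complex.conj_conj]

lemma conjL_kerL (w : ℂ) (hw : w.im ≠ 0) :
    conjL (kerL w hw) = kerL (conj w) (by simpa using hw) := by
  apply Lp.ext
  filter_upwards [conjL_coeFn (kerL w hw), coeFn_kerL w hw,
    coeFn_kerL (conj w) (by simpa using hw)] with s h1 h2 h3
  rw [h1, h2, h3, conj_ker]

lemma norm_conjL (u : L2) : ‖conjL u‖ = ‖u‖ := by
  apply le_antisymm <;> apply Lp.norm_le_norm_of_ae_le <;>
    filter_upwards [conjL_coeFn u] with s h <;> rw [h, RCLike.norm_conj]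

lemma norm_pair_le (u v : L2) : ‖pair u v‖ ≤ ‖u‖ * ‖v‖ := by
  have := norm_inner_le_norm (𝕜 := ℂ) (conjL u) v
  rwa [inner_eq_pair, conjL_conjL, norm_conjL] at this

/-- Multiplication by a bounded continuous function. -/
def mulFun (φ : ℝ →ᵇ ℂ) (f : L2) : L2 :=
  ((Lp.memLp f).of_le_mul (c := ‖φ‖) (f := fun s => φ s * f s)
    (φ.continuous.aestronglyMeasurable.mul (Lp.aestronglyMeasurable f))
    (Eventually.of_forall fun s => by
      rw [norm_mul]
      exact mul_le_mul_of_nonneg_right (φ.norm_coe_le_norm s) (norm_nonneg _))).toLp _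

lemma mulFun_coeFn (φ : ℝ →ᵇ ℂ) (f : L2) : ∀ᵐ s, mulFun φ f s = φ s * f s := MemLp.coeFn_toLp _

/-- Multiplication by bounded continuous functions, as a bounded bilinear map. -/
def mulL : (ℝ →ᵇ ℂ) →L[ℂ] L2 →L[ℂ] L2 :=
  LinearMap.mkContinuous₂
    (LinearMap.mk₂ ℂ mulFun
      (fun φ ψ f => by
        apply Lp.ext
        filter_upwards [mulFun_coeFn (φ + ψ) f, mulFun_coeFn φ f, mulFun_coeFn ψ f,
          Lp.coeFn_add (mulFun φ f) (mulFun ψ f)] with s h1 h2 h3 h4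
        rw [h1, h4, Pi.add_apply, h2, h3, BoundedContinuousFunction.add_apply, add_mul])
      (fun c φ f => by
        apply Lp.ext
        filter_upwards [mulFun_coeFn (c • φ) f, mulFun_coeFn φ f,
          Lp.coeFn_smul c (mulFun φ f)] with s h1 h2 h3
        rw [h1, h3, Pi.smul_apply, h2, BoundedContinuousFunction.smul_apply, smul_eq_mul,
          smul_eq_mul, mul_assoc])
      (fun φ f g => by
        apply Lp.ext
        filter_upwards [mulFun_coeFn φ (f + g), mulFun_coeFn φ f, mulFun_coeFn φ g,
          Lp.coeFn_add (mulFun φ f) (mulFun φ g), Lp.coeFn_add f g] with s h1 h2 h3 h4 h5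
        rw [h1, h4, Pi.add_apply, h2, h3, h5, Pi.add_apply, mul_add])
      (fun c φ f => by
        apply Lp.ext
        filter_upwards [mulFun_coeFn φ (c • f), mulFun_coeFn φ f,
          Lp.coeFn_smul c (mulFun φ f), Lp.coeFn_smul c f] with s h1 h2 h3 h4
        rw [h1, h3, Pi.smul_apply, h2, h4, Pi.smul_apply, smul_eq_mul, smul_eq_mul,
          mul_left_comm])) 1
    (fun φ f => by
      rw [one_mul]
      apply Lp.norm_le_mul_norm_of_ae_le_mul
      filter_upwards [mulFun_coeFn φ f] with s h
      rw [LinearMap.mk₂_apply, h, norm_mul]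
      exact mul_le_mul_of_nonneg_right (φ.norm_coe_le_norm s) (norm_nonneg _))

lemma mulL_coeFn (φ : ℝ →ᵇ ℂ) (f : L2) : ∀ᵐ s, mulL φ f s = φ s * f s := mulFun_coeFn φ f

lemma mulL_mul (φ ψ : ℝ →ᵇ ℂ) (f : L2) : mulL (φ * ψ) f = mulL φ (mulL ψ f) := by
  apply Lp.ext
  filter_upwards [mulL_coeFn (φ * ψ) f, mulL_coeFn φ (mulL ψ f), mulL_coeFn ψ f] with s h1 h2 h3
  rw [h1, h2, h3, BoundedContinuousFunction.mul_apply, mul_assoc]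

lemma pair_mulL (φ : ℝ →ᵇ ℂ) (u v : L2) : pair (mulL φ u) v = pair u (mulL φ v) := by
  rw [pair_apply, pair_apply]
  apply integral_congr_ae
  filter_upwards [mulL_coeFn φ u, mulL_coeFn φ v] with s h1 h2
  rw [h1, h2]
  ring

lemma conjL_mulL (φ : ℝ →ᵇ ℂ) (u : L2) : conjL (mulL φ u) = mulL (star φ) (conjL u) := by
  apply Lp.ext
  filter_upwards [mulL_coeFn φ u, mulL_coeFn (star φ) (conjL u), conjL_coeFn u,
    conjL_coeFn (mulL φ u)] with s h1 h2 h3 h4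
  rw [h4, h1, h2, h3, map_mul]
  rfl

/-- The Cauchy kernel as a bounded continuous function. -/
def kerB (w : ℂ) (hw : w.im ≠ 0) : ℝ →ᵇ ℂ :=
  BoundedContinuousFunction.ofNormedAddCommGroup (ker w) (continuous_ker hw) |w.im|⁻¹
    (norm_ker_le w hw)

lemma kerB_apply (w : ℂ) (hw : w.im ≠ 0) (s : ℝ) : kerB w hw s = ker w s := rfl

/-! ### Totality of the Cauchy kernels -/

/-- The difference of the kernels at two conjugate points is a multiple of the Poisson kernel. -/
lemma ker_sub_ker (a ε s : ℝ) (hε : 0 < ε) :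
    ker (a + ε * I) s - ker (a - ε * I) s = 2 * I * ((ε / ((s - a) ^ 2 + ε ^ 2) : ℝ) : ℂ) := by
  have h1 : (s : ℂ) - (a + ε * I) ≠ 0 := ofReal_sub_ne_zero (by simp [hε.ne']) s
  have h2 : (s : ℂ) - (a - ε * I) ≠ 0 := ofReal_sub_ne_zero (by simp [hε.ne']) s
  have h3 : ((s : ℂ) - a) ^ 2 + ε ^ 2 = ((s : ℂ) - (a + ε * I)) * ((s : ℂ) - (a - ε * I)) := by
    ring_nf
    rw [Complex.I_sq]
    ring
  unfold ker
  push_cast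
  rw [h3]
  field_simp
  ring

/-- The substitution `a = s + εu` leaves `ε` only in the argument of `g`, ready for dominated
convergence. -/
lemma integral_poisson (g : ℝ → ℝ) (s ε : ℝ) (hε : 0 < ε) :
    ∫ a, g a * (ε / ((s - a) ^ 2 + ε ^ 2)) = ∫ u, g (s + ε * u) * (1 + u ^ 2)⁻¹ := by
  set G : ℝ → ℝ := fun a => g a * (ε / ((s - a) ^ 2 + ε ^ 2)) with hG
  have h1 := Measure.integral_comp_mul_left (fun u => G (s + u)) ε
  rw [integral_add_left_eq_self (fun u => G u) s] at h1
  have h2 : ∀ u, G (s + ε * u) = ε⁻¹ * (g (s + ε * u) * (1 + u ^ 2)⁻¹) := by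
    intro u
    have : (1 + u ^ 2) ≠ 0 := by positivity
    simp only [hG]
    have h3 : (s - (s + ε * u)) ^ 2 + ε ^ 2 = ε ^ 2 * (1 + u ^ 2) := by ring
    rw [h3]
    field_simp
  simp only [h2, integral_const_mul, abs_of_pos (inv_pos.2 hε), smul_eq_mul] at h1
  exact (mul_left_cancel₀ (inv_ne_zero hε.ne') h1).symm

/-- The hypothesis kills the Poisson averages of `A` at every height `ε < δ`. By Fubini the averages
may be moved to a test function `g`, which they approximate up to the factor `π` as `ε → 0`; so `∫ g
A = 0` for all `g`. -/
theorem ae_eq_zero_of_integral_mul_ker {A : ℝ → ℂ} (hA : Integrable A) {δ : ℝ} (hδ : 0 < δ)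
    (h : ∀ w : ℂ, w.im ≠ 0 → |w.im| < δ → ∫ s, A s * ker w s = 0) : ∀ᵐ s, A s = 0 := by
  refine ae_eq_zero_of_integral_contDiff_smul_eq_zero hA.locallyIntegrable fun g hg hgc => ?_
  have hgcont : Continuous g := hg.continuous
  have hgi : Integrable g := hgcont.integrable_of_hasCompactSupport hgc
  obtain ⟨M, hM⟩ := hgcont.bounded_above_of_compact_support hgc
  have hM0 : 0 ≤ M := (norm_nonneg _).trans (hM 0)
  have hP : ∀ ε, 0 < ε → ε < δ → ∫ s, (∫ u, g (s + ε * u) * (1 + u ^ 2)⁻¹ : ℝ) • A s = 0 := by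
    intro ε hε hεδ
    have hz : ∀ a : ℝ, ∫ s, A s * ((ε / ((s - a) ^ 2 + ε ^ 2) : ℝ) : ℂ) = 0 := by
      intro a
      have i1 : (a + ε * I : ℂ).im = ε := by simp
      have i2 : (a - ε * I : ℂ).im = -ε := by simp
      have n1 : (a + ε * I : ℂ).im ≠ 0 := by rw [i1]; exact hε.ne'
      have n2 : (a - ε * I : ℂ).im ≠ 0 := by rw [i2]; exact neg_ne_zero.2 hε.ne'
      have e1 := h (a + ε * I) n1 (by rwa [i1, abs_of_pos hε])
      have e2 := h (a - ε * I) n2 (by rwa [i2, abs_neg, abs_of_pos hε])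
      have ii : ∀ w : ℂ, w.im ≠ 0 → Integrable fun s => A s * ker w s := fun w hw =>
        hA.mul_bdd (c := |w.im|⁻¹) (continuous_ker hw).aestronglyMeasurable
          (Eventually.of_forall (norm_ker_le w hw))
      have e3 : ∫ s, A s * (ker (a + ε * I) s - ker (a - ε * I) s) = 0 := by
        simp_rw [mul_sub]
        rw [integral_sub (ii _ n1) (ii _ n2), e1, e2, sub_zero]
      simp_rw [ker_sub_ker a ε _ hε, mul_left_comm (A _), integral_const_mul] at e3
      exact (mul_eq_zero.1 e3).resolve_left (by simp)
    have hprod : Integrable (Function.uncurry fun s a : ℝ =>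
        ((g a * (ε / ((s - a) ^ 2 + ε ^ 2)) : ℝ) : ℂ) * A s) (volume.prod volume) := by
      have h0 : Integrable (fun p : ℝ × ℝ => A p.1 * (g p.2 : ℂ)) (volume.prod volume) :=
        hA.mul_prod hgi.ofReal
      have hne : ∀ p : ℝ × ℝ, (p.1 - p.2) ^ 2 + ε ^ 2 ≠ 0 := fun p => by positivity
      have hc : Continuous fun p : ℝ × ℝ => ((ε / ((p.1 - p.2) ^ 2 + ε ^ 2) : ℝ) : ℂ) := by
        refine continuous_ofReal.comp (Continuous.div continuous_const (by fun_prop) hne)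
      refine (h0.mul_bdd (c := ε⁻¹) hc.aestronglyMeasurable (Eventually.of_forall fun p => ?_)).congr
        (Eventually.of_forall fun p => ?_)
      · rw [Complex.norm_real, Real.norm_of_nonneg (by positivity), div_le_iff₀ (by positivity)]
        field_simp
        nlinarith [sq_nonneg (p.1 - p.2)]
      · simp only [Function.uncurry]
        push_cast
        ring
    simp_rw [← integral_poisson g _ ε hε, Complex.real_smul, ← integral_complex_ofReal,
      ← integral_mul_const]
    rw [integral_integral_swap hprod]
    have : ∀ a, ∫ s, ((g a * (ε / ((s - a) ^ 2 + ε ^ 2)) : ℝ) : ℂ) * A s = 0 := by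
      intro a
      have := congrArg (fun c => (g a : ℂ) * c) (hz a)
      simp only [mul_zero, ← integral_const_mul] at this
      rw [← this]
      congr 1
      funext s
      push_cast
      ring
    simp_rw [this, integral_zero]
  -- The heights `δ / (n + 2)` are positive, stay below `δ` from `n = 0` on, and tend to zero.
  have hlim : Tendsto (fun n : ℕ => ∫ s, (∫ u, g (s + (δ / (n + 2)) * u) * (1 + u ^ 2)⁻¹ : ℝ) • A s)
      atTop (𝓝 (∫ s, (g s * Real.pi) • A s)) := by
    have hε : Tendsto (fun n : ℕ => δ / ((n : ℝ) + 2)) atTop (𝓝 0) :=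
      tendsto_const_nhds.div_atTop (tendsto_atTop_add_const_right _ _ tendsto_natCast_atTop_atTop)
    have hbd : ∀ (ε s u : ℝ), ‖g (s + ε * u) * (1 + u ^ 2)⁻¹‖ ≤ M * (1 + u ^ 2)⁻¹ := by
      intro ε s u
      rw [norm_mul, Real.norm_of_nonneg (by positivity : (0 : ℝ) ≤ (1 + u ^ 2)⁻¹)]
      exact mul_le_mul_of_nonneg_right (hM _) (by positivity)
    have hcont : ∀ ε : ℝ, Continuous fun s => ∫ u, g (s + ε * u) * (1 + u ^ 2)⁻¹ := by
      intro ε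
      refine continuous_of_dominated (bound := fun u => M * (1 + u ^ 2)⁻¹) (fun s => ?_)
        (fun s => Eventually.of_forall (hbd ε s)) (integrable_inv_one_add_sq.const_mul M)
        (Eventually.of_forall fun u => by fun_prop)
      refine Continuous.aestronglyMeasurable ?_
      have : ∀ u : ℝ, 1 + u ^ 2 ≠ 0 := fun u => by positivity
      fun_prop (disch := assumption)
    refine tendsto_integral_of_dominated_convergence (fun s => M * Real.pi * ‖A s‖)
      (fun n => (hcont _).aestronglyMeasurable.smul hA.aestronglyMeasurable)
      (hA.norm.const_mul _) (fun n => Eventually.of_forall fun s => ?_)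
      (Eventually.of_forall fun s => ?_)
    · rw [norm_smul]
      refine mul_le_mul_of_nonneg_right ?_ (norm_nonneg _)
      calc _ ≤ ∫ u, M * (1 + u ^ 2)⁻¹ := norm_integral_le_of_norm_le
              (integrable_inv_one_add_sq.const_mul M) (Eventually.of_forall (hbd _ s))
        _ = M * Real.pi := by rw [integral_const_mul, integral_univ_inv_one_add_sq]
    · refine Tendsto.smul_const ?_ _
      rw [← integral_univ_inv_one_add_sq, ← integral_const_mul]
      refine tendsto_integral_of_dominated_convergence (fun u => M * (1 + u ^ 2)⁻¹)
        (fun n => ?_) (integrable_inv_one_add_sq.const_mul M)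
        (fun n => Eventually.of_forall (hbd _ s)) (Eventually.of_forall fun u => ?_)
      · refine Continuous.aestronglyMeasurable ?_
        have : ∀ u : ℝ, 1 + u ^ 2 ≠ 0 := fun u => by positivity
        fun_prop (disch := assumption)
      · refine Tendsto.mul_const _ ?_
        have : Tendsto (fun n : ℕ => s + δ / ((n : ℝ) + 2) * u) atTop (𝓝 (s + 0 * u)) :=
          (hε.mul_const u).const_add s
        rw [zero_mul, add_zero] at this
        exact (hgcont.tendsto s).comp this
  have h0 : ∀ n : ℕ, ∫ s, (∫ u, g (s + (δ / (n + 2)) * u) * (1 + u ^ 2)⁻¹ : ℝ) • A s = 0 := by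
    intro n
    refine hP _ (by positivity) ?_
    rw [div_lt_iff₀ (by positivity)]
    have : (0 : ℝ) ≤ n := Nat.cast_nonneg n
    nlinarith
  have h1 : ∫ s, (g s * Real.pi) • A s = 0 :=
    tendsto_nhds_unique hlim (by simp_rw [h0]; exact tendsto_const_nhds)
  simp_rw [mul_comm (g _), mul_smul, integral_smul] at h1
  exact (smul_eq_zero.1 h1).resolve_left Real.pi_ne_zero

lemma kerB_mul_kerL {a b : ℂ} (ha : a.im ≠ 0) (hb : b.im ≠ 0) (hab : a ≠ b) :
    mulL (kerB a ha) (kerL b hb) = (a - b)⁻¹ • (kerL a ha - kerL b hb) := by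
  apply Lp.ext
  filter_upwards [mulL_coeFn (kerB a ha) (kerL b hb), coeFn_kerL a ha, coeFn_kerL b hb,
    Lp.coeFn_smul (a - b)⁻¹ (kerL a ha - kerL b hb), Lp.coeFn_sub (kerL a ha) (kerL b hb)]
    with s h1 h2 h3 h4 h5
  rw [h1, h4, Pi.smul_apply, h5, Pi.sub_apply, h2, h3, kerB_apply, ker_mul_ker ha hb hab,
    smul_eq_mul]

lemma pair_kerL (u : L2) (w : ℂ) (hw : w.im ≠ 0) : pair u (kerL w hw) = ∫ s, u s * ker w s := by
  rw [pair_apply]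
  apply integral_congr_ae
  filter_upwards [coeFn_kerL w hw] with s h
  rw [h]

/-- An `L²` function need not be integrable, so `u` is first multiplied by one fixed kernel; partial
fractions carry the hypothesis over to the product. -/
theorem eq_zero_of_pair_kerL {u : L2} {δ : ℝ} (hδ : 0 < δ)
    (h : ∀ (w : ℂ) (hw : w.im ≠ 0), |w.im| < δ → pair u (kerL w hw) = 0) : u = 0 := by
  set a : ℂ := (δ / 2 : ℝ) * I with ha
  have hai : a.im = δ / 2 := by simp [ha]
  have ha0 : a.im ≠ 0 := by rw [hai]; positivity
  have hint : Integrable fun s => u s * ker a s := by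
    refine (integrable_mul_L2 u (kerL a ha0)).congr ?_
    filter_upwards [coeFn_kerL a ha0] with s h
    rw [h]
  -- Halving the strip keeps `w` away from the fixed pole `iδ/2`, where partial fractions would
  -- fail.
  have key := ae_eq_zero_of_integral_mul_ker hint (half_pos hδ) fun w hw hwδ => by
    have hne : a ≠ w := by
      rintro rfl
      rw [hai, abs_of_pos (half_pos hδ)] at hwδ
      exact lt_irrefl _ hwδ
    have h1 := congrArg (pair u) (kerB_mul_kerL ha0 hw hne)
    rw [map_smul, map_sub, h a ha0 (by rw [hai, abs_of_pos (half_pos hδ)]; linarith),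
      h w hw (by linarith), sub_zero, smul_zero, pair_apply] at h1
    rw [← h1]
    apply integral_congr_ae
    filter_upwards [mulL_coeFn (kerB a ha0) (kerL w hw), coeFn_kerL w hw] with s h2 h3
    rw [h2, h3, kerB_apply, mul_assoc]
  apply Lp.ext
  filter_upwards [key, Lp.coeFn_zero ℂ 2 (volume : Measure ℝ)] with s h1 h2
  rw [h2]
  exact (mul_eq_zero.1 h1).resolve_right (inv_ne_zero (ofReal_sub_ne_zero ha0 s))

lemma dense_span_kerL {δ : ℝ} (hδ : 0 < δ) :
    Dense (Submodule.span ℂ {f : L2 | ∃ (w : ℂ) (hw : w.im ≠ 0), |w.im| < δ ∧ f = kerL w hw} :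
      Set L2) := by
  rw [Submodule.dense_iff_topologicalClosure_eq_top, Submodule.topologicalClosure_eq_top_iff,
    Submodule.eq_bot_iff]
  intro u hu
  refine eq_zero_of_pair_kerL hδ fun w hw hwδ => ?_
  have hw' : (conj w).im ≠ 0 := by simpa using hw
  have h1 := (Submodule.mem_orthogonal _ _).1 hu (kerL (conj w) hw')
    (Submodule.subset_span ⟨conj w, hw', by simpa using hwδ, rfl⟩)
  rw [inner_eq_pair, conjL_kerL] at h1
  simp only [Complex.conj_conj] at h1
  rwa [pair_comm]

/-- Two bounded (semi)linear maps agree if they agree on the Cauchy kernels with poles near the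
real line. -/
theorem clm_ext {F : Type*} [NormedAddCommGroup F] [NormedSpace ℂ F] {σ : ℂ →+* ℂ}
    {T₁ T₂ : L2 →SL[σ] F} {δ : ℝ} (hδ : 0 < δ)
    (hn : ∀ (w : ℂ) (hw : w.im < 0), |w.im| < δ → T₁ (kerL w hw.ne) = T₂ (kerL w hw.ne))
    (hp : ∀ (w : ℂ) (hw : 0 < w.im), |w.im| < δ → T₁ (kerL w hw.ne') = T₂ (kerL w hw.ne')) :
    T₁ = T₂ := by
  refine ContinuousLinearMap.ext_on (dense_span_kerL hδ) ?_
  rintro _ ⟨w, hw, hwδ, rfl⟩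
  rcases lt_or_gt_of_ne hw with h | h
  · exact hn w h hwδ
  · exact hp w h hwδ

/-! ### Algebra of the Cauchy projectors -/

lemma Cp_sub_Cm (u : L2) : Cp u - Cm u = u := by
  have : Cp - Cm = ContinuousLinearMap.id ℂ L2 := by
    refine clm_ext one_pos (fun w hw _ => ?_) (fun w hw _ => ?_)
    · simp [Cp_kerL_of_neg hw, Cm_kerL_of_neg hw]
    · simp [Cp_kerL_of_pos hw, Cm_kerL_of_pos hw]
  simpa using DFunLike.congr_fun this u

lemma Cm_eq (u : L2) : Cm u = Cp u - u := by
  rw [eq_sub_iff_add_eq, ← eq_sub_iff_add_eq']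
  exact (Cp_sub_Cm u).symm

lemma Cp_Cp (u : L2) : Cp (Cp u) = Cp u := by
  have : Cp.comp Cp = Cp := by
    refine clm_ext one_pos (fun w hw _ => ?_) (fun w hw _ => ?_)
    · simp [Cp_kerL_of_neg hw]
    · simp [Cp_kerL_of_pos hw]
  simpa using DFunLike.congr_fun this u

lemma Cm_Cp (u : L2) : Cm (Cp u) = 0 := by rw [Cm_eq, Cp_Cp, sub_self]

lemma Cp_Cm (u : L2) : Cp (Cm u) = 0 := by rw [Cm_eq, map_sub, Cp_Cp, sub_self]

/-- Conjugation reflects the poles across the line and so exchanges the two half-planes; the sign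
appears because `C⁻` is minus a projection. -/
lemma conjL_Cp (u : L2) : conjL (Cp u) = -Cm (conjL u) := by
  have : conjL.comp Cp = -(Cm.comp conjL) := by
    refine clm_ext one_pos (fun w hw _ => ?_) (fun w hw _ => ?_)
    · have hw' : 0 < (conj w).im := by simpa using hw
      simp [Cp_kerL_of_neg hw, conjL_kerL, Cm_kerL_of_pos hw']
    · have hw' : (conj w).im < 0 := by simpa using hw
      simp [Cp_kerL_of_pos hw, conjL_kerL, Cm_kerL_of_neg hw']
  simpa using DFunLike.congr_fun this u

lemma conjL_Cm (u : L2) : conjL (Cm u) = -Cp (conjL u) := by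
  have := congrArg conjL (conjL_Cp (conjL u))
  rw [conjL_conjL, conjL_conjL, map_neg] at this
  rw [this, neg_neg]

/-- Self-adjointness of `C⁺` read through the bilinear pairing, where conjugation turns `C⁺` into
`-C⁻`. -/
lemma pair_Cp (u v : L2) : pair (Cp u) v = -pair u (Cm v) := by
  have h1 : Cp u = -conjL (Cm (conjL u)) := by rw [conjL_Cm, conjL_conjL, neg_neg]
  rw [h1, map_neg, neg_apply, ← inner_eq_pair, Cm_eq, inner_sub_left, inner_Cp,
    ← inner_sub_right, ← Cm_eq, inner_eq_pair, conjL_conjL]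

lemma pair_Cm (u v : L2) : pair (Cm u) v = -pair u (Cp v) := by
  rw [pair_comm, pair_comm u, pair_Cp, neg_neg]

/-- This is Cauchy's theorem: the product of two boundary values from the same half-plane has
integral zero. -/
lemma pair_Cp_Cp (u v : L2) : pair (Cp u) (Cp v) = 0 := by
  rw [pair_Cp, Cm_Cp, map_zero, neg_zero]

lemma pair_Cm_Cm (u v : L2) : pair (Cm u) (Cm v) = 0 := by
  rw [pair_Cm, Cp_Cm, map_zero, neg_zero]

/-- The value is a residue, obtained here from Plancherel and an exponential integral on the
half-line rather than from a contour. -/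
lemma pair_kerL_kerL {a b : ℂ} (ha : 0 < a.im) (hb : b.im < 0) :
    pair (kerL a ha.ne') (kerL b hb.ne) = 2 * Real.pi * I / (a - b) := by
  have ha' : (conj a).im < 0 := by simpa using ha
  have hpi : (Real.pi : ℂ) ≠ 0 := by exact_mod_cast Real.pi_ne_zero
  have hne : a - b ≠ 0 := by
    intro h
    have := congrArg Complex.im h
    simp at this
    linarith
  have h1 : pair (kerL a ha.ne') (kerL b hb.ne) = inner ℂ (kerL (conj a) ha'.ne) (kerL b hb.ne) := by
    rw [inner_eq_pair, conjL_kerL]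
    simp only [Complex.conj_conj]
  rw [h1, ← Lp.inner_fourier_eq, fourier_kerL, fourier_kerL, L2.inner_def]
  have h2 : ∀ᵐ ξ : ℝ, inner ℂ ((memLp_kerHat ha'.ne).toLp (kerHat (conj a)) ξ)
      ((memLp_kerHat hb.ne).toLp (kerHat b) ξ)
      = (Set.Ioi (0 : ℝ)).indicator (fun ξ : ℝ => (4 * Real.pi ^ 2 : ℂ) *
        exp ((2 * Real.pi * I * (a - b)) * ξ)) ξ := by
    filter_upwards [(memLp_kerHat ha'.ne).coeFn_toLp, (memLp_kerHat hb.ne).coeFn_toLp] with ξ e1 e2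
    rw [e1, e2, kerHat, if_pos ha', kerHat, if_pos hb, RCLike.inner_apply]
    by_cases hξ : ξ ∈ Set.Ioi (0 : ℝ)
    · simp only [Set.indicator_of_mem hξ]
      have : (4 * Real.pi ^ 2 : ℂ) = (-(2 * Real.pi * I)) * conj (-(2 * Real.pi * I) : ℂ) := by
        simp only [map_neg, map_mul, Complex.conj_I, Complex.conj_ofReal, map_ofNat]
        ring_nf
        rw [Complex.I_sq]
        ring
      rw [map_mul, ← Complex.exp_conj, this, mul_mul_mul_comm, ← Complex.exp_add]
      congr 2
      simp only [map_neg, map_mul, Complex.conj_I, Complex.conj_ofReal, map_ofNat,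
        Complex.conj_conj]
      ring
    · simp [Set.indicator_of_notMem hξ]
  rw [integral_congr_ae h2, integral_indicator measurableSet_Ioi, integral_const_mul,
    integral_exp_mul_complex_Ioi]
  · simp only [ofReal_zero, mul_zero, Complex.exp_zero]
    field_simp
    ring_nf
    simp
  · rw [re_two_pi_I_mul]
    simp only [sub_im]
    nlinarith [Real.pi_pos]

/-- Commutator of `C⁺` with multiplication by a Cauchy kernel. -/
theorem Cp_kerB_mul (w : ℂ) (hw : w.im ≠ 0) (k : L2) :
    Cp (mulL (kerB w hw) k)
      = mulL (kerB w hw) (Cp k) - ((2 * Real.pi * I)⁻¹ * pair (kerL w hw) k) • kerL w hw := by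
  have hpi : (2 * Real.pi * I : ℂ) ≠ 0 := by
    simp [Real.pi_ne_zero]
  have hlow : ∀ a b : L2, Cp a = a → Cp b = b → pair a b = 0 := fun a b h1 h2 => by
    rw [← h1, ← h2, pair_Cp_Cp]
  have hup : ∀ a b : L2, Cm a = -a → Cm b = -b → pair a b = 0 := fun a b h1 h2 => by
    rw [← neg_neg a, ← neg_neg b, ← h1, ← h2, map_neg, map_neg, neg_apply,
      pair_Cm_Cm, neg_zero, neg_zero]
  have hne : ∀ v : ℂ, |v.im| < |w.im| → w ≠ v := by
    rintro v hv rfl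
    exact lt_irrefl _ hv
  have : Cp.comp (mulL (kerB w hw)) = (mulL (kerB w hw)).comp Cp
      - (2 * Real.pi * I : ℂ)⁻¹ • (pair (kerL w hw)).smulRight (kerL w hw) := by
    -- Testing only on poles `v` closer to the line than `w` excludes the double pole `v = w`.
    refine clm_ext (abs_pos.2 hw) (fun v hv hvw => ?_) (fun v hv hvw => ?_)
    · have hwv := sub_ne_zero.2 (hne v hvw)
      simp only [ContinuousLinearMap.comp_apply, sub_apply,
        smul_apply, ContinuousLinearMap.smulRight_apply, Cp_kerL_of_neg hv,
        kerB_mul_kerL hw hv.ne (hne v hvw), map_smul, map_sub]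
      rcases lt_or_gt_of_ne hw with h | h
      · rw [Cp_kerL_of_neg h, hlow _ _ (Cp_kerL_of_neg h) (Cp_kerL_of_neg hv), zero_smul,
          smul_zero, sub_zero]
      · rw [Cp_kerL_of_pos h, pair_kerL_kerL h hv, smul_smul,
          show (2 * Real.pi * I : ℂ)⁻¹ * (2 * Real.pi * I / (w - v)) = (w - v)⁻¹ by field_simp,
          ← smul_sub]
        congr 1
        abel
    · have hwv := sub_ne_zero.2 (hne v hvw)
      simp only [ContinuousLinearMap.comp_apply, sub_apply,
        smul_apply, ContinuousLinearMap.smulRight_apply, Cp_kerL_of_pos hv,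
        kerB_mul_kerL hw hv.ne' (hne v hvw), map_smul, map_sub, map_zero]
      rcases lt_or_gt_of_ne hw with h | h
      · have hvw' : v - w ≠ 0 := by rw [← neg_sub]; exact neg_ne_zero.2 hwv
        rw [Cp_kerL_of_neg h, pair_comm, pair_kerL_kerL hv h, smul_smul,
          show (2 * Real.pi * I : ℂ)⁻¹ * (2 * Real.pi * I / (v - w)) = -(w - v)⁻¹ by
            rw [← neg_sub v w, inv_neg, neg_neg]; field_simp]
        module
      · rw [Cp_kerL_of_pos h, hup _ _ (Cm_kerL_of_pos h) (Cm_kerL_of_pos hv)]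
        simp
  have h := DFunLike.congr_fun this k
  simpa [smul_smul] using h

/-! ### Multiplication by the independent variable -/

/-- The functional `u ↦ (2πi)⁻¹ ∫ u`. -/
def kap (u : L2) : ℂ := (2 * Real.pi * I)⁻¹ * ∫ s, u s

/-- `u₁` is the product of `u₀` and the independent variable. -/
def IsMulX (u₀ u₁ : L2) : Prop := ∀ᵐ s : ℝ, u₁ s = s * u₀ s

lemma I_im_ne : (I : ℂ).im ≠ 0 := by simp

lemma two_pi_I_ne : (2 * Real.pi * I : ℂ) ≠ 0 := by simp [Real.pi_ne_zero]

variable {u₀ u₁ : L2}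

lemma IsMulX.eq_kerB_mul (h : IsMulX u₀ u₁) : u₀ = mulL (kerB I I_im_ne) (u₁ - I • u₀) := by
  apply Lp.ext
  filter_upwards [h, mulL_coeFn (kerB I I_im_ne) (u₁ - I • u₀), Lp.coeFn_sub u₁ (I • u₀),
    Lp.coeFn_smul I u₀] with s h1 h2 h3 h4
  have := ofReal_sub_ne_zero I_im_ne s
  rw [h2, h3, Pi.sub_apply, h4, Pi.smul_apply, h1, kerB_apply, ker, smul_eq_mul]
  field_simp

lemma IsMulX.ae_eq_mul (h : IsMulX u₀ u₁) :
    ∀ᵐ s, kerL I I_im_ne s * (u₁ - I • u₀) s = u₀ s := by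
  filter_upwards [mulL_coeFn (kerB I I_im_ne) (u₁ - I • u₀), coeFn_kerL I I_im_ne] with s h1 h2
  conv_rhs => rw [h.eq_kerB_mul]
  rw [h1, h2, kerB_apply]

lemma IsMulX.integrable (h : IsMulX u₀ u₁) : Integrable u₀ :=
  (integrable_mul_L2 (kerL I I_im_ne) (u₁ - I • u₀)).congr h.ae_eq_mul

lemma IsMulX.pair_eq (h : IsMulX u₀ u₁) : pair (kerL I I_im_ne) (u₁ - I • u₀) = ∫ s, u₀ s := by
  rw [pair_apply]
  exact integral_congr_ae h.ae_eq_mul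

lemma IsMulX.kap_eq (h : IsMulX u₀ u₁) :
    kap u₀ = (2 * Real.pi * I)⁻¹ * pair (kerL I I_im_ne) (u₁ - I • u₀) := by
  rw [h.pair_eq, kap]

/-- Multiplication by `s` commutes with `C⁺` up to the rank-one term `kap`. Since that
multiplication is unbounded, the relation is drawn from the bounded commutator `Cp_kerB_mul`, after
writing `u₀ = (s - i)⁻¹ (u₁ - i u₀)`. -/
lemma IsMulX.mul_Cp (h : IsMulX u₀ u₁) : ∀ᵐ s : ℝ, s * Cp u₀ s = Cp u₁ s - kap u₀ := by
  have h1 := Cp_kerB_mul I I_im_ne (u₁ - I • u₀)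
  rw [← h.eq_kerB_mul, ← h.kap_eq, map_sub, map_smul] at h1
  filter_upwards [Lp.coeFn_sub (mulL (kerB I I_im_ne) (Cp u₁ - I • Cp u₀))
    (kap u₀ • kerL I I_im_ne), Lp.coeFn_smul (kap u₀) (kerL I I_im_ne), coeFn_kerL I I_im_ne,
    mulL_coeFn (kerB I I_im_ne) (Cp u₁ - I • Cp u₀), Lp.coeFn_sub (Cp u₁) (I • Cp u₀),
    Lp.coeFn_smul I (Cp u₀)] with s e1 e2 e3 e4 e5 e6
  rw [← h1, Pi.sub_apply, e2, Pi.smul_apply, e3, e4, e5, Pi.sub_apply, e6, Pi.smul_apply,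
    kerB_apply, ker, smul_eq_mul, smul_eq_mul] at e1
  have hs := ofReal_sub_ne_zero I_im_ne s
  field_simp at e1
  linear_combination e1

lemma IsMulX.mul_Cm (h : IsMulX u₀ u₁) : ∀ᵐ s : ℝ, s * Cm u₀ s = Cm u₁ s - kap u₀ := by
  rw [Cm_eq, Cm_eq]
  filter_upwards [h.mul_Cp, h, Lp.coeFn_sub (Cp u₀) u₀, Lp.coeFn_sub (Cp u₁) u₁]
    with s h1 h2 h3 h4
  rw [h3, h4, Pi.sub_apply, Pi.sub_apply, mul_sub, h1, h2]
  ring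

/-- If `C⁺` commuted with `s`, then `⟨s u₀, C⁺ u₀⟩` would be real; its imaginary part comes from the
rank-one commutator alone. Both the vanishing lemma and the determinant relation rest on this. -/
lemma IsMulX.pair_conjL_Cp (h : IsMulX u₀ u₁) :
    pair (conjL u₁) (Cp u₀) = conj (pair (conjL u₁) (Cp u₀))
      + 2 * Real.pi * I * (kap u₀ * conj (kap u₀)) := by
  have h1 : conj (pair (conjL u₁) (Cp u₀)) = pair (conjL u₀) (Cp u₁) := by
    rw [← inner_eq_pair, ← inner_eq_pair, inner_conj_symm, inner_Cp]
  have hint : Integrable fun s => conj (u₀ s) := by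
    exact (Complex.conjCLE.toContinuousLinearMap.integrable_comp h.integrable)
  have h2 : pair (conjL u₁) (Cp u₀) = pair (conjL u₀) (Cp u₁) - (∫ s, conj (u₀ s)) * kap u₀ := by
    rw [pair_apply, pair_apply, ← integral_mul_const, ← integral_sub (integrable_mul_L2 _ _)
      (hint.mul_const _)]
    apply integral_congr_ae
    filter_upwards [conjL_coeFn u₁, conjL_coeFn u₀, h, h.mul_Cp] with s e1 e2 e3 e4
    rw [e1, e2, e3, map_mul, Complex.conj_ofReal]
    linear_combination conj (u₀ s) * e4
  have h3 : ∫ s, u₀ s = 2 * Real.pi * I * kap u₀ := by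
    rw [kap, mul_inv_cancel_left₀ two_pi_I_ne]
  rw [h1, h2, integral_conj, h3]
  simp only [map_mul, Complex.conj_I, Complex.conj_ofReal, map_ofNat]
  ring

/-! ### Compactness of Hankel operators -/

lemma tendsto_ker_cocompact (w : ℂ) : Tendsto (ker w) (coclosedCompact ℝ) (𝓝 0) := by
  rw [coclosedCompact_eq_cocompact]
  refine tendsto_inv₀_cobounded.comp ?_
  rw [← tendsto_norm_atTop_iff_cobounded]
  refine tendsto_atTop_mono (fun s : ℝ => ?_)
    (tendsto_atTop_add_const_right _ (-‖w‖) (tendsto_norm_cocompact_atTop (E := ℝ)))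
  have := norm_sub_norm_le (s : ℂ) w
  rw [Complex.norm_real] at this
  linarith

/-- The Cauchy kernel on the one-point compactification of the line. -/
def kerO (w : ℂ) (hw : w.im ≠ 0) : C(OnePoint ℝ, ℂ) :=
  OnePoint.continuousMapMk ⟨ker w, continuous_ker hw⟩ 0 (tendsto_ker_cocompact w)

/-- Restriction to the line of a continuous function on the one-point compactification. -/
def restr (φ : C(OnePoint ℝ, ℂ)) : ℝ →ᵇ ℂ :=
  (BoundedContinuousFunction.mkOfCompact φ).compContinuous ⟨_, OnePoint.continuous_coe⟩

lemma norm_restr_le (φ : C(OnePoint ℝ, ℂ)) : ‖restr φ‖ ≤ ‖φ‖ := by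
  rw [BoundedContinuousFunction.norm_le (norm_nonneg _)]
  exact fun s => φ.norm_coe_le_norm _

/-- The commutator of `C⁺` with multiplication by `φ`. -/
def commCp (φ : ℝ →ᵇ ℂ) : L2 →L[ℂ] L2 := Cp.comp (mulL φ) - (mulL φ).comp Cp

/-- By `Cp_kerB_mul` this commutator has rank at most one. -/
lemma isCompactOperator_commCp_kerB (w : ℂ) (hw : w.im ≠ 0) :
    IsCompactOperator (commCp (kerB w hw)) := by
  have h : commCp (kerB w hw) = (ContinuousLinearMap.toSpanSingleton ℂ (kerL w hw)).comp
      (-(2 * Real.pi * I : ℂ)⁻¹ • pair (kerL w hw)) := by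
    ext1 k
    simp only [commCp, sub_apply, ContinuousLinearMap.comp_apply, Cp_kerB_mul]
    simp [ContinuousLinearMap.toSpanSingleton_apply]
  rw [h]
  exact (isCompactOperator_of_locallyCompactSpace_rng
    (ContinuousLinearMap.toSpanSingleton ℂ (kerL w hw))).comp_clm _

/-- The commutator satisfies the Leibniz rule, and compact operators form an ideal. -/
lemma isCompactOperator_commCp_mul {φ ψ : ℝ →ᵇ ℂ} (hφ : IsCompactOperator (commCp φ))
    (hψ : IsCompactOperator (commCp ψ)) : IsCompactOperator (commCp (φ * ψ)) := by
  have h : ⇑(commCp (φ * ψ)) = ⇑(commCp φ) ∘ ⇑(mulL ψ) + ⇑(mulL φ) ∘ ⇑(commCp ψ) := by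
    funext k
    simp [commCp, mulL_mul]
  rw [h]
  exact (hφ.comp_clm _).add (hψ.clm_comp _)

/-- The symbols with compact commutator form a closed algebra. It contains the constants and the
kernels at `±i`, which separate the points of the compactified line, so Stone–Weierstrass applies.
-/
lemma isCompactOperator_commCp_restr (φ : C(OnePoint ℝ, ℂ)) :
    IsCompactOperator (commCp (restr φ)) := by
  set r := kerO I I_im_ne
  have hstar : star r = kerO (-I) (by simp) := by
    ext x
    induction x using OnePoint.rec with
    | infty => exact map_zero (starRingEnd ℂ)
    | coe s => exact (conj_ker I s).trans (by rw [Complex.conj_I]; rfl)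
  have hadj : ∀ ψ ∈ StarAlgebra.adjoin ℂ {r}, IsCompactOperator (commCp (restr ψ)) := by
    intro ψ hψ
    rw [← StarSubalgebra.mem_toSubalgebra, StarAlgebra.adjoin_toSubalgebra] at hψ
    induction hψ using Algebra.adjoin_induction with
    | mem x hx =>
      rcases hx with hx | hx
      · rw [Set.mem_singleton_iff.1 hx]
        exact isCompactOperator_commCp_kerB I I_im_ne
      · have : x = kerO (-I) (by simp) := by
          rw [← hstar, ← star_star x, Set.mem_singleton_iff.1 hx]
        rw [this]
        exact isCompactOperator_commCp_kerB (-I) (by simp)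
    | algebraMap c =>
      have : commCp (restr (algebraMap ℂ C(OnePoint ℝ, ℂ) c)) = 0 := by
        have h0 : ∀ u : L2, mulL (restr (algebraMap ℂ C(OnePoint ℝ, ℂ) c)) u = c • u := by
          intro u
          apply Lp.ext
          filter_upwards [mulL_coeFn (restr (algebraMap ℂ C(OnePoint ℝ, ℂ) c)) u,
            Lp.coeFn_smul c u] with s h1 h2
          rw [h1, h2]
          rfl
        ext1 u
        simp [commCp, h0]
      rw [this]
      exact isCompactOperator_zero
    | add x y _ _ hx hy =>
      have : ⇑(commCp (restr (x + y))) = ⇑(commCp (restr x)) + ⇑(commCp (restr y)) := by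
        have h0 : restr (x + y) = restr x + restr y := rfl
        funext u
        simp [commCp, h0]
        abel
      rw [this]
      exact hx.add hy
    | mul x y _ _ hx hy =>
      have h0 : restr (x * y) = restr x * restr y := by
        ext s
        rfl
      rw [h0]
      exact isCompactOperator_commCp_mul hx hy
  have hcont : Continuous fun ψ : C(OnePoint ℝ, ℂ) => commCp (restr ψ) := by
    have h1 : Continuous restr := by
      refine (LipschitzWith.of_dist_le_mul (K := 1) fun x y => ?_).continuous
      rw [dist_eq_norm, dist_eq_norm, NNReal.coe_one, one_mul]
      exact norm_restr_le (x - y)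
    have h2 : Continuous fun ψ : C(OnePoint ℝ, ℂ) => mulL (restr ψ) := mulL.continuous.comp h1
    exact (continuous_const.clm_comp h2).sub (h2.clm_comp continuous_const)
  have hsep : (StarAlgebra.adjoin ℂ {r}).SeparatesPoints := by
    intro x y hxy
    refine ⟨r, ⟨r, StarAlgebra.subset_adjoin ℂ {r} (Set.mem_singleton r), rfl⟩, ?_⟩
    have hinf : r OnePoint.infty = 0 := rfl
    have hcoe : ∀ s : ℝ, r (s : OnePoint ℝ) = ((s : ℂ) - I)⁻¹ := fun s => rfl
    have hne : ∀ s : ℝ, ((s : ℂ) - I)⁻¹ ≠ 0 := fun s =>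
      inv_ne_zero (ofReal_sub_ne_zero I_im_ne s)
    induction x using OnePoint.rec with
    | infty =>
      induction y using OnePoint.rec with
      | infty => exact absurd rfl hxy
      | coe s => rw [hinf, hcoe]; exact (hne s).symm
    | coe s =>
      induction y using OnePoint.rec with
      | infty => rw [hinf, hcoe]; exact hne s
      | coe t =>
        intro h
        apply hxy
        rw [hcoe, hcoe, inv_inj, sub_left_inj] at h
        rw [Complex.ofReal_injective h]
  have htop := ContinuousMap.starSubalgebra_topologicalClosure_eq_top_of_separatesPoints _ hsep
  have hmem : φ ∈ closure (StarAlgebra.adjoin ℂ {r} : Set C(OnePoint ℝ, ℂ)) := by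
    rw [← StarSubalgebra.topologicalClosure_coe, htop]
    exact Set.mem_univ φ
  have hclosed : IsClosed {ψ : C(OnePoint ℝ, ℂ) | IsCompactOperator (commCp (restr ψ))} :=
    (isClosed_setOfPred_isCompactOperator (σ₁₂ := RingHom.id ℂ) (M₁ := L2) (M₂ := L2)).preimage
      hcont
  exact closure_minimal hadj hclosed hmem

/-- Hankel operators with continuous symbols vanishing at infinity are compact. -/
theorem isCompactOperator_hankel (φ : ℝ →ᵇ ℂ) (hφ : Tendsto φ (cocompact ℝ) (𝓝 0)) :
    IsCompactOperator (Cm.comp ((mulL φ).comp Cp)) := by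
  have h1 : φ = restr (OnePoint.continuousMapMk φ.toContinuousMap 0
      (by rw [coclosedCompact_eq_cocompact]; exact hφ)) := by
    ext s
    rfl
  have h2 := isCompactOperator_commCp_restr (OnePoint.continuousMapMk φ.toContinuousMap 0
      (by rw [coclosedCompact_eq_cocompact]; exact hφ))
  rw [← h1] at h2
  -- Because `C⁻C⁺ = 0`, only the commutator survives under `C⁻`.
  have h3 : ⇑(Cm.comp ((mulL φ).comp Cp)) = -(⇑Cm ∘ ⇑(commCp φ)) := by
    funext u
    simp [commCp, Cm_Cp]
  rw [h3]
  exact (h2.clm_comp Cm).neg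

/-! ### Hardy functions vanishing on a half-line -/

lemma pair_kerL_of_Cp_eq_zero {u : L2} (hu : Cp u = 0) {w : ℂ} (hw : 0 < w.im) :
    pair u (kerL w hw.ne') = 0 := by
  have h1 : u = -Cm u := by rw [Cm_eq, hu, zero_sub, neg_neg]
  have h2 : kerL w hw.ne' = -Cm (kerL w hw.ne') := by rw [Cm_kerL_of_pos hw, neg_neg]
  rw [h1, h2, map_neg, map_neg, neg_apply, pair_Cm_Cm, neg_zero, neg_zero]

/-- Differentiation under the integral over `(0, ∞)`: near a point off the closed half-line `[0, ∞)`
every kernel is dominated by a multiple of the one at `i`, which is square-integrable. -/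
lemma differentiableOn_integral_ker (u : L2) :
    DifferentiableOn ℂ (fun z => ∫ s in Set.Ioi (0 : ℝ), u s * ker z s) {z | -z ∈ slitPlane} := by
  intro z₀ hz₀
  refine DifferentiableAt.differentiableWithinAt ?_
  have hopen : IsOpen {z : ℂ | -z ∈ slitPlane} := isOpen_slitPlane.preimage continuous_neg
  obtain ⟨r, hr, hball⟩ := Metric.isOpen_iff.1 hopen z₀ hz₀
  have hdist : ∀ s : ℝ, 0 < s → ∀ z ∈ Metric.ball z₀ (r / 2), r / 2 ≤ ‖(s : ℂ) - z‖ := by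
    intro s hs z hz
    by_contra! h
    have h1 : (s : ℂ) ∈ Metric.ball z₀ r := by
      rw [Metric.mem_ball, dist_eq_norm] at hz ⊢
      calc ‖(s : ℂ) - z₀‖ = ‖((s : ℂ) - z) + (z - z₀)‖ := by ring_nf
        _ ≤ ‖(s : ℂ) - z‖ + ‖z - z₀‖ := norm_add_le _ _
        _ < r := by linarith
    have h2 := hball h1
    rw [Set.mem_ofPred_eq, mem_slitPlane_iff] at h2
    simp at h2
    linarith
  set K : ℝ := 1 + (‖z₀‖ + r + 1) / (r / 2) with hK
  have hK1 : 0 ≤ K := by positivity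
  have hker : ∀ s : ℝ, 0 < s → ∀ z ∈ Metric.ball z₀ (r / 2), ‖ker z s‖ ≤ K * ‖ker I s‖ := by
    intro s hs z hz
    have h1 := hdist s hs z hz
    have h2 : 0 < ‖(s : ℂ) - z‖ := by linarith
    have h3 : 0 < ‖(s : ℂ) - I‖ := norm_pos_iff.2 (ofReal_sub_ne_zero I_im_ne s)
    rw [ker, ker, norm_inv, norm_inv, ← div_eq_mul_inv, le_div_iff₀ h3, inv_mul_le_iff₀ h2]
    have h4 : ‖z‖ ≤ ‖z₀‖ + r := by
      rw [Metric.mem_ball, dist_eq_norm] at hz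
      have := norm_le_norm_add_norm_sub z₀ z
      rw [norm_sub_rev] at this
      linarith
    have h5 : ‖(s : ℂ) - I‖ ≤ ‖(s : ℂ) - z‖ + (‖z‖ + 1) := by
      calc ‖(s : ℂ) - I‖ = ‖((s : ℂ) - z) + (z - I)‖ := by ring_nf
        _ ≤ ‖(s : ℂ) - z‖ + ‖z - I‖ := norm_add_le _ _
        _ ≤ _ := by
          have := norm_sub_le z I
          rw [Complex.norm_I] at this
          linarith
    have h6 : ‖z₀‖ + r + 1 ≤ ‖(s : ℂ) - z‖ * ((‖z₀‖ + r + 1) / (r / 2)) := by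
      rw [mul_div_assoc', le_div_iff₀ (by positivity), mul_comm]
      exact mul_le_mul_of_nonneg_right h1 (by positivity)
    rw [hK, mul_add, mul_one]
    linarith
  have hmeas : ∀ z ∈ Metric.ball z₀ (r / 2), ∀ F : ℂ → ℂ, ContinuousOn F {z | z ≠ 0} →
      AEStronglyMeasurable (fun s : ℝ => F ((s : ℂ) - z)) (volume.restrict (Set.Ioi (0 : ℝ))) := by
    intro z hz F hF
    refine ContinuousOn.aestronglyMeasurable ?_ measurableSet_Ioi
    refine hF.comp (by fun_prop) fun s hs h => ?_
    have := hdist s hs z hz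
    rw [show (s : ℂ) - z = 0 from h, norm_zero] at this
    linarith
  have hu := (Lp.aestronglyMeasurable u).restrict (s := Set.Ioi (0 : ℝ))
  have hz₀' : z₀ ∈ Metric.ball z₀ (r / 2) := Metric.mem_ball_self (half_pos hr)
  have hinv : ContinuousOn (fun z : ℂ => z⁻¹) {z | z ≠ 0} := continuousOn_inv₀
  have hbase : Integrable (fun s => K * (‖u s‖ * ‖ker I s‖)) (volume.restrict (Set.Ioi 0)) := by
    have h1 : Integrable fun s => u s * ker I s := by
      refine (integrable_mul_L2 u (kerL I I_im_ne)).congr ?_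
      filter_upwards [coeFn_kerL I I_im_ne] with s h
      rw [h]
    have h2 := h1.norm.integrableOn (s := Set.Ioi (0 : ℝ))
    simp only [norm_mul] at h2
    exact h2.const_mul K
  have hm : ∀ z ∈ Metric.ball z₀ (r / 2), AEStronglyMeasurable (fun s => u s * ker z s)
      (volume.restrict (Set.Ioi (0 : ℝ))) := fun z hz => hu.mul (hmeas z hz _ hinv)
  refine (hasDerivAt_integral_of_dominated_loc_of_deriv_le
    (F' := fun z s => u s * (ker z s * ker z s))
    (bound := fun s => (r / 2)⁻¹ * (K * (‖u s‖ * ‖ker I s‖)))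
    (Metric.ball_mem_nhds z₀ (half_pos hr)) ?_ ?_ ?_ ?_ (hbase.const_mul _) ?_).2.differentiableAt
  · filter_upwards [Metric.ball_mem_nhds z₀ (half_pos hr)] with z hz
    exact hm z hz
  · refine hbase.mono' (hm z₀ hz₀') ((ae_restrict_mem measurableSet_Ioi).mono fun s hs => ?_)
    rw [norm_mul, mul_left_comm]
    exact mul_le_mul_of_nonneg_left (hker s hs z₀ hz₀') (norm_nonneg _)
  · exact hu.mul ((hmeas z₀ hz₀' _ hinv).mul (hmeas z₀ hz₀' _ hinv))
  · refine (ae_restrict_mem measurableSet_Ioi).mono fun s hs z hz => ?_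
    have h1 : ‖ker z s‖ ≤ (r / 2)⁻¹ := by
      rw [ker, norm_inv]
      exact inv_anti₀ (half_pos hr) (hdist s hs z hz)
    have h2 := hker s hs z hz
    rw [norm_mul, norm_mul]
    calc ‖u s‖ * (‖ker z s‖ * ‖ker z s‖) ≤ ‖u s‖ * ((r / 2)⁻¹ * (K * ‖ker I s‖)) := by gcongr
      _ = _ := by ring
  · refine (ae_restrict_mem measurableSet_Ioi).mono fun s hs z hz => ?_
    have hne : (s : ℂ) - z ≠ 0 := by
      intro h
      have := hdist s hs z hz
      rw [h, norm_zero] at this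
      linarith
    have h1 : HasDerivAt (fun z : ℂ => ((s : ℂ) - z)⁻¹) (ker z s * ker z s) z := by
      have := ((hasDerivAt_id z).const_sub (s : ℂ)).inv hne
      convert! this using 1
      simp only [ker, id]
      field_simp
    exact h1.const_mul (u s)

/-- The Cauchy integral of `u` is analytic on the connected complement of `[0, ∞)` and vanishes in
the upper half-plane because `C⁺u = 0`. The identity theorem carries the vanishing into the lower
half-plane, and the kernels are total. -/
theorem eq_zero_of_Cp_eq_zero_of_ae_eq_zero {u : L2} (hu : Cp u = 0)
    (h : ∀ᵐ s : ℝ, s < 0 → u s = 0) : u = 0 := by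
  set Φ : ℂ → ℂ := fun z => ∫ s in Set.Ioi (0 : ℝ), u s * ker z s with hΦ
  have hΦpair : ∀ (w : ℂ) (hw : w.im ≠ 0), pair u (kerL w hw) = Φ w := by
    intro w hw
    rw [pair_kerL]
    simp only [hΦ]
    rw [← integral_indicator measurableSet_Ioi]
    apply integral_congr_ae
    have h0 : ∀ᵐ s : ℝ, s ≠ 0 := by simp [ae_iff]
    filter_upwards [h, h0] with s h1 h2
    by_cases hs : s ∈ Set.Ioi (0 : ℝ)
    · rw [Set.indicator_of_mem hs]
    · rw [Set.indicator_of_notMem hs, h1 (lt_of_le_of_ne (not_lt.1 hs) h2), zero_mul]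
  have hopen : IsOpen {z : ℂ | -z ∈ slitPlane} := isOpen_slitPlane.preimage continuous_neg
  have han := (differentiableOn_integral_ker u).analyticOnNhd hopen
  have hpre : IsPreconnected {z : ℂ | -z ∈ slitPlane} := by
    have h1 : IsPreconnected slitPlane :=
      (starConvex_one_slitPlane.isPathConnected one_mem_slitPlane).isConnected.isPreconnected
    have h2 : {z : ℂ | -z ∈ slitPlane} = (fun z => -z) '' slitPlane := by
      ext z
      simp
    rw [h2]
    exact h1.image _ continuous_neg.continuousOn
  have hI : (I : ℂ) ∈ {z : ℂ | -z ∈ slitPlane} := by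
    simp [mem_slitPlane_iff]
  have hev : Φ =ᶠ[𝓝 I] 0 := by
    have : {z : ℂ | 0 < z.im} ∈ 𝓝 (I : ℂ) :=
      (isOpen_lt continuous_const Complex.continuous_im).mem_nhds (by simp)
    filter_upwards [this] with w hw
    rw [← hΦpair w (ne_of_gt hw), pair_kerL_of_Cp_eq_zero hu hw]
    rfl
  have hzero := han.eqOn_of_preconnected_of_eventuallyEq (g := 0)
    (fun z _ => analyticAt_const) hpre hI hev
  refine eq_zero_of_pair_kerL one_pos fun w hw _ => ?_
  rw [hΦpair w hw]
  refine hzero ?_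
  rw [Set.mem_ofPred_eq, mem_slitPlane_iff]
  right
  simpa using hw

/-! ### Injectivity of the Riemann-Hilbert operator -/

/-- All three factors extend analytically to the upper half-plane. In `L²` terms, the kernel times
`C⁺b` is again in the range of `C⁺`, by the commutator formula. -/
lemma integral_Cp_mul_Cp_mul_ker (a b : L2) {w : ℂ} (hw : w.im < 0) :
    ∫ s, Cp a s * Cp b s * ker w s = 0 := by
  have h1 : mulL (kerB w hw.ne) (Cp b) = Cp (mulL (kerB w hw.ne) b
      + ((2 * Real.pi * I)⁻¹ * pair (kerL w hw.ne) b) • kerL w hw.ne) := by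
    rw [map_add, Cp_kerB_mul, map_smul, Cp_kerL_of_neg hw, sub_add_cancel]
  have h2 : pair (Cp a) (mulL (kerB w hw.ne) (Cp b)) = 0 := by rw [h1, pair_Cp_Cp]
  rw [pair_apply] at h2
  rw [← h2]
  apply integral_congr_ae
  filter_upwards [mulL_coeFn (kerB w hw.ne) (Cp b)] with s h
  rw [h, kerB_apply]
  ring

/-- The vanishing lemma. -/
theorem eq_zero_of_hankel {R₀ R₁ : ℝ →ᵇ ℂ} (hR : ∀ s : ℝ, R₁ s = s * R₀ s) {f : L2}
    (hf : f = -Cm (mulL (star R₁) (Cp (mulL R₀ f)))) : f = 0 := by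
  set p := mulL R₀ f with hp
  set p₁ := mulL R₁ f with hp₁
  set g := Cp p with hg
  set v := mulL (star R₁) g with hv
  have hmul : IsMulX p p₁ := by
    filter_upwards [mulL_coeFn R₀ f, mulL_coeFn R₁ f] with s h1 h2
    rw [h2, h1, hR, mul_assoc]
  have hCpf : Cp f = 0 := by rw [hf, map_neg, Cp_Cm, neg_zero]
  have hconjf : conjL f = Cp (conjL v) := by rw [hf, map_neg, conjL_Cm, neg_neg]
  have hveq : v = Cp v + f := by
    conv_lhs => rw [← Cp_sub_Cm v]
    rw [hf, sub_eq_add_neg]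
  -- The number `⟨p₁, C⁺p⟩` equals `‖f‖²`, hence is real, so the defect `2πi |kap p|²` must vanish.
  have hkap : kap p = 0 := by
    have h1 := hmul.pair_conjL_Cp
    have h2 : pair (conjL p₁) (Cp p) = inner ℂ f f := by
      rw [hp₁, conjL_mulL, ← hg, pair_mulL, ← hv, inner_eq_pair]
      conv_lhs => rw [hveq, map_add, hconjf, pair_Cp_Cp, zero_add, ← hconjf]
    rw [h2, inner_self_conj, left_eq_add] at h1
    rcases mul_eq_zero.1 h1 with h | h
    · exact absurd h two_pi_I_ne
    · rcases mul_eq_zero.1 h with h | h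
      · exact h
      · simpa using h
  have hsg : ∀ᵐ s : ℝ, s * g s = Cp p₁ s := by
    filter_upwards [hmul.mul_Cp] with s h
    rw [hg, h, hkap, sub_zero]
  set A : ℝ → ℂ := fun s => ((‖f s‖ ^ 2 - s * ‖g s‖ ^ 2 : ℝ) : ℂ) with hA
  -- Expanding `C⁺p̄ = -conj(C⁻p) = p̄ - ḡ` and `C⁺v = v - f`, the two cross terms `s g p̄` cancel.
  have hAeq : ∀ᵐ s, A s = Cp p₁ s * Cp (conjL p) s - Cp (conjL v) s * Cp v s := by
    have e1 : Cp (conjL p) = -conjL (Cm p) := by rw [conjL_Cm, neg_neg]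
    rw [e1, ← hconjf]
    filter_upwards [hsg, mulL_coeFn R₀ f, mulL_coeFn (star R₁) g, conjL_coeFn f,
      Lp.coeFn_add (Cp v) f, Lp.coeFn_neg (conjL (Cm p)), conjL_coeFn (Cm p),
      Lp.coeFn_sub (Cp p) p] with s h1 h2 h3 h4 h5 h6 h7 h8
    rw [← hveq] at h5
    rw [← hp] at h2
    rw [← hv] at h3
    rw [← Cm_eq, ← hg] at h8
    rw [← h1, h6, Pi.neg_apply, h7, h8, h4]
    have h9 : Cp v s = v s - f s := by rw [h5, Pi.add_apply]; ring
    have h10 : (star R₁) s = s * conj (R₀ s) := by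
      change conj (R₁ s) = _
      rw [hR, map_mul, Complex.conj_ofReal]
    rw [h9, h3, h10, Pi.sub_apply, h2, map_sub, map_mul]
    simp only [hA]
    push_cast
    rw [← Complex.mul_conj', ← Complex.mul_conj']
    ring
  have hAint : Integrable A := by
    refine Integrable.congr ?_ (hAeq.mono fun s h => h.symm)
    exact (integrable_mul_L2 _ _).sub (integrable_mul_L2 _ _)
  have hneg : ∀ w : ℂ, w.im < 0 → ∫ s, A s * ker w s = 0 := by
    intro w hw
    have hi : ∀ a b : L2, Integrable fun s => a s * b s * ker w s := fun a b =>
      (integrable_mul_L2 a b).mul_bdd (c := |w.im|⁻¹) (continuous_ker hw.ne).aestronglyMeasurable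
        (Eventually.of_forall (norm_ker_le w hw.ne))
    have : ∫ s, A s * ker w s = ∫ s, (Cp p₁ s * Cp (conjL p) s * ker w s
        - Cp (conjL v) s * Cp v s * ker w s) := by
      apply integral_congr_ae
      filter_upwards [hAeq] with s h
      rw [h, sub_mul]
    rw [this, integral_sub (hi _ _) (hi _ _), integral_Cp_mul_Cp_mul_ker _ _ hw,
      integral_Cp_mul_Cp_mul_ker _ _ hw, sub_zero]
  have hA0 := ae_eq_zero_of_integral_mul_ker hAint one_pos fun w hw _ => by
    rcases lt_or_gt_of_ne hw with h | h
    · exact hneg w h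
    -- `A` is real, so conjugation transfers the vanishing to poles in the upper half-plane.
    · have h1 := congrArg conj (hneg (conj w) (by simpa using h))
      rw [← integral_conj, map_zero] at h1
      rw [← h1]
      congr 1
      funext s
      rw [map_mul, conj_ker, Complex.conj_conj, hA, Complex.conj_ofReal]
  refine eq_zero_of_Cp_eq_zero_of_ae_eq_zero hCpf ?_
  filter_upwards [hA0] with s h hs
  have h1 : ‖f s‖ ^ 2 - s * ‖g s‖ ^ 2 = 0 := by
    simp only [hA] at h
    exact_mod_cast h
  -- For `s < 0`, the identity `|f|² = s|g|²` leaves no room.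
  have h2 : ‖f s‖ ^ 2 ≤ 0 := by nlinarith [sq_nonneg ‖g s‖]
  exact norm_eq_zero.1 (pow_eq_zero_iff two_ne_zero |>.1 (le_antisymm h2 (sq_nonneg _)))

/-! ### Differentiation lemmas over the reals for complex-linear maps -/

section deriv

variable {E F G : Type*} [NormedAddCommGroup E] [NormedSpace ℂ E] [NormedAddCommGroup F]
  [NormedSpace ℂ F] [NormedAddCommGroup G] [NormedSpace ℂ G]

lemma hasDerivAt_clm (L : E →L[ℂ] F) {u : ℝ → E} {u' : E} {x : ℝ} (hu : HasDerivAt u u' x) :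
    HasDerivAt (fun y => L (u y)) (L u') x :=
  (L.restrictScalars ℝ).hasFDerivAt.comp_hasDerivAt x hu

lemma hasDerivAt_bilin (B : E →L[ℂ] F →L[ℂ] G) {u : ℝ → E} {v : ℝ → F} {u' : E} {v' : F} {x : ℝ}
    (hu : HasDerivAt u u' x) (hv : HasDerivAt v v' x) :
    HasDerivAt (fun y => B (u y) (v y)) (B (u x) v' + B u' (v x)) x :=
  (B.bilinearRestrictScalars ℝ).hasDerivAt_of_bilinear (fun _ => hu) (fun _ => hv)

end deriv

/-! ### The Riemann-Hilbert operator -/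

/-- The operator `1 + C⁻ M(R̄₁) C⁺ M(R₀)`. -/
def rhOp (R₀ R₁ : ℝ →ᵇ ℂ) : L2 →L[ℂ] L2 := 1 + Cm * (mulL (star R₁) * (Cp * mulL R₀))

lemma rhOp_apply (R₀ R₁ : ℝ →ᵇ ℂ) (f : L2) :
    rhOp R₀ R₁ f = f + Cm (mulL (star R₁) (Cp (mulL R₀ f))) := rfl

/-- Admissible pairs of weights: `R₁ = l R₀` vanishes at infinity. -/
structure IsWeightPair (R₀ R₁ : ℝ →ᵇ ℂ) : Prop where
  eq_mul : ∀ s : ℝ, R₁ s = s * R₀ s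
  tendsto : Tendsto R₁ (cocompact ℝ) (𝓝 0)

lemma IsWeightPair.eq_zero {R₀ R₁ : ℝ →ᵇ ℂ} (h : IsWeightPair R₀ R₁) {f : L2}
    (hf : rhOp R₀ R₁ f = 0) : f = 0 := by
  rw [rhOp_apply] at hf
  exact eq_zero_of_hankel h.eq_mul (eq_neg_of_add_eq_zero_left hf)

lemma IsWeightPair.injective {R₀ R₁ : ℝ →ᵇ ℂ} (h : IsWeightPair R₀ R₁) :
    Function.Injective (rhOp R₀ R₁) :=
  (injective_iff_map_eq_zero _).2 fun _ hf => h.eq_zero hf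

/-- Fredholm alternative: the identity plus a compact operator for which `-1` is not an eigenvalue,
by the vanishing lemma. -/
theorem IsWeightPair.isUnit {R₀ R₁ : ℝ →ᵇ ℂ} (h : IsWeightPair R₀ R₁) : IsUnit (rhOp R₀ R₁) := by
  have hstar : Tendsto (star R₁) (cocompact ℝ) (𝓝 0) := by
    have := (continuous_star.tendsto (0 : ℂ)).comp h.tendsto
    rwa [star_zero] at this
  have hK : IsCompactOperator (Cm.comp ((mulL (star R₁)).comp (Cp.comp (mulL R₀)))) :=
    (isCompactOperator_hankel (star R₁) hstar).comp_clm (mulL R₀)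
  rcases hK.hasEigenvalue_or_mem_resolventSet (μ := -1) (by simp) with h1 | h1
  · obtain ⟨f, hf⟩ := h1.exists_hasEigenvector
    refine absurd (h.eq_zero (f := f) ?_) hf.2
    have h2 : Cm (mulL (star R₁) (Cp (mulL R₀ f))) = (-1 : ℂ) • f := hf.apply_eq_smul
    rw [rhOp_apply, h2, neg_one_smul, add_neg_cancel]
  · rw [spectrum.mem_resolventSet_iff] at h1
    have h2 : rhOp R₀ R₁ = -((algebraMap ℂ (L2 →L[ℂ] L2) (-1))
        - Cm.comp ((mulL (star R₁)).comp (Cp.comp (mulL R₀)))) := by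
      rw [map_neg, map_one, neg_sub, sub_neg_eq_add, add_comm]
      rfl
    rw [h2]
    exact h1.neg

/-- The solution of `f + C⁻ R̄₁ C⁺ (R₀ f + r) = 0`. -/
def rhSol (R₀ R₁ : ℝ →ᵇ ℂ) (r : L2) : L2 :=
  Ring.inverse (rhOp R₀ R₁) (-Cm (mulL (star R₁) (Cp r)))

lemma rhOp_rhSol {R₀ R₁ : ℝ →ᵇ ℂ} (h : IsWeightPair R₀ R₁) (r : L2) :
    rhOp R₀ R₁ (rhSol R₀ R₁ r) = -Cm (mulL (star R₁) (Cp r)) := by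
  have := Ring.mul_inverse_cancel _ h.isUnit
  exact DFunLike.congr_fun this (-Cm (mulL (star R₁) (Cp r)))

lemma rhSol_eq {R₀ R₁ : ℝ →ᵇ ℂ} (h : IsWeightPair R₀ R₁) (r : L2) :
    rhSol R₀ R₁ r = -Cm (mulL (star R₁) (Cp (r + mulL R₀ (rhSol R₀ R₁ r)))) := by
  have := rhOp_rhSol h r
  rw [rhOp_apply] at this
  rw [map_add, map_add, map_add, neg_add, ← this]
  abel

lemma continuous_rhSol {X : Type*} [TopologicalSpace X] {R₀ R₁ : X → ℝ →ᵇ ℂ} {r : X → L2}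
    (h : ∀ x, IsWeightPair (R₀ x) (R₁ x)) (h0 : Continuous R₀) (h1 : Continuous R₁)
    (hr : Continuous r) : Continuous fun x => rhSol (R₀ x) (R₁ x) (r x) := by
  have hs : Continuous fun x => mulL (star (R₁ x)) := mulL.continuous.comp (continuous_star.comp h1)
  have hop : Continuous fun x => rhOp (R₀ x) (R₁ x) :=
    continuous_const.add (continuous_const.mul (hs.mul (continuous_const.mul
      (mulL.continuous.comp h0))))
  have hinv : Continuous fun x => Ring.inverse (rhOp (R₀ x) (R₁ x)) := by
    rw [continuous_iff_continuousAt]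
    intro x
    obtain ⟨u, hu⟩ := (h x).isUnit
    have := NormedRing.inverse_continuousAt u
    rw [hu] at this
    exact this.comp (f := fun x => rhOp (R₀ x) (R₁ x)) hop.continuousAt
  exact hinv.clm_apply (Cm.continuous.comp (hs.clm_apply (Cp.continuous.comp hr))).neg

/-- Inversion is differentiable at units. Only existence is recorded; the value is later read off
the equation itself. -/
lemma exists_hasDerivAt_rhSol {R₀ R₁ : ℝ → ℝ →ᵇ ℂ} {r : ℝ → L2} {R₀' R₁' : ℝ →ᵇ ℂ} {r' : L2}
    {x : ℝ} (h : IsWeightPair (R₀ x) (R₁ x)) (h0 : HasDerivAt R₀ R₀' x)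
    (h1 : HasDerivAt R₁ R₁' x) (hr : HasDerivAt r r' x) :
    ∃ f', HasDerivAt (fun y => rhSol (R₀ y) (R₁ y) (r y)) f' x := by
  have hs : HasDerivAt (fun y => mulL (star (R₁ y))) (mulL (star R₁')) x :=
    hasDerivAt_clm mulL h1.star
  have hop : HasDerivAt (fun y => rhOp (R₀ y) (R₁ y)) _ x :=
    ((hs.mul ((hasDerivAt_clm mulL h0).const_mul Cp)).const_mul Cm).const_add 1
  have hinv : DifferentiableAt ℝ (fun y => Ring.inverse (rhOp (R₀ y) (R₁ y))) x := by
    obtain ⟨u, hu⟩ := h.isUnit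
    have h3 := differentiableAt_inverse (𝕜 := ℝ) (R := L2 →L[ℂ] L2) (x := rhOp (R₀ x) (R₁ x))
      h.isUnit
    exact h3.comp x hop.differentiableAt
  have hv : HasDerivAt (fun y => -Cm (mulL (star (R₁ y)) (Cp (r y)))) _ x :=
    (hasDerivAt_clm Cm (hasDerivAt_bilin mulL h1.star (hasDerivAt_clm Cp hr))).neg
  exact ⟨_, hasDerivAt_bilin (ContinuousLinearMap.id ℂ (L2 →L[ℂ] L2)) hinv.hasDerivAt hv⟩

/-! ### Rapidly decreasing Lipschitz data and their phases -/

/-- All the functions `l ↦ l^k ρ(l)` are bounded and Lipschitz. -/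
structure Rapid (ρ : ℝ → ℂ) : Prop where
  bdd : ∀ k : ℕ, ∃ C : ℝ, ∀ l : ℝ, ‖(l : ℂ) ^ k * ρ l‖ ≤ C
  lip : ∀ k : ℕ, ∃ C : ℝ, ∀ l m : ℝ, ‖(l : ℂ) ^ k * ρ l - (m : ℂ) ^ k * ρ m‖ ≤ C * |l - m|

lemma Rapid.continuous {ρ : ℝ → ℂ} (hρ : Rapid ρ) : Continuous ρ := by
  obtain ⟨C, hC⟩ := hρ.lip 0
  have : LipschitzWith (Real.toNNReal C) ρ := by
    refine LipschitzWith.of_dist_le_mul fun l m => ?_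
    rw [dist_eq_norm, Real.dist_eq]
    refine le_trans (by simpa using hC l m) (mul_le_mul_of_nonneg_right ?_ (abs_nonneg _))
    exact Real.le_coe_toNNReal C
  exact this.continuous

/-- The oscillatory factor `e^{-2ilx-4il²t}`. -/
def phase (x t l : ℝ) : ℂ := exp (((-(2 * l * x + 4 * l ^ 2 * t) : ℝ) : ℂ) * I)

lemma norm_phase (x t l : ℝ) : ‖phase x t l‖ = 1 := Complex.norm_exp_ofReal_mul_I _

lemma continuous_phase (x t : ℝ) : Continuous (phase x t) := by
  unfold phase
  fun_prop

lemma norm_exp_mul_I_sub_le (a b : ℝ) : ‖exp (a * I) - exp (b * I)‖ ≤ |a - b| := by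
  have h1 : exp (a * I) - exp (b * I) = exp (b * I) * (exp (I * ((a - b : ℝ) : ℂ)) - 1) := by
    rw [mul_sub, ← Complex.exp_add, mul_one]
    congr 2
    push_cast
    ring
  rw [h1, norm_mul, Complex.norm_exp_ofReal_mul_I, one_mul]
  exact Real.norm_exp_I_mul_ofReal_sub_one_le

lemma norm_exp_mul_I_sub_one_sub_le (a : ℝ) : ‖exp (a * I) - 1 - a * I‖ ≤ 2 * a ^ 2 := by
  have hn : ‖(a * I : ℂ)‖ = |a| := by simp
  rcases le_total |a| 1 with h | h
  · refine (Complex.norm_exp_sub_one_sub_id_le (by rwa [hn])).trans ?_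
    rw [hn, sq_abs]
    nlinarith [sq_nonneg a]
  · have h1 : ‖exp (a * I) - 1‖ ≤ |a| := by
      have := norm_exp_mul_I_sub_le a 0
      simpa using this
    calc ‖exp (a * I) - 1 - a * I‖ ≤ ‖exp (a * I) - 1‖ + ‖(a * I : ℂ)‖ := norm_sub_le _ _
      _ ≤ 2 * |a| := by rw [hn]; linarith
      _ ≤ 2 * a ^ 2 := by rw [← sq_abs]; nlinarith

lemma norm_phase_sub_le (x t x' t' l : ℝ) :
    ‖phase x t l - phase x' t' l‖ ≤ 2 * |x - x'| * |l| + 4 * |t - t'| * |l| ^ 2 := by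
  refine (norm_exp_mul_I_sub_le _ _).trans ?_
  have h : -(2 * l * x + 4 * l ^ 2 * t) - -(2 * l * x' + 4 * l ^ 2 * t')
      = -(2 * (x - x') * l + 4 * (t - t') * l ^ 2) := by ring
  rw [h, abs_neg]
  refine (abs_add_le _ _).trans (le_of_eq ?_)
  simp only [abs_mul, abs_pow]
  norm_num

section weights

variable {ρ : ℝ → ℂ} (hρ : Rapid ρ)

/-- The weight `l^k ρ(l) e^{-2ilx-4il²t}`. -/
def wt (k : ℕ) (x t : ℝ) : ℝ →ᵇ ℂ :=
  BoundedContinuousFunction.ofNormedAddCommGroup (fun l => (l : ℂ) ^ k * ρ l * phase x t l)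
    (((continuous_ofReal.pow k).mul hρ.continuous).mul (continuous_phase x t)) (hρ.bdd k).choose
    fun l => by
      rw [norm_mul, norm_phase, mul_one]
      exact (hρ.bdd k).choose_spec l

lemma wt_apply (k : ℕ) (x t l : ℝ) : wt hρ k x t l = (l : ℂ) ^ k * ρ l * phase x t l := rfl

lemma wt_succ (k : ℕ) (x t l : ℝ) : wt hρ (k + 1) x t l = l * wt hρ k x t l := by
  rw [wt_apply, wt_apply]
  ring

lemma star_wt_succ (k : ℕ) (x t l : ℝ) :
    star (wt hρ (k + 1) x t) l = l * star (wt hρ k x t) l := by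
  change conj (wt hρ (k + 1) x t l) = l * conj (wt hρ k x t l)
  rw [wt_succ, map_mul, Complex.conj_ofReal]

lemma exists_norm_sub_le_wt (k : ℕ) : ∃ C : ℝ, ∀ x t x' t' : ℝ,
    ‖wt hρ k x t - wt hρ k x' t'‖ ≤ C * (|x - x'| + |t - t'|) := by
  obtain ⟨C₁, h₁⟩ := hρ.bdd (k + 1)
  obtain ⟨C₂, h₂⟩ := hρ.bdd (k + 2)
  have p1 : 0 ≤ C₁ := (norm_nonneg _).trans (h₁ 0)
  have p2 : 0 ≤ C₂ := (norm_nonneg _).trans (h₂ 0)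
  refine ⟨2 * C₁ + 4 * C₂, fun x t x' t' => ?_⟩
  rw [BoundedContinuousFunction.norm_le (by positivity)]
  intro l
  rw [BoundedContinuousFunction.sub_apply, wt_apply, wt_apply, ← mul_sub, norm_mul]
  have e1 : ‖(l : ℂ) ^ k * ρ l‖ * |l| ≤ C₁ := by
    refine le_trans (le_of_eq ?_) (h₁ l)
    rw [pow_succ, ← Real.norm_eq_abs, ← Complex.norm_real, ← norm_mul]
    ring_nf
  have e2 : ‖(l : ℂ) ^ k * ρ l‖ * |l| ^ 2 ≤ C₂ := by
    refine le_trans (le_of_eq ?_) (h₂ l)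
    rw [pow_add, ← Real.norm_eq_abs, ← Complex.norm_real, ← norm_pow, ← norm_mul]
    ring_nf
  calc _ ≤ ‖(l : ℂ) ^ k * ρ l‖ * (2 * |x - x'| * |l| + 4 * |t - t'| * |l| ^ 2) :=
        mul_le_mul_of_nonneg_left (norm_phase_sub_le _ _ _ _ _) (norm_nonneg _)
    _ = 2 * |x - x'| * (‖(l : ℂ) ^ k * ρ l‖ * |l|) + 4 * |t - t'| * (‖(l : ℂ) ^ k * ρ l‖ * |l| ^ 2) := by
        ring
    _ ≤ 2 * |x - x'| * C₁ + 4 * |t - t'| * C₂ := by gcongr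
    _ ≤ _ := by nlinarith [mul_nonneg (abs_nonneg (x - x')) p2, mul_nonneg (abs_nonneg (t - t')) p1]

lemma continuous_wt (k : ℕ) : Continuous fun p : ℝ × ℝ => wt hρ k p.1 p.2 := by
  obtain ⟨C, hC⟩ := exists_norm_sub_le_wt hρ k
  rw [continuous_iff_continuousAt]
  intro p
  rw [ContinuousAt, tendsto_iff_norm_sub_tendsto_zero]
  refine squeeze_zero (fun _ => norm_nonneg _) (fun p' => hC p'.1 p'.2 p.1 p.2) ?_
  have : Continuous fun p' : ℝ × ℝ => C * (|p'.1 - p.1| + |p'.2 - p.2|) := by fun_prop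
  have h := this.tendsto p
  simpa using h

/-- The sup norm requires a Taylor remainder uniform in `l`: it is at most `2 ((θ - θ₀) b)²`, so two
powers of `b` must be absorbed by the amplitude `a`. -/
lemma hasDerivAt_bcf {u : ℝ → ℝ →ᵇ ℂ} {u' : ℝ →ᵇ ℂ} {a : ℝ → ℂ} {b : ℝ → ℝ} {C θ₀ : ℝ}
    (hu : ∀ θ l, u θ l = a l * exp (((-(θ * b l) : ℝ) : ℂ) * I)) (hC : ∀ l, ‖a l‖ * b l ^ 2 ≤ C)
    (hu' : ∀ l, u' l = -(I * b l) * u θ₀ l) : HasDerivAt u u' θ₀ := by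
  have hC0 : 0 ≤ C := le_trans (by positivity) (hC 0)
  rw [hasDerivAt_iff_isLittleO]
  refine Asymptotics.IsBigO.trans_isLittleO (g := fun θ => ‖θ - θ₀‖ ^ 2) ?_
    (Asymptotics.isLittleO_pow_sub_sub θ₀ one_lt_two)
  refine Asymptotics.IsBigO.of_bound (2 * C) (Eventually.of_forall fun θ => ?_)
  rw [BoundedContinuousFunction.norm_le (by positivity)]
  intro l
  have h1 : (u θ - u θ₀ - (θ - θ₀) • u') l = a l * exp (((-(θ₀ * b l) : ℝ) : ℂ) * I)
      * (exp (((-((θ - θ₀) * b l) : ℝ) : ℂ) * I) - 1 - ((-((θ - θ₀) * b l) : ℝ) : ℂ) * I) := by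
    have h2 : exp (((-(θ * b l) : ℝ) : ℂ) * I)
        = exp (((-(θ₀ * b l) : ℝ) : ℂ) * I) * exp (((-((θ - θ₀) * b l) : ℝ) : ℂ) * I) := by
      rw [← Complex.exp_add]
      congr 1
      push_cast
      ring
    simp only [BoundedContinuousFunction.sub_apply, BoundedContinuousFunction.smul_apply, hu', hu,
      h2, Complex.real_smul]
    push_cast
    ring
  rw [h1, norm_mul, norm_mul, Complex.norm_exp_ofReal_mul_I, mul_one]
  calc _ ≤ ‖a l‖ * (2 * (-((θ - θ₀) * b l)) ^ 2) :=
        mul_le_mul_of_nonneg_left (norm_exp_mul_I_sub_one_sub_le _) (norm_nonneg _)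
    _ = 2 * (‖a l‖ * b l ^ 2) * (θ - θ₀) ^ 2 := by ring
    _ ≤ 2 * C * (θ - θ₀) ^ 2 := by
        have := hC l
        gcongr
    _ = _ := by rw [norm_pow, norm_norm, Real.norm_eq_abs, sq_abs]

lemma hasDerivAt_wt_x (k : ℕ) (x t : ℝ) :
    HasDerivAt (fun y => wt hρ k y t) (-(2 * I) • wt hρ (k + 1) x t) x := by
  obtain ⟨C, hC⟩ := hρ.bdd (k + 2)
  refine hasDerivAt_bcf (a := fun l => (l : ℂ) ^ k * ρ l * phase 0 t l) (b := fun l => 2 * l)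
    (C := 4 * C) (fun θ l => ?_) (fun l => ?_) (fun l => ?_)
  · rw [wt_apply, mul_assoc ((l : ℂ) ^ k * ρ l), phase, phase, ← Complex.exp_add]
    congr 2
    push_cast
    ring
  · rw [norm_mul, norm_phase, mul_one]
    have := hC l
    rw [pow_add, mul_right_comm, norm_mul, norm_pow (l : ℂ) 2, Complex.norm_real, Real.norm_eq_abs,
      sq_abs] at this
    nlinarith
  · rw [BoundedContinuousFunction.smul_apply, wt_succ, smul_eq_mul]
    push_cast
    ring

lemma hasDerivAt_wt_t (k : ℕ) (x t : ℝ) :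
    HasDerivAt (fun s => wt hρ k x s) (-(4 * I) • wt hρ (k + 2) x t) t := by
  obtain ⟨C, hC⟩ := hρ.bdd (k + 4)
  refine hasDerivAt_bcf (a := fun l => (l : ℂ) ^ k * ρ l * phase x 0 l) (b := fun l => 4 * l ^ 2)
    (C := 16 * C) (fun θ l => ?_) (fun l => ?_) (fun l => ?_)
  · rw [wt_apply, mul_assoc ((l : ℂ) ^ k * ρ l), phase, phase, ← Complex.exp_add]
    congr 2
    push_cast
    ring
  · rw [norm_mul, norm_phase, mul_one]
    have := hC l
    rw [pow_add, mul_right_comm, norm_mul, norm_pow (l : ℂ) 4, Complex.norm_real, Real.norm_eq_abs,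
      (by decide : Even 4).pow_abs] at this
    nlinarith
  · rw [BoundedContinuousFunction.smul_apply, wt_succ, wt_succ, smul_eq_mul]
    push_cast
    ring

/-- The weight `l^k ρ(l) e^{-2ilx-4il²t}` as an element of `L²(ℝ)`. -/
def wtL (k : ℕ) (x t : ℝ) : L2 :=
  -- A bounded function, `l - i` times the weight, multiplies the square-integrable kernel at `i`.
  -- Continuity and derivatives then pass from the sup norm to `L²` through `mulL`.
  mulL (wt hρ (k + 1) x t - I • wt hρ k x t) (kerL I I_im_ne)

lemma wtL_coeFn (k : ℕ) (x t : ℝ) : ∀ᵐ l : ℝ, wtL hρ k x t l = wt hρ k x t l := by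
  filter_upwards [mulL_coeFn (wt hρ (k + 1) x t - I • wt hρ k x t) (kerL I I_im_ne),
    coeFn_kerL I I_im_ne] with l h1 h2
  have hl := ofReal_sub_ne_zero I_im_ne l
  rw [wtL, h1, h2, BoundedContinuousFunction.sub_apply, BoundedContinuousFunction.smul_apply,
    wt_succ, ker, smul_eq_mul]
  field_simp

lemma continuous_wtL (k : ℕ) : Continuous fun p : ℝ × ℝ => wtL hρ k p.1 p.2 :=
  (mulL.continuous.comp ((continuous_wt hρ (k + 1)).sub
    ((continuous_wt hρ k).const_smul I))).clm_apply continuous_const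

lemma hasDerivAt_wtL_x (k : ℕ) (x t : ℝ) :
    HasDerivAt (fun y => wtL hρ k y t) (-(2 * I) • wtL hρ (k + 1) x t) x := by
  have := hasDerivAt_clm (mulL.flip (kerL I I_im_ne))
    ((hasDerivAt_wt_x hρ (k + 1) x t).sub ((hasDerivAt_wt_x hρ k x t).const_smul I))
  convert! this using 1
  simp only [wtL, ContinuousLinearMap.flip_apply, map_sub, map_smul, sub_apply, smul_apply]
  module

lemma hasDerivAt_wtL_t (k : ℕ) (x t : ℝ) :
    HasDerivAt (fun s => wtL hρ k x s) (-(4 * I) • wtL hρ (k + 2) x t) t := by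
  have := hasDerivAt_clm (mulL.flip (kerL I I_im_ne))
    ((hasDerivAt_wt_t hρ (k + 1) x t).sub ((hasDerivAt_wt_t hρ k x t).const_smul I))
  convert! this using 1
  simp only [wtL, ContinuousLinearMap.flip_apply, map_sub, map_smul, sub_apply, smul_apply]
  module

lemma isWeightPair_wt (x t : ℝ) : IsWeightPair (wt hρ 0 x t) (wt hρ 1 x t) where
  eq_mul := wt_succ hρ 0 x t
  tendsto := by
    obtain ⟨C, hC⟩ := hρ.bdd 2
    have h1 : ∀ l : ℝ, ‖wt hρ 1 x t l‖ ≤ C / |l| := by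
      intro l
      rcases eq_or_ne l 0 with rfl | hl
      · simp [wt_apply]
      · rw [le_div_iff₀ (abs_pos.2 hl), wt_apply, norm_mul, norm_phase, mul_one]
        refine le_trans (le_of_eq ?_) (hC l)
        rw [← Real.norm_eq_abs, ← Complex.norm_real, ← norm_mul]
        ring_nf
    refine squeeze_zero_norm h1 (tendsto_const_nhds.div_atTop ?_)
    exact tendsto_norm_cocompact_atTop (E := ℝ)

end weights

/-! ### Shift relations -/

/-- `l u₀ = u₁ - c`. -/
def Shift (u₀ u₁ : L2) (c : ℂ) : Prop := ∀ᵐ s : ℝ, s * u₀ s = u₁ s - c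

variable {u₀ u₁ v₀ v₁ : L2} {c d : ℂ}

lemma Shift.conjL (h : Shift u₀ u₁ c) : Shift (conjL u₀) (conjL u₁) (conj c) := by
  filter_upwards [h, conjL_coeFn u₀, conjL_coeFn u₁] with s h1 h2 h3
  rw [h2, h3, ← map_sub, ← h1, map_mul, Complex.conj_ofReal]

lemma Shift.neg (h : Shift u₀ u₁ c) : Shift (-u₀) (-u₁) (-c) := by
  filter_upwards [h, Lp.coeFn_neg u₀, Lp.coeFn_neg u₁] with s h1 h2 h3
  rw [h2, h3, Pi.neg_apply, Pi.neg_apply, mul_neg, h1]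
  ring

lemma IsMulX.shift_Cp (h : IsMulX u₀ u₁) : Shift (Cp u₀) (Cp u₁) (kap u₀) := h.mul_Cp

lemma IsMulX.shift_Cm (h : IsMulX u₀ u₁) : Shift (Cm u₀) (Cm u₁) (kap u₀) := h.mul_Cm

/-- Multiplying a shift relation by a pair of weights. -/
lemma Shift.mulL_eq (h : Shift u₀ u₁ c) {φ₀ φ₁ : ℝ →ᵇ ℂ} {p : L2} (hφ : ∀ s : ℝ, φ₁ s = s * φ₀ s)
    (hp : ∀ᵐ s, p s = φ₀ s) : mulL φ₁ u₀ = mulL φ₀ u₁ - c • p := by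
  apply Lp.ext
  filter_upwards [h, hp, mulL_coeFn φ₁ u₀, mulL_coeFn φ₀ u₁, Lp.coeFn_sub (mulL φ₀ u₁) (c • p),
    Lp.coeFn_smul c p] with s h1 h2 h3 h4 h5 h6
  rw [h3, h5, Pi.sub_apply, h6, Pi.smul_apply, h4, h2, hφ, smul_eq_mul, mul_assoc, mul_left_comm, h1]
  ring

lemma isMulX_mulL {φ₀ φ₁ : ℝ →ᵇ ℂ} (hφ : ∀ s : ℝ, φ₁ s = s * φ₀ s) (u : L2) :
    IsMulX (mulL φ₀ u) (mulL φ₁ u) := by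
  filter_upwards [mulL_coeFn φ₀ u, mulL_coeFn φ₁ u] with s h1 h2
  rw [h1, h2, hφ, mul_assoc]

lemma IsMulX.add (h : IsMulX u₀ u₁) (h' : IsMulX v₀ v₁) : IsMulX (u₀ + v₀) (u₁ + v₁) := by
  filter_upwards [h, h', Lp.coeFn_add u₀ v₀, Lp.coeFn_add u₁ v₁] with s h1 h2 h3 h4
  rw [h3, h4, Pi.add_apply, Pi.add_apply, h1, h2, mul_add]

lemma IsMulX.smul (h : IsMulX u₀ u₁) (a : ℂ) : IsMulX (a • u₀) (a • u₁) := by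
  filter_upwards [h, Lp.coeFn_smul a u₀, Lp.coeFn_smul a u₁] with s h1 h2 h3
  rw [h2, h3, Pi.smul_apply, Pi.smul_apply, h1, smul_eq_mul, smul_eq_mul, mul_left_comm]

lemma IsMulX.conjL (h : IsMulX u₀ u₁) : IsMulX (conjL u₀) (conjL u₁) := by
  filter_upwards [h, conjL_coeFn u₀, conjL_coeFn u₁] with s h1 h2 h3
  rw [h2, h3, h1, map_mul, Complex.conj_ofReal]

lemma kap_smul (a : ℂ) (u : L2) : kap (a • u) = a * kap u := by
  have : ∫ s, (a • u) s = a * ∫ s, u s := by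
    rw [← integral_const_mul]
    apply integral_congr_ae
    filter_upwards [Lp.coeFn_smul a u] with s h
    rw [h, Pi.smul_apply, smul_eq_mul]
  rw [kap, this, kap, mul_left_comm]

lemma IsMulX.kap_add (h : IsMulX u₀ u₁) (h' : IsMulX v₀ v₁) :
    kap (u₀ + v₀) = kap u₀ + kap v₀ := by
  rw [h.kap_eq, h'.kap_eq, (h.add h').kap_eq, ← mul_add, ← map_add, smul_add, add_sub_add_comm]

lemma kap_conjL (u : L2) : kap (conjL u) = -conj (kap u) := by
  have : ∫ s, conjL u s = conj (∫ s, u s) := by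
    rw [← integral_conj]
    apply integral_congr_ae
    filter_upwards [conjL_coeFn u] with s h
    rw [h]
  rw [kap, this, kap, map_mul, map_inv₀]
  simp only [map_mul, Complex.conj_I, Complex.conj_ofReal, map_ofNat, mul_neg, inv_neg, neg_mul,
    neg_neg]

lemma continuous_kap {X : Type*} [TopologicalSpace X] {u v : X → L2} (hu : Continuous u)
    (hv : Continuous v) (h : ∀ x, IsMulX (u x) (v x)) : Continuous fun x => kap (u x) := by
  simp_rw [fun x => (h x).kap_eq]
  exact continuous_const.mul ((pair (kerL I I_im_ne)).continuous.comp (hv.sub (hu.const_smul I)))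

lemma hasDerivAt_kap {u v : ℝ → L2} {u' v' : L2} {x : ℝ} (hu : HasDerivAt u u' x)
    (hv : HasDerivAt v v' x) (h : ∀ x, IsMulX (u x) (v x)) (h' : IsMulX u' v') :
    HasDerivAt (fun y => kap (u y)) (kap u') x := by
  simp_rw [fun x => (h x).kap_eq, h'.kap_eq]
  exact (hasDerivAt_clm (pair (kerL I I_im_ne)) (hv.sub (hu.const_smul I))).const_mul _

/-! ### The solution of the Riemann-Hilbert problem and its moments -/

section solution

variable {ρ : ℝ → ℂ} (hρ : Rapid ρ)

/-- The function `N₁₁₋ - 1`. -/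
def fS (x t : ℝ) : L2 := rhSol (wt hρ 0 x t) (wt hρ 1 x t) (wtL hρ 0 x t)

/-- The functions `l^k N₁₁₋ ρ`. -/
def hS (k : ℕ) (x t : ℝ) : L2 := wtL hρ k x t + mulL (wt hρ k x t) (fS hρ x t)

/-- The functions `C⁺ (l^k N₁₁₋ ρ)`. -/
def gS (k : ℕ) (x t : ℝ) : L2 := Cp (hS hρ k x t)

/-- The functions `l^{k+1} ρ̄ N₁₂₊`. -/
def vS (k : ℕ) (x t : ℝ) : L2 := mulL (star (wt hρ (k + 1) x t)) (gS hρ 0 x t)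

/-- The conjugate weights `l^{k+1} ρ̄` in `L²(ℝ)`. -/
def sS (k : ℕ) (x t : ℝ) : L2 := conjL (wtL hρ (k + 1) x t)

/-- The moments of `N₁₁₋ ρ`. -/
def kS (k : ℕ) (x t : ℝ) : ℂ := kap (hS hρ k x t)

/-- The moments of `l ρ̄ N₁₂₊`. -/
def thS (k : ℕ) (x t : ℝ) : ℂ := kap (vS hρ k x t)

lemma continuous_fS : Continuous fun p : ℝ × ℝ => fS hρ p.1 p.2 :=
  continuous_rhSol (fun p => isWeightPair_wt hρ p.1 p.2) (continuous_wt hρ 0) (continuous_wt hρ 1)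
    (continuous_wtL hρ 0)

lemma continuous_hS (k : ℕ) : Continuous fun p : ℝ × ℝ => hS hρ k p.1 p.2 :=
  (continuous_wtL hρ k).add ((mulL.continuous.comp (continuous_wt hρ k)).clm_apply
    (continuous_fS hρ))

lemma continuous_vS (k : ℕ) : Continuous fun p : ℝ × ℝ => vS hρ k p.1 p.2 :=
  (mulL.continuous.comp (continuous_star.comp (continuous_wt hρ (k + 1)))).clm_apply
    (Cp.continuous.comp (continuous_hS hρ 0))

/-! ### Identities between the moments at a fixed point `(x, t)` -/

section pointwise

variable (k : ℕ) (x t : ℝ)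

lemma isMulX_wtL : IsMulX (wtL hρ k x t) (wtL hρ (k + 1) x t) := by
  filter_upwards [wtL_coeFn hρ k x t, wtL_coeFn hρ (k + 1) x t] with s h1 h2
  rw [h1, h2, wt_succ]

lemma isMulX_hS : IsMulX (hS hρ k x t) (hS hρ (k + 1) x t) :=
  (isMulX_wtL hρ k x t).add (isMulX_mulL (wt_succ hρ k x t) _)

lemma isMulX_vS : IsMulX (vS hρ k x t) (vS hρ (k + 1) x t) :=
  isMulX_mulL (star_wt_succ hρ (k + 1) x t) _

lemma sS_coeFn : ∀ᵐ l : ℝ, sS hρ k x t l = star (wt hρ (k + 1) x t) l := by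
  filter_upwards [conjL_coeFn (wtL hρ (k + 1) x t), wtL_coeFn hρ (k + 1) x t] with l h1 h2
  rw [sS, h1, h2]
  rfl

lemma fS_eq : fS hρ x t = -Cm (vS hρ 0 x t) :=
  rhSol_eq (isWeightPair_wt hρ x t) (wtL hρ 0 x t)

lemma conjL_fS : conjL (fS hρ x t) = Cp (conjL (vS hρ 0 x t)) := by
  rw [fS_eq, map_neg, conjL_Cm, neg_neg]

lemma conjL_gS : conjL (gS hρ k x t) = -Cm (conjL (hS hρ k x t)) := conjL_Cp _

lemma conjL_hS_succ : conjL (hS hρ (k + 1) x t)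
    = sS hρ k x t + mulL (star (wt hρ (k + 1) x t)) (conjL (fS hρ x t)) := by
  rw [hS, map_add, conjL_mulL]
  rfl

lemma conjL_vS : conjL (vS hρ k x t) = mulL (wt hρ (k + 1) x t) (conjL (gS hρ 0 x t)) := by
  rw [vS, conjL_mulL, star_star]

lemma shift_gS : Shift (gS hρ k x t) (gS hρ (k + 1) x t) (kS hρ k x t) :=
  (isMulX_hS hρ k x t).shift_Cp

/-- The function `C⁻(l² ρ̄ N₁₂₊)`, up to sign. -/
def FS : L2 := -Cm (vS hρ 1 x t)

lemma shift_fS : Shift (fS hρ x t) (FS hρ x t) (-thS hρ 0 x t) := by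
  rw [fS_eq]
  exact (isMulX_vS hρ 0 x t).shift_Cm.neg

lemma conjL_FS : conjL (FS hρ x t) = Cp (conjL (vS hρ 1 x t)) := by
  rw [FS, map_neg, conjL_Cm, neg_neg]

/-- A power of `l` passes from `C⁺(l^{j+1} N₁₁₋ρ)` to the weight at the price of a moment. This and
its companion for the conjugate weight are the rewriting rules for all that follows. -/
lemma wt_mul_conj_gS (j : ℕ) : mulL (wt hρ k x t) (conjL (gS hρ (j + 1) x t))
    = mulL (wt hρ (k + 1) x t) (conjL (gS hρ j x t)) + conj (kS hρ j x t) • wtL hρ k x t := by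
  rw [(shift_gS hρ j x t).conjL.mulL_eq (wt_succ hρ k x t) (wtL_coeFn hρ k x t), sub_add_cancel]

lemma star_wt_mul_gS (j : ℕ) : mulL (star (wt hρ (k + 2) x t)) (gS hρ j x t)
    = mulL (star (wt hρ (k + 1) x t)) (gS hρ (j + 1) x t) - kS hρ j x t • sS hρ k x t :=
  (shift_gS hρ j x t).mulL_eq (star_wt_succ hρ (k + 1) x t) (sS_coeFn hρ k x t)

/-- The Riemann-Hilbert operator along the family. -/
def TS : L2 →L[ℂ] L2 := rhOp (wt hρ 0 x t) (wt hρ 1 x t)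

/-- The operator `C⁻ M(l ρ̄)`. -/
def BS : L2 →L[ℂ] L2 := Cm.comp (mulL (star (wt hρ 1 x t)))

lemma TS_apply (u : L2) : TS hρ x t u = u + BS hρ x t (Cp (mulL (wt hρ 0 x t) u)) := rfl

lemma TS_injective : Function.Injective (TS hρ x t) := (isWeightPair_wt hρ x t).injective

lemma TS_fS : TS hρ x t (fS hρ x t) = -BS hρ x t (Cp (wtL hρ 0 x t)) :=
  rhOp_rhSol (isWeightPair_wt hρ x t) _

lemma Cp_wt_mul_conj_g1 : Cp (mulL (wt hρ 0 x t) (conjL (gS hρ 1 x t)))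
    = conjL (fS hρ x t) + conj (kS hρ 0 x t) • Cp (wtL hρ 0 x t) := by
  rw [wt_mul_conj_gS hρ 0 x t 0, map_add, map_smul, ← conjL_vS, conjL_fS]

lemma TS_conj_g1 : TS hρ x t (conjL (gS hρ 1 x t))
    = -Cm (sS hρ 0 x t) - conj (kS hρ 0 x t) • TS hρ x t (fS hρ x t) := by
  rw [TS_apply, Cp_wt_mul_conj_g1, conjL_gS, conjL_hS_succ, TS_fS, map_add, map_add, map_smul]
  change -(Cm (sS hρ 0 x t) + BS hρ x t (conjL (fS hρ x t))) + _ = _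
  module

/-- The solution of `T a = -C⁻(l ρ̄)`. -/
def aS : L2 := conjL (gS hρ 1 x t) + conj (kS hρ 0 x t) • fS hρ x t

lemma TS_aS : TS hρ x t (aS hρ x t) = -Cm (sS hρ 0 x t) := by
  rw [aS, map_add, map_smul, TS_conj_g1, sub_add_cancel]

lemma Cp_wt_mul_aS : Cp (mulL (wt hρ 0 x t) (aS hρ x t))
    = conjL (fS hρ x t) + conj (kS hρ 0 x t) • gS hρ 0 x t := by
  rw [aS, map_add, map_add, Cp_wt_mul_conj_g1, map_smul, map_smul, gS, hS, map_add]
  module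

lemma TS_conj_g2 : TS hρ x t (conjL (gS hρ 2 x t))
    = -Cm (sS hρ 1 x t) - conj (thS hρ 0 x t) • Cm (sS hρ 0 x t)
      + conj (kS hρ 0 x t) • BS hρ x t (Cp (wtL hρ 1 x t))
      - conj (kS hρ 1 x t) • TS hρ x t (fS hρ x t) := by
  have h1 : mulL (star (wt hρ 2 x t)) (conjL (fS hρ x t))
      = mulL (star (wt hρ 1 x t)) (conjL (FS hρ x t)) + conj (thS hρ 0 x t) • sS hρ 0 x t := by
    rw [(shift_fS hρ x t).conjL.mulL_eq (star_wt_succ hρ 1 x t) (sS_coeFn hρ 0 x t), map_neg]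
    module
  have h2 : Cp (mulL (wt hρ 0 x t) (conjL (gS hρ 2 x t))) = conjL (FS hρ x t)
      + conj (kS hρ 0 x t) • Cp (wtL hρ 1 x t) + conj (kS hρ 1 x t) • Cp (wtL hρ 0 x t) := by
    rw [wt_mul_conj_gS hρ 0 x t 1, wt_mul_conj_gS hρ 1 x t 0, ← conjL_vS, map_add, map_add,
      ← conjL_FS, map_smul, map_smul]
  rw [TS_apply, h2, conjL_gS, conjL_hS_succ, h1, TS_fS]
  simp only [map_add, map_smul]
  change -(Cm (sS hρ 1 x t) + (BS hρ x t (conjL (FS hρ x t)) + _)) + _ = _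
  module

lemma TS_FS : TS hρ x t (FS hρ x t) = kS hρ 0 x t • Cm (sS hρ 0 x t)
    - BS hρ x t (Cp (wtL hρ 1 x t)) + thS hρ 0 x t • TS hρ x t (fS hρ x t) := by
  have h1 : mulL (wt hρ 0 x t) (FS hρ x t)
      = mulL (wt hρ 1 x t) (fS hρ x t) - thS hρ 0 x t • wtL hρ 0 x t := by
    rw [(shift_fS hρ x t).mulL_eq (wt_succ hρ 0 x t) (wtL_coeFn hρ 0 x t)]
    module
  have h2 : Cp (mulL (wt hρ 1 x t) (fS hρ x t)) = gS hρ 1 x t - Cp (wtL hρ 1 x t) := by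
    rw [gS, hS, map_add, add_sub_cancel_left]
  rw [TS_apply, h1, map_sub, h2, map_smul, TS_fS, FS, vS, star_wt_mul_gS hρ 0 x t 0]
  simp only [map_sub, map_smul]
  change -(BS hρ x t (gS hρ 1 x t) - _) + _ = _
  module

/-- The solution of `T a = -C⁻(l² ρ̄)`. -/
def bS : L2 := conjL (gS hρ 2 x t) + conj (kS hρ 1 x t) • fS hρ x t
  - (conj (kS hρ 0 x t) * thS hρ 0 x t) • fS hρ x t + conj (kS hρ 0 x t) • FS hρ x t
  + (kS hρ 0 x t * conj (kS hρ 0 x t) - conj (thS hρ 0 x t)) • aS hρ x t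

/-- Each term of `bS` removes one error term of `TS_conj_g2`: the multiple of `FS` removes the one
with `wtL hρ 1`, the multiples of `fS` those with `T f`, and the multiple of `aS` the remaining
`C⁻(lρ̄)`. -/
lemma TS_bS : TS hρ x t (bS hρ x t) = -Cm (sS hρ 1 x t) := by
  simp only [bS, map_add, map_sub, map_smul]
  rw [TS_conj_g2, TS_FS, TS_aS]
  module

lemma kap_wt_mul_aS : kap (mulL (wt hρ k x t) (aS hρ x t))
    = -conj (thS hρ k x t) + conj (kS hρ 0 x t) * kS hρ k x t := by
  have h1 : mulL (wt hρ k x t) (aS hρ x t)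
      = conjL (vS hρ k x t) + conj (kS hρ 0 x t) • hS hρ k x t := by
    rw [aS, map_add, map_smul, wt_mul_conj_gS hρ k x t 0, ← conjL_vS, hS]
    module
  rw [h1, ((isMulX_vS hρ k x t).conjL).kap_add ((isMulX_hS hρ k x t).smul _), kap_conjL, kap_smul]
  rfl

lemma kap_wt_mul_bS : kap (mulL (wt hρ 0 x t) (bS hρ x t))
    = -conj (thS hρ 1 x t) + conj (kS hρ 1 x t) * kS hρ 0 x t
      - conj (kS hρ 0 x t) * thS hρ 0 x t * kS hρ 0 x t + conj (kS hρ 0 x t) * kS hρ 1 x t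
      + (kS hρ 0 x t * conj (kS hρ 0 x t) - conj (thS hρ 0 x t))
        * (-conj (thS hρ 0 x t) + conj (kS hρ 0 x t) * kS hρ 0 x t) := by
  have h1 : mulL (wt hρ 0 x t) (bS hρ x t) = conjL (vS hρ 1 x t)
      + (conj (kS hρ 1 x t) - conj (kS hρ 0 x t) * thS hρ 0 x t) • hS hρ 0 x t
      + conj (kS hρ 0 x t) • hS hρ 1 x t
      + (kS hρ 0 x t * conj (kS hρ 0 x t) - conj (thS hρ 0 x t))
        • mulL (wt hρ 0 x t) (aS hρ x t) := by
    simp only [bS, map_add, map_sub, map_smul]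
    rw [wt_mul_conj_gS hρ 0 x t 1, wt_mul_conj_gS hρ 1 x t 0, ← conjL_vS, hS, hS,
      (shift_fS hρ x t).mulL_eq (wt_succ hρ 0 x t) (wtL_coeFn hρ 0 x t)]
    module
  have m1 := (isMulX_vS hρ 1 x t).conjL
  have m2 := (isMulX_hS hρ 0 x t).smul (conj (kS hρ 1 x t) - conj (kS hρ 0 x t) * thS hρ 0 x t)
  have m3 := (isMulX_hS hρ 1 x t).smul (conj (kS hρ 0 x t))
  have m4 := (isMulX_mulL (wt_succ hρ 0 x t) (aS hρ x t)).smul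
    (kS hρ 0 x t * conj (kS hρ 0 x t) - conj (thS hρ 0 x t))
  rw [h1, ((m1.add m2).add m3).kap_add m4, (m1.add m2).kap_add m3, m1.kap_add m2, kap_conjL,
    kap_smul, kap_smul, kap_smul, kap_wt_mul_aS]
  change -conj (thS hρ 1 x t) + _ * kS hρ 0 x t + _ * kS hρ 1 x t + _ = _
  ring

/-- The first-order term of `det N = 1`. -/
lemma thS_add_conj : thS hρ 0 x t + conj (thS hρ 0 x t) = kS hρ 0 x t * conj (kS hρ 0 x t) := by
  have h1 := (isMulX_hS hρ 0 x t).pair_conjL_Cp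
  have hveq : vS hρ 0 x t = Cp (vS hρ 0 x t) + fS hρ x t := by
    conv_lhs => rw [← Cp_sub_Cm (vS hρ 0 x t)]
    rw [fS_eq, sub_eq_add_neg]
  -- With `h_k = l^k N₁₁₋ρ`, the number `⟨h₁, C⁺h₀⟩` is also `2πi θ₀ + ‖f‖²`, where `θ₀` is `thS hρ
  -- 0 x t`. Comparing imaginary parts with `IsMulX.pair_conjL_Cp` gives the relation.
  have h2 : pair (conjL (hS hρ 1 x t)) (gS hρ 0 x t)
      = (∫ s, vS hρ 0 x t s) + inner ℂ (fS hρ x t) (fS hρ x t) := by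
    rw [conjL_hS_succ, map_add, add_apply, pair_mulL]
    congr 1
    · rw [pair_apply]
      apply integral_congr_ae
      filter_upwards [sS_coeFn hρ 0 x t, mulL_coeFn (star (wt hρ 1 x t)) (gS hρ 0 x t)] with s e1 e2
      rw [e1, vS, e2]
    · change pair (conjL (fS hρ x t)) (vS hρ 0 x t) = _
      rw [inner_eq_pair]
      conv_lhs => rw [hveq, map_add, conjL_fS, pair_Cp_Cp, zero_add, ← conjL_fS]
  have h3 : ∫ s, vS hρ 0 x t s = 2 * Real.pi * I * thS hρ 0 x t := by
    rw [thS, kap, mul_inv_cancel_left₀ two_pi_I_ne]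
  change pair (conjL (hS hρ 1 x t)) (gS hρ 0 x t) = conj (pair (conjL (hS hρ 1 x t)) (gS hρ 0 x t))
    + 2 * Real.pi * I * (kS hρ 0 x t * conj (kS hρ 0 x t)) at h1
  rw [h2, map_add, inner_self_conj, h3] at h1
  simp only [map_mul, Complex.conj_I, Complex.conj_ofReal, map_ofNat] at h1
  apply mul_left_cancel₀ two_pi_I_ne
  linear_combination h1

end pointwise

/-! ### Derivatives in space and time -/

section derivatives

variable (x t : ℝ)

lemma hasDerivAt_star_wt_x (k : ℕ) : HasDerivAt (fun y => star (wt hρ k y t))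
    ((2 * I : ℂ) • star (wt hρ (k + 1) x t)) x := by
  have := (hasDerivAt_wt_x hρ k x t).star
  convert! this using 1
  rw [star_smul]
  simp

lemma hasDerivAt_star_wt_t (k : ℕ) : HasDerivAt (fun s => star (wt hρ k x s))
    ((4 * I : ℂ) • star (wt hρ (k + 2) x t)) t := by
  have := (hasDerivAt_wt_t hρ k x t).star
  convert! this using 1
  rw [star_smul]
  simp

/-- Differentiating `f = -C⁻v` and moving the part containing `f'` to the left gives `T f'`. The
derivatives of the two weights then cancel up to the moment in `star_wt_mul_gS`, leaving `2i k₀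
C⁻(lρ̄) = -2i k₀ T a`; injectivity of `T` concludes. -/
lemma hasDerivAt_fS_x : HasDerivAt (fun y => fS hρ y t)
    ((-(2 * I) * kS hρ 0 x t) • aS hρ x t) x := by
  obtain ⟨f', hf'⟩ := exists_hasDerivAt_rhSol (R₀ := fun y => wt hρ 0 y t) (R₁ := fun y => wt hρ 1 y t)
    (r := fun y => wtL hρ 0 y t) (isWeightPair_wt hρ x t) (hasDerivAt_wt_x hρ 0 x t)
    (hasDerivAt_wt_x hρ 1 x t) (hasDerivAt_wtL_x hρ 0 x t)
  change HasDerivAt (fun y => fS hρ y t) f' x at hf'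
  have hh := (hasDerivAt_wtL_x hρ 0 x t).add (hasDerivAt_bilin mulL (hasDerivAt_wt_x hρ 0 x t) hf')
  have hv := hasDerivAt_clm Cm (hasDerivAt_bilin mulL (hasDerivAt_star_wt_x hρ x t 1)
    (hasDerivAt_clm Cp hh))
  have hf2 := HasDerivAt.congr_of_eventuallyEq (f₁ := fun y => fS hρ y t) hv.neg
    (Eventually.of_forall fun y => fS_eq hρ y t)
  have heq := hf'.unique hf2
  have hT : TS hρ x t f' = TS hρ x t ((-(2 * I) * kS hρ 0 x t) • aS hρ x t) := by
    rw [map_smul, TS_aS, TS_apply]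
    conv_lhs => enter [1]; rw [heq]
    have e1 : Cp (-(2 * I) • wtL hρ 1 x t + (mulL (wt hρ 0 x t) f'
        + mulL (-(2 * I) • wt hρ 1 x t) (fS hρ x t)))
        = -(2 * I) • gS hρ 1 x t + Cp (mulL (wt hρ 0 x t) f') := by
      rw [gS, hS]
      simp only [map_add, map_smul, smul_apply]
      module
    have e2 : mulL ((2 * I : ℂ) • star (wt hρ 2 x t)) (gS hρ 0 x t)
        = (2 * I : ℂ) • (mulL (star (wt hρ 1 x t)) (gS hρ 1 x t) - kS hρ 0 x t • sS hρ 0 x t) := by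
      rw [map_smul, smul_apply, star_wt_mul_gS hρ 0 x t 0]
    change -Cm (mulL (star (wt hρ 1 x t)) (Cp (-(2 * I) • wtL hρ 1 x t + (mulL (wt hρ 0 x t) f'
        + mulL (-(2 * I) • wt hρ 1 x t) (fS hρ x t))))
        + mulL ((2 * I : ℂ) • star (wt hρ 2 x t)) (gS hρ 0 x t)) + _ = _
    rw [e1, e2]
    simp only [BS, map_add, map_sub, map_smul, ContinuousLinearMap.comp_apply]
    module
  rwa [TS_injective hρ x t hT] at hf'

/-- As for `x`, but two powers of `l` have to be moved, which leaves two sources: `C⁻(lρ̄)` with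
coefficient `k₁` and `C⁻(l²ρ̄)` with coefficient `k₀`. -/
lemma hasDerivAt_fS_t : HasDerivAt (fun s => fS hρ x s)
    ((-(4 * I) * kS hρ 1 x t) • aS hρ x t + (-(4 * I) * kS hρ 0 x t) • bS hρ x t) t := by
  obtain ⟨f', hf'⟩ := exists_hasDerivAt_rhSol (R₀ := fun s => wt hρ 0 x s) (R₁ := fun s => wt hρ 1 x s)
    (r := fun s => wtL hρ 0 x s) (isWeightPair_wt hρ x t) (hasDerivAt_wt_t hρ 0 x t)
    (hasDerivAt_wt_t hρ 1 x t) (hasDerivAt_wtL_t hρ 0 x t)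
  change HasDerivAt (fun s => fS hρ x s) f' t at hf'
  have hh := (hasDerivAt_wtL_t hρ 0 x t).add (hasDerivAt_bilin mulL (hasDerivAt_wt_t hρ 0 x t) hf')
  have hv := hasDerivAt_clm Cm (hasDerivAt_bilin mulL (hasDerivAt_star_wt_t hρ x t 1)
    (hasDerivAt_clm Cp hh))
  have hf2 := HasDerivAt.congr_of_eventuallyEq (f₁ := fun s => fS hρ x s) hv.neg
    (Eventually.of_forall fun s => fS_eq hρ x s)
  have heq := hf'.unique hf2
  have hT : TS hρ x t f' = TS hρ x t ((-(4 * I) * kS hρ 1 x t) • aS hρ x t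
      + (-(4 * I) * kS hρ 0 x t) • bS hρ x t) := by
    rw [map_add, map_smul, map_smul, TS_aS, TS_bS, TS_apply]
    conv_lhs => enter [1]; rw [heq]
    have e1 : Cp (-(4 * I) • wtL hρ 2 x t + (mulL (wt hρ 0 x t) f'
        + mulL (-(4 * I) • wt hρ 2 x t) (fS hρ x t)))
        = -(4 * I) • gS hρ 2 x t + Cp (mulL (wt hρ 0 x t) f') := by
      rw [gS, hS]
      simp only [map_add, map_smul, smul_apply]
      module
    have e2 : mulL ((4 * I : ℂ) • star (wt hρ 3 x t)) (gS hρ 0 x t)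
        = (4 * I : ℂ) • (mulL (star (wt hρ 1 x t)) (gS hρ 2 x t) - kS hρ 1 x t • sS hρ 0 x t
          - kS hρ 0 x t • sS hρ 1 x t) := by
      rw [map_smul, smul_apply, star_wt_mul_gS hρ 1 x t 0, star_wt_mul_gS hρ 0 x t 1]
    change -Cm (mulL (star (wt hρ 1 x t)) (Cp (-(4 * I) • wtL hρ 2 x t + (mulL (wt hρ 0 x t) f'
        + mulL (-(4 * I) • wt hρ 2 x t) (fS hρ x t))))
        + mulL ((4 * I : ℂ) • star (wt hρ 3 x t)) (gS hρ 0 x t)) + _ = _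
    rw [e1, e2]
    simp only [BS, map_add, map_sub, map_smul, ContinuousLinearMap.comp_apply]
    module
  rwa [TS_injective hρ x t hT] at hf'

lemma hasDerivAt_hS_x (k : ℕ) : HasDerivAt (fun y => hS hρ k y t)
    (-(2 * I) • hS hρ (k + 1) x t
      + (-(2 * I) * kS hρ 0 x t) • mulL (wt hρ k x t) (aS hρ x t)) x := by
  have := (hasDerivAt_wtL_x hρ k x t).add
    (hasDerivAt_bilin mulL (hasDerivAt_wt_x hρ k x t) (hasDerivAt_fS_x hρ x t))
  convert! this using 1
  simp only [hS, map_smul, smul_apply]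
  module

lemma hasDerivAt_hS_t (k : ℕ) : HasDerivAt (fun s => hS hρ k x s)
    (-(4 * I) • hS hρ (k + 2) x t
      + ((-(4 * I) * kS hρ 1 x t) • mulL (wt hρ k x t) (aS hρ x t)
        + (-(4 * I) * kS hρ 0 x t) • mulL (wt hρ k x t) (bS hρ x t))) t := by
  have := (hasDerivAt_wtL_t hρ k x t).add
    (hasDerivAt_bilin mulL (hasDerivAt_wt_t hρ k x t) (hasDerivAt_fS_t hρ x t))
  convert! this using 1
  simp only [hS, map_smul, smul_apply, map_add]
  module

lemma hasDerivAt_kS_x (k : ℕ) : HasDerivAt (fun y => kS hρ k y t)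
    (-(2 * I) * kS hρ (k + 1) x t + (-(2 * I) * kS hρ 0 x t)
      * (-conj (thS hρ k x t) + conj (kS hρ 0 x t) * kS hρ k x t)) x := by
  have m1 : ∀ k, IsMulX (-(2 * I) • hS hρ (k + 1) x t) (-(2 * I) • hS hρ (k + 2) x t) :=
    fun k => (isMulX_hS hρ (k + 1) x t).smul _
  have m2 := fun k => (isMulX_mulL (wt_succ hρ k x t) (aS hρ x t)).smul (-(2 * I) * kS hρ 0 x t)
  have := hasDerivAt_kap (hasDerivAt_hS_x hρ x t k) (hasDerivAt_hS_x hρ x t (k + 1))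
    (fun y => isMulX_hS hρ k y t) ((m1 k).add (m2 k))
  rw [(m1 k).kap_add (m2 k), kap_smul, kap_smul, kap_wt_mul_aS] at this
  exact this

lemma hasDerivAt_kS_t : HasDerivAt (fun s => kS hρ 0 x s)
    (-(4 * I) * kS hρ 2 x t + ((-(4 * I) * kS hρ 1 x t)
      * kap (mulL (wt hρ 0 x t) (aS hρ x t))
      + (-(4 * I) * kS hρ 0 x t) * kap (mulL (wt hρ 0 x t) (bS hρ x t)))) t := by
  have m1 : ∀ k, IsMulX (-(4 * I) • hS hρ (k + 2) x t) (-(4 * I) • hS hρ (k + 3) x t) :=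
    fun k => (isMulX_hS hρ (k + 2) x t).smul _
  have m2 := fun k => (isMulX_mulL (wt_succ hρ k x t) (aS hρ x t)).smul (-(4 * I) * kS hρ 1 x t)
  have m3 := fun k => (isMulX_mulL (wt_succ hρ k x t) (bS hρ x t)).smul (-(4 * I) * kS hρ 0 x t)
  have := hasDerivAt_kap (hasDerivAt_hS_t hρ x t 0) (hasDerivAt_hS_t hρ x t 1)
    (fun s => isMulX_hS hρ 0 x s) ((m1 0).add ((m2 0).add (m3 0)))
  rw [(m1 0).kap_add ((m2 0).add (m3 0)), (m2 0).kap_add (m3 0), kap_smul, kap_smul,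
    kap_smul] at this
  exact this

lemma hasDerivAt_thS_x (k : ℕ) : HasDerivAt (fun y => thS hρ k y t)
    ((-(2 * I) * kS hρ 0 x t)
      * (-conj (kS hρ (k + 1) x t) + conj (kS hρ 0 x t) * thS hρ k x t)) x := by
  have hv : ∀ k, HasDerivAt (fun y => vS hρ k y t)
      ((-(2 * I) * kS hρ 0 x t) • (conjL (hS hρ (k + 1) x t)
        + conj (kS hρ 0 x t) • vS hρ k x t)) x := by
    intro k
    have := hasDerivAt_bilin mulL (hasDerivAt_star_wt_x hρ x t (k + 1))
      (hasDerivAt_clm Cp (hasDerivAt_hS_x hρ x t 0))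
    convert! this using 1
    change _ = _ + mulL ((2 * I : ℂ) • star (wt hρ (k + 2) x t)) (gS hρ 0 x t)
    rw [map_smul, smul_apply, star_wt_mul_gS hρ k x t 0, map_add, map_smul, map_smul,
      Cp_wt_mul_aS, conjL_hS_succ]
    change _ = mulL (star (wt hρ (k + 1) x t)) (-(2 * I) • gS hρ 1 x t + _) + _
    simp only [map_add, map_smul, vS]
    module
  have m1 : ∀ k, IsMulX (conjL (hS hρ (k + 1) x t)) (conjL (hS hρ (k + 2) x t)) :=
    fun k => (isMulX_hS hρ (k + 1) x t).conjL
  have m2 := fun k => (isMulX_vS hρ k x t).smul (conj (kS hρ 0 x t))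
  have := hasDerivAt_kap (hv k) (hv (k + 1)) (fun y => isMulX_vS hρ k y t)
    (((m1 k).add (m2 k)).smul (-(2 * I) * kS hρ 0 x t))
  rw [kap_smul, (m1 k).kap_add (m2 k), kap_smul, kap_conjL] at this
  exact this

end derivatives

end solution

/-! ### From the moments to the differential equation -/

section equation

variable {ρ : ℝ → ℂ} (hρ : Rapid ρ)

lemma conj_thS_zero (x t : ℝ) : conj (thS hρ 0 x t)
    = kS hρ 0 x t * conj (kS hρ 0 x t) - thS hρ 0 x t := by
  linear_combination thS_add_conj hρ x t

lemma hasDerivAt_kS_zero_x (x t : ℝ) : HasDerivAt (fun y => kS hρ 0 y t)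
    (-(2 * I) * (kS hρ 1 x t + kS hρ 0 x t * thS hρ 0 x t)) x := by
  refine (hasDerivAt_kS_x hρ x t 0).congr_deriv ?_
  rw [conj_thS_zero]
  ring

lemma continuous_kS (k : ℕ) : Continuous fun p : ℝ × ℝ => kS hρ k p.1 p.2 :=
  continuous_kap (continuous_hS hρ k) (continuous_hS hρ (k + 1)) fun p => isMulX_hS hρ k p.1 p.2

lemma continuous_thS (k : ℕ) : Continuous fun p : ℝ × ℝ => thS hρ k p.1 p.2 :=
  continuous_kap (continuous_vS hρ k) (continuous_vS hρ (k + 1)) fun p => isMulX_vS hρ k p.1 p.2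

/-- The potential recovered from the reflection coefficient solves the evolution equation. -/
theorem isClassicalSolution_kS : IsClassicalSolution fun x t => -(2 * I) * kS hρ 0 x t := by
  have cK := continuous_kS hρ
  have cT := continuous_thS hρ
  have cc : Continuous (conj : ℂ → ℂ) := continuous_conj
  refine ⟨fun x t => -4 * (kS hρ 1 x t + kS hρ 0 x t * thS hρ 0 x t),
    fun x t => -4 * ((-(2 * I) * kS hρ 2 x t + (-(2 * I) * kS hρ 0 x t)
      * (-conj (thS hρ 1 x t) + conj (kS hρ 0 x t) * kS hρ 1 x t))
      + ((-(2 * I) * (kS hρ 1 x t + kS hρ 0 x t * thS hρ 0 x t)) * thS hρ 0 x t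
        + kS hρ 0 x t * ((-(2 * I) * kS hρ 0 x t)
      * (-conj (kS hρ 1 x t) + conj (kS hρ 0 x t) * thS hρ 0 x t)))),
    fun x t => -(2 * I) * (-(4 * I) * kS hρ 2 x t + ((-(4 * I) * kS hρ 1 x t)
      * kap (mulL (wt hρ 0 x t) (aS hρ x t))
      + (-(4 * I) * kS hρ 0 x t) * kap (mulL (wt hρ 0 x t) (bS hρ x t)))),
    ?_, ?_, ?_, ?_, ?_, ?_, ?_, ?_⟩
  · exact continuous_const.mul (cK 0)
  · exact continuous_const.mul ((cK 1).add ((cK 0).mul (cT 0)))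
  · have h0 := cK 0
    have h1 := cK 1
    have h2 := cK 2
    have h3 := cT 0
    have h4 := cT 1
    simp only [Function.uncurry_def]
    fun_prop
  · have h0 := cK 0
    have h1 := cK 1
    have h2 := cK 2
    have h3 := cT 0
    have h4 := cT 1
    simp only [Function.uncurry_def, kap_wt_mul_aS, kap_wt_mul_bS]
    fun_prop
  · intro x t
    refine ((hasDerivAt_kS_zero_x hρ x t).const_mul _).congr_deriv ?_
    ring_nf
    rw [I_sq]
    ring
  · intro x t
    exact ((hasDerivAt_kS_x hρ x t 1).add ((hasDerivAt_kS_zero_x hρ x t).mul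
      (hasDerivAt_thS_x hρ x t 0))).const_mul _
  · intro x t
    exact (hasDerivAt_kS_t hρ x t).const_mul _
  · intro x t
    have h4 : ((‖-(2 * I) * kS hρ 0 x t‖ : ℝ) : ℂ) ^ 4
        = (4 * (kS hρ 0 x t * conj (kS hρ 0 x t))) ^ 2 := by
      rw [show (4 : ℕ) = 2 * 2 from rfl, pow_mul, ← Complex.mul_conj']
      simp only [map_mul, map_neg, map_ofNat, conj_I]
      linear_combination (16 * (1 - I ^ 2) * kS hρ 0 x t ^ 2 * conj (kS hρ 0 x t) ^ 2) * (-I_sq)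
    have hI3 : I ^ 3 = -I := by rw [pow_succ, I_sq]; ring
    dsimp only
    rw [h4, kap_wt_mul_aS, kap_wt_mul_bS]
    simp only [map_mul, map_neg, map_add, map_ofNat]
    -- Once the determinant relation eliminates `conj θ₀`, the equation is a polynomial identity in
    -- the moments and their conjugates.
    rw [conj_thS_zero]
    ring_nf
    simp only [hI3]
    ring

end equation

/-! ### Uniform bounds for Cauchy integrals -/

/-- The bounded function `φ` is Lipschitz. -/
def IsLip (φ : ℝ →ᵇ ℂ) : Prop := ∃ L : ℝ, ∀ l m : ℝ, ‖φ l - φ m‖ ≤ L * |l - m|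

lemma IsLip.mul {φ ψ : ℝ →ᵇ ℂ} (h : IsLip φ) (h' : IsLip ψ) : IsLip (φ * ψ) := by
  obtain ⟨L, hL⟩ := h
  obtain ⟨M, hM⟩ := h'
  refine ⟨L * ‖ψ‖ + ‖φ‖ * M, fun l m => ?_⟩
  have h1 : (φ * ψ) l - (φ * ψ) m = (φ l - φ m) * ψ l + φ m * (ψ l - ψ m) := by
    simp only [BoundedContinuousFunction.coe_mul, Pi.mul_apply]
    ring
  rw [h1, add_mul, mul_right_comm, mul_assoc ‖φ‖]
  refine (norm_add_le _ _).trans (add_le_add ?_ ?_) <;> rw [norm_mul]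
  · exact mul_le_mul (hL l m) (ψ.norm_coe_le_norm l) (norm_nonneg _)
      ((norm_nonneg _).trans (hL l m))
  · exact mul_le_mul (φ.norm_coe_le_norm m) (hM l m) (norm_nonneg _) (norm_nonneg _)

lemma IsLip.star {φ : ℝ →ᵇ ℂ} (h : IsLip φ) : IsLip (star φ) := by
  obtain ⟨L, hL⟩ := h
  refine ⟨L, fun l m => ?_⟩
  change ‖conj (φ l) - conj (φ m)‖ ≤ _
  rw [← map_sub, Complex.norm_conj]
  exact hL l m

lemma IsLip.sub {φ ψ : ℝ →ᵇ ℂ} (h : IsLip φ) (h' : IsLip ψ) : IsLip (φ - ψ) := by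
  obtain ⟨L, hL⟩ := h
  obtain ⟨M, hM⟩ := h'
  refine ⟨L + M, fun l m => ?_⟩
  have h1 : (φ - ψ) l - (φ - ψ) m = (φ l - φ m) - (ψ l - ψ m) := by
    simp only [BoundedContinuousFunction.coe_sub, Pi.sub_apply]
    ring
  rw [h1, add_mul]
  exact (norm_sub_le _ _).trans (add_le_add (hL l m) (hM l m))

lemma IsLip.smul {φ : ℝ →ᵇ ℂ} (h : IsLip φ) (c : ℂ) : IsLip (c • φ) := by
  obtain ⟨L, hL⟩ := h
  refine ⟨‖c‖ * L, fun l m => ?_⟩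
  change ‖c • φ l - c • φ m‖ ≤ _
  rw [← smul_sub, norm_smul, mul_assoc]
  exact mul_le_mul_of_nonneg_left (hL l m) (norm_nonneg _)

/-- The pole stays at height one, so the squared norm is `π` for every `a`, by the residue formula.
-/
lemma exists_norm_kerL_le : ∃ M : ℝ, ∀ (a : ℝ) (h : ((a : ℂ) + I).im ≠ 0),
    ‖kerL ((a : ℂ) + I) h‖ ≤ M := by
  refine ⟨Real.sqrt Real.pi, fun a h => ?_⟩
  have h1 : 0 < ((a : ℂ) + I).im := by simp
  have h2 : (conj ((a : ℂ) + I)).im < 0 := by simp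
  have h4 := inner_eq_pair (kerL ((a : ℂ) + I) h) (kerL ((a : ℂ) + I) h)
  rw [conjL_kerL, pair_comm, pair_kerL_kerL h1 h2, inner_self_eq_norm_sq_to_K] at h4
  have h5 : 2 * (Real.pi : ℂ) * I / ((a : ℂ) + I - conj ((a : ℂ) + I)) = (Real.pi : ℂ) := by
    simp only [map_add, conj_ofReal, conj_I]
    rw [show (a : ℂ) + I - (a + -I) = 2 * I by ring]
    field_simp
  rw [h5] at h4
  apply Real.le_sqrt_of_sq_le
  have h6 : ‖kerL ((a : ℂ) + I) h‖ ^ 2 = Real.pi :=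
    Complex.ofReal_injective (by push_cast; exact h4)
  exact h6.le

/-- If the Cauchy integral of `u` vanishes at `z`, that of `φ u` is bounded there by a multiple
of `‖u‖` which does not depend on `z`. -/
lemma exists_norm_pair_kerL_le {φ : ℝ →ᵇ ℂ} (hφ : IsLip φ) : ∃ M : ℝ, ∀ (u : L2) (z : ℂ)
    (hz : z.im ≠ 0), pair u (kerL z hz) = 0 → ‖pair (mulL φ u) (kerL z hz)‖ ≤ M * ‖u‖ := by
  obtain ⟨L, hL⟩ := hφ
  obtain ⟨K, hK⟩ := exists_norm_kerL_le
  have hL0 : 0 ≤ L := by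
    have := (norm_nonneg _).trans (hL 1 0)
    simpa using this
  have hK0 : 0 ≤ K := (norm_nonneg _).trans (hK 0 (by simp))
  refine ⟨‖mulL‖ * (2 * ‖φ‖ + L) * K, fun u z hz hu => ?_⟩
  set a := z.re
  have hw : ((a : ℂ) + I).im ≠ 0 := by simp
  -- By hypothesis `φ` may be replaced by `φ - φ(a)` with `a = Re z`. Its product with the kernel at
  -- `z` is then comparable to the kernel at `a + i`: near `a` by the Lipschitz bound, far from `a`
  -- by boundedness. The bound does not involve `Im z`.
  have hbd : ∀ s : ℝ, ‖(φ s - φ a) * (ker z s * (s - (a + I)))‖ ≤ 2 * ‖φ‖ + L := by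
    intro s
    rcases eq_or_ne s a with rfl | hs
    · rw [sub_self, zero_mul, norm_zero]
      positivity
    have hr : 0 < |s - a| := abs_pos.mpr (sub_ne_zero.mpr hs)
    have h1 : |s - a| ≤ ‖(s : ℂ) - z‖ := by
      have := Complex.abs_re_le_norm ((s : ℂ) - z)
      simpa using this
    have h2 : ‖(s : ℂ) - (a + I)‖ ≤ |s - a| + 1 := by
      have h3 : (s : ℂ) - (a + I) = ((s - a : ℝ) : ℂ) - I := by
        push_cast
        ring
      rw [h3]
      refine (norm_sub_le _ _).trans ?_
      rw [Complex.norm_real, Complex.norm_I, Real.norm_eq_abs]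
    have h3 : ‖φ s - φ a‖ ≤ 2 * ‖φ‖ := (norm_sub_le _ _).trans (by
      linarith [φ.norm_coe_le_norm s, φ.norm_coe_le_norm a])
    rw [norm_mul, norm_mul, ker, norm_inv]
    have h4 : ‖φ s - φ a‖ * (|s - a| + 1) ≤ (2 * ‖φ‖ + L) * |s - a| := by
      nlinarith [hL s a]
    calc ‖φ s - φ a‖ * (‖(s : ℂ) - z‖⁻¹ * ‖(s : ℂ) - (a + I)‖)
        ≤ ‖φ s - φ a‖ * (|s - a|⁻¹ * (|s - a| + 1)) := by gcongr
      _ = ‖φ s - φ a‖ * (|s - a| + 1) / |s - a| := by ring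
      _ ≤ _ := by rwa [div_le_iff₀ hr]
  have hcont : Continuous fun s : ℝ => (φ s - φ a) * (ker z s * (s - (a + I))) :=
    (φ.continuous.sub continuous_const).mul ((continuous_ker hz).mul
      (continuous_ofReal.sub continuous_const))
  let m : ℝ →ᵇ ℂ := BoundedContinuousFunction.ofNormedAddCommGroup _ hcont _ hbd
  have hm : ‖m‖ ≤ 2 * ‖φ‖ + L :=
    BoundedContinuousFunction.norm_ofNormedAddCommGroup_le _ (by positivity) hbd
  have h1 : pair (mulL φ u) (kerL z hz) = pair (mulL m u) (kerL (a + I) hw) := by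
    have h2 : pair (mulL φ u) (kerL z hz) = pair (mulL φ u - φ a • u) (kerL z hz) := by
      rw [map_sub, map_smul, sub_apply, smul_apply, hu, smul_zero, sub_zero]
    rw [h2, pair_kerL, pair_kerL]
    apply integral_congr_ae
    filter_upwards [mulL_coeFn φ u, mulL_coeFn m u, Lp.coeFn_sub (mulL φ u) (φ a • u),
      Lp.coeFn_smul (φ a) u] with s e1 e2 e3 e4
    have h5 : (s : ℂ) - (a + I) ≠ 0 := ofReal_sub_ne_zero hw s
    rw [e3, e2, Pi.sub_apply, e1, e4, Pi.smul_apply, smul_eq_mul]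
    change _ = (φ s - φ a) * (ker z s * (s - (a + I))) * u s * ((s : ℂ) - (a + I))⁻¹
    field_simp
  rw [h1]
  calc ‖pair (mulL m u) (kerL (a + I) hw)‖ ≤ ‖mulL m u‖ * ‖kerL (a + I) hw‖ := norm_pair_le _ _
    _ ≤ (‖mulL‖ * ‖m‖ * ‖u‖) * K := by
        refine mul_le_mul (mulL.le_opNorm₂ m u) (hK a hw) (norm_nonneg _) (by positivity)
    _ ≤ (‖mulL‖ * (2 * ‖φ‖ + L) * ‖u‖) * K := by gcongr
    _ = _ := by ring

section data

variable {ρ : ℝ → ℂ} (hρ : Rapid ρ)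

/-- The derivative of the phase in `l` grows linearly, which costs one more moment of `ρ`; this is
used for `|l - m| ≤ 1`, while boundedness suffices otherwise. -/
lemma isLip_wt (k : ℕ) (x t : ℝ) : IsLip (wt hρ k x t) := by
  obtain ⟨B, hB⟩ := hρ.bdd k
  obtain ⟨B', hB'⟩ := hρ.bdd (k + 1)
  obtain ⟨C, hC⟩ := hρ.lip k
  have hB0 : 0 ≤ B := (norm_nonneg _).trans (hB 0)
  have hB0' : 0 ≤ B' := (norm_nonneg _).trans (hB' 0)
  have hC0 : 0 ≤ C := by
    have := (norm_nonneg _).trans (hC 1 0)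
    simpa using this
  have hph : ∀ l m : ℝ, |l - m| ≤ 1 →
      ‖phase x t l - phase x t m‖ ≤ (2 * |x| + 4 * |t| * (2 * |m| + 1)) * |l - m| := by
    intro l m h
    refine (norm_exp_mul_I_sub_le _ _).trans ?_
    have h1 : -(2 * l * x + 4 * l ^ 2 * t) - -(2 * m * x + 4 * m ^ 2 * t)
        = -((2 * x + 4 * t * (2 * m + (l - m))) * (l - m)) := by ring
    rw [h1, abs_neg, abs_mul]
    refine mul_le_mul_of_nonneg_right ((abs_add_le _ _).trans ?_) (abs_nonneg _)
    rw [abs_mul, abs_mul, abs_mul, abs_of_pos (two_pos), abs_of_pos (four_pos : (0 : ℝ) < 4)]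
    gcongr
    refine (abs_add_le _ _).trans ?_
    rw [abs_mul, abs_of_pos (two_pos)]
    gcongr
  refine ⟨C + (B * (2 * |x| + 4 * |t|) + 8 * |t| * B') + 2 * B, fun l m => ?_⟩
  rcases le_total |l - m| 1 with h | h
  · have h1 : wt hρ k x t l - wt hρ k x t m
        = ((l : ℂ) ^ k * ρ l - (m : ℂ) ^ k * ρ m) * phase x t l
          + (m : ℂ) ^ k * ρ m * (phase x t l - phase x t m) := by
      rw [wt_apply, wt_apply]
      ring
    have h2 : ‖(m : ℂ) ^ k * ρ m‖ * |m| ≤ B' := by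
      have := hB' m
      rw [pow_succ', mul_assoc, norm_mul, Complex.norm_real, Real.norm_eq_abs] at this
      linarith
    rw [h1]
    refine (norm_add_le _ _).trans ?_
    rw [norm_mul, norm_mul (_ * _) (_ - _), norm_phase, mul_one]
    have h3 : ‖(m : ℂ) ^ k * ρ m‖ * ‖phase x t l - phase x t m‖
        ≤ (B * (2 * |x| + 4 * |t|) + 8 * |t| * B') * |l - m| := by
      calc _ ≤ ‖(m : ℂ) ^ k * ρ m‖ * ((2 * |x| + 4 * |t| * (2 * |m| + 1)) * |l - m|) := by
            gcongr
            exact hph l m h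
        _ = (‖(m : ℂ) ^ k * ρ m‖ * (2 * |x| + 4 * |t|)
              + 8 * |t| * (‖(m : ℂ) ^ k * ρ m‖ * |m|)) * |l - m| := by ring
        _ ≤ _ := by
            gcongr
            exact hB m
    have h4 := hC l m
    have h5 : 0 ≤ 2 * B * |l - m| := by positivity
    linarith
  · have h1 : ∀ l, ‖wt hρ k x t l‖ ≤ B := by
      intro l
      rw [wt_apply, norm_mul, norm_phase, mul_one]
      exact hB l
    calc ‖wt hρ k x t l - wt hρ k x t m‖ ≤ 2 * B := (norm_sub_le _ _).trans (by
          linarith [h1 l, h1 m])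
      _ ≤ 2 * B * |l - m| := le_mul_of_one_le_right (by positivity) h
      _ ≤ _ := by
          refine mul_le_mul_of_nonneg_right ?_ (abs_nonneg _)
          have : 0 ≤ C + (B * (2 * |x| + 4 * |t|) + 8 * |t| * B') := by positivity
          linarith

lemma wtL_eq_mulL_kerL (k : ℕ) (x t : ℝ) (w : ℂ) (hw : w.im ≠ 0) :
    wtL hρ k x t = mulL (wt hρ (k + 1) x t - w • wt hρ k x t) (kerL w hw) := by
  apply Lp.ext
  filter_upwards [wtL_coeFn hρ k x t, coeFn_kerL w hw,
    mulL_coeFn (wt hρ (k + 1) x t - w • wt hρ k x t) (kerL w hw)] with s e1 e2 e3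
  have h1 : (wt hρ (k + 1) x t - w • wt hρ k x t) s
      = wt hρ (k + 1) x t s - w * wt hρ k x t s := rfl
  rw [e1, e3, e2, h1, wt_succ, ker]
  have := ofReal_sub_ne_zero hw s
  field_simp

/-- The density is split differently according to the half-plane of `z`, so that each piece is a
Lipschitz weight times a function whose Cauchy integral vanishes there. Above the line these are
ranges of `C⁻`, and `f = -C⁻v` already has this form; below, they are ranges of `C⁺`, reached
through `f = v - C⁺v` and `v = lρ̄ C⁺h₀`, where `h₀ = N₁₁₋ρ`. -/
lemma exists_norm_pair_hS_le (k : ℕ) (x t : ℝ) : ∃ M : ℝ, ∀ (z : ℂ) (hz : z.im ≠ 0),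
    ‖pair (hS hρ k x t) (kerL z hz)‖ ≤ M := by
  have hI : (I : ℂ).im ≠ 0 := I_im_ne
  have hI' : (-I : ℂ).im ≠ 0 := by simp
  have l0 := isLip_wt hρ k x t
  have l1 := isLip_wt hρ (k + 1) x t
  obtain ⟨M₁, h₁⟩ := exists_norm_pair_kerL_le (l1.sub (l0.smul I))
  obtain ⟨M₂, h₂⟩ := exists_norm_pair_kerL_le (l1.sub (l0.smul (-I)))
  obtain ⟨M₃, h₃⟩ := exists_norm_pair_kerL_le l0
  obtain ⟨M₄, h₄⟩ := exists_norm_pair_kerL_le (l0.mul (isLip_wt hρ 1 x t).star)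
  refine ⟨max (M₁ * ‖kerL I hI‖ + M₃ * ‖fS hρ x t‖)
    (M₂ * ‖kerL (-I) hI'‖ + (M₄ * ‖gS hρ 0 x t‖ + M₃ * ‖Cp (vS hρ 0 x t)‖)), fun z hz => ?_⟩
  rcases lt_or_gt_of_ne hz with hz' | hz'
  · refine le_trans ?_ (le_max_right _ _)
    have hC : ∀ u, pair (Cp u) (kerL z hz) = 0 := fun u => by
      rw [pair_Cp, Cm_kerL_of_neg hz', map_zero, neg_zero]
    have hf : fS hρ x t = vS hρ 0 x t - Cp (vS hρ 0 x t) := by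
      conv_rhs => enter [1]; rw [← Cp_sub_Cm (vS hρ 0 x t)]
      rw [fS_eq]
      abel
    have e1 : hS hρ k x t = mulL (wt hρ (k + 1) x t - (-I) • wt hρ k x t) (kerL (-I) hI')
        + (mulL (wt hρ k x t * star (wt hρ 1 x t)) (gS hρ 0 x t)
          - mulL (wt hρ k x t) (Cp (vS hρ 0 x t))) := by
      rw [← wtL_eq_mulL_kerL, mulL_mul]
      conv_lhs => rw [hS, hf, map_sub]
      rfl
    rw [e1, map_add, map_sub pair, add_apply, sub_apply]
    refine (norm_add_le _ _).trans (add_le_add ?_ ((norm_sub_le _ _).trans (add_le_add ?_ ?_)))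
    · refine h₂ _ _ _ ?_
      have := hC (kerL (-I) hI')
      rwa [Cp_kerL_of_neg (by simp : (-I : ℂ).im < 0)] at this
    · exact h₄ _ _ _ (hC _)
    · exact h₃ _ _ _ (hC _)
  · refine le_trans ?_ (le_max_left _ _)
    have hC : ∀ u, pair (Cm u) (kerL z hz) = 0 := fun u => by
      rw [pair_Cm, Cp_kerL_of_pos hz', map_zero, neg_zero]
    have e1 : hS hρ k x t = mulL (wt hρ (k + 1) x t - I • wt hρ k x t) (kerL I hI)
        + mulL (wt hρ k x t) (fS hρ x t) := by
      rw [← wtL_eq_mulL_kerL, hS]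
    rw [e1, map_add, add_apply]
    refine (norm_add_le _ _).trans (add_le_add ?_ ?_)
    · refine h₁ _ _ _ ?_
      have := hC (kerL I hI)
      rw [Cm_kerL_of_pos (by simp : 0 < (I : ℂ).im), map_neg, neg_apply] at this
      exact neg_eq_zero.mp this
    · refine h₃ _ _ _ ?_
      rw [fS_eq, map_neg, neg_apply, hC, neg_zero]

end data

/-! ### Asymptotics of Cauchy integrals -/

lemma IsMulX.mul_cauchyIntegral {u₀ u₁ : L2} (h : IsMulX u₀ u₁) {z : ℂ} (hz : z.im ≠ 0) :
    z * cauchyIntegral u₀ z = -kap u₀ + cauchyIntegral u₁ z := by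
  have h1 : ∀ u : L2, ∫ s : ℝ, u s / ((s : ℂ) - z) = ∫ s, u s * ker z s := fun u => by
    simp only [div_eq_mul_inv, ker]
  have i1 : Integrable fun s => u₁ s * ker z s :=
    (integrable_mul_L2 u₁ (kerL z hz)).congr (by
      filter_upwards [coeFn_kerL z hz] with s e1
      rw [e1])
  have h2 : z * ∫ s, u₀ s * ker z s = (∫ s, u₁ s * ker z s) - ∫ s, u₀ s := by
    rw [← integral_sub i1 h.integrable, ← integral_const_mul]
    apply integral_congr_ae
    filter_upwards [h] with s e1
    have := ofReal_sub_ne_zero hz s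
    rw [e1, ker]
    field_simp
    ring
  rw [cauchyIntegral, cauchyIntegral, h1, h1, kap, mul_left_comm, h2]
  ring

lemma cauchyIntegral_eq_pair (u : L2) {z : ℂ} (hz : z.im ≠ 0) :
    cauchyIntegral u z = (2 * Real.pi * I)⁻¹ * pair u (kerL z hz) := by
  rw [cauchyIntegral, pair_kerL]
  simp only [div_eq_mul_inv, ker]

instance : NeBot (Bornology.cobounded ℂ ⊓ 𝓟 {z : ℂ | z.im ≠ 0}) := by
  have h : Tendsto (fun r : ℝ => (r : ℂ) * I) atTop
      (Bornology.cobounded ℂ ⊓ 𝓟 {z : ℂ | z.im ≠ 0}) := by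
    refine tendsto_inf.mpr ⟨?_, ?_⟩
    · rw [← tendsto_norm_atTop_iff_cobounded]
      refine tendsto_abs_atTop_atTop.congr fun r => ?_
      simp
    · rw [tendsto_principal]
      filter_upwards [eventually_gt_atTop 0] with r hr
      simpa using hr.ne'
  exact h.neBot

/-- Expanding twice, `z Cu₀ = -kap u₀ + z⁻¹(-kap u₁ + Cu₂)`. The uniform bound on `Cu₂` is essential
because `z` may approach the line while tending to infinity. -/
lemma tendsto_mul_cauchyIntegral {u₀ u₁ u₂ : L2} (h : IsMulX u₀ u₁) (h' : IsMulX u₁ u₂) {M : ℝ}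
    (hM : ∀ (z : ℂ) (hz : z.im ≠ 0), ‖pair u₂ (kerL z hz)‖ ≤ M) :
    Tendsto (fun z : ℂ => z * cauchyIntegral u₀ z)
      (Bornology.cobounded ℂ ⊓ 𝓟 {z : ℂ | z.im ≠ 0}) (𝓝 (-kap u₀)) := by
  have hne : ∀ᶠ z : ℂ in Bornology.cobounded ℂ ⊓ 𝓟 {z : ℂ | z.im ≠ 0}, z.im ≠ 0 :=
    eventually_inf_principal.mpr (Eventually.of_forall fun z hz => hz)
  have hinv : Tendsto (fun z : ℂ => z⁻¹) (Bornology.cobounded ℂ ⊓ 𝓟 {z : ℂ | z.im ≠ 0}) (𝓝 0) :=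
    tendsto_inv₀_cobounded.mono_left inf_le_left
  have hb : IsBoundedUnder (· ≤ ·) (Bornology.cobounded ℂ ⊓ 𝓟 {z : ℂ | z.im ≠ 0})
      (norm ∘ fun z : ℂ => -kap u₁ + cauchyIntegral u₂ z) := by
    refine isBoundedUnder_of_eventually_le (a := ‖kap u₁‖ + ‖(2 * Real.pi * I : ℂ)⁻¹‖ * M) ?_
    filter_upwards [hne] with z hz
    refine (norm_add_le _ _).trans ?_
    rw [norm_neg, cauchyIntegral_eq_pair _ hz, norm_mul]
    gcongr
    exact hM z hz
  have h1 := (hinv.zero_mul_isBoundedUnder_le hb).const_add (-kap u₀)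
  rw [add_zero] at h1
  refine h1.congr' ?_
  filter_upwards [hne] with z hz
  have hz0 : z ≠ 0 := fun h0 => hz (by rw [h0, Complex.zero_im])
  rw [h.mul_cauchyIntegral hz, ← h'.mul_cauchyIntegral hz, inv_mul_cancel_left₀ hz0]

/-! ### The Riemann-Hilbert problem -/

section rhp

variable {ρ : ℝ → ℂ} (hρ : Rapid ρ)

lemma exp_mul_evolve (x t l : ℝ) :
    exp (2 * I * ((-(l * x) : ℝ) : ℂ)) * evolve t ρ l = wt hρ 0 x t l := by
  rw [evolve, wt_apply, phase, pow_zero, one_mul, ← mul_assoc, ← Complex.exp_add, mul_comm]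
  congr 2
  push_cast
  ring

lemma exp_mul_conj_evolve (x t l : ℝ) :
    exp (-(2 * I * ((-(l * x) : ℝ) : ℂ))) * -(l * conj (evolve t ρ l))
      = -star (wt hρ 1 x t) l := by
  change _ = -conj (wt hρ (0 + 1) x t l)
  rw [wt_succ, ← exp_mul_evolve, map_mul, map_mul, conj_ofReal, ← Complex.exp_conj]
  simp only [map_mul, map_ofNat, conj_I, conj_ofReal]
  ring_nf

/-- The jump is the product of the upper triangular factor with entry `ρ` and the lower triangular
one with entry `-lρ̄`. With `C⁺ - C⁻ = 1`, the second column reads `h₁ = N₁₁₋ρ`, and the first then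
becomes `h₀ = -lρ̄ N₁₂₊`. -/
lemma isRHPSolution_iff (x t : ℝ) (h : Fin 2 → L2) : IsRHPSolution (evolve t ρ) x h ↔
    h 0 = -mulL (star (wt hρ 1 x t)) (Cp (h 1)) ∧
      h 1 = wtL hρ 0 x t + mulL (wt hρ 0 x t) (Cm (h 0)) := by
  have hsub : ∀ u : L2, ∀ᵐ l, Cp u l - Cm u l = u l := fun u => by
    filter_upwards [Lp.coeFn_sub (Cp u) (Cm u)] with l e1
    rw [← Pi.sub_apply, ← e1, Cp_sub_Cm]
  have key : ∀ l : ℝ, ((fun j => e1 j + Cp (h j) l) =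
      Matrix.vecMul (fun j => e1 j + Cm (h j) l) (adExp (-(l * x)) (jump (evolve t ρ) l))) ↔
      (1 + Cp (h 0) l = (1 + Cm (h 0) l) * (1 - wt hρ 0 x t l * star (wt hρ 1 x t) l)
          - Cm (h 1) l * star (wt hρ 1 x t) l ∧
        Cp (h 1) l = (1 + Cm (h 0) l) * wt hρ 0 x t l + Cm (h 1) l) := by
    intro l
    have e00 : (adExp (-(l * x)) (jump (evolve t ρ) l)) 0 0
        = 1 - wt hρ 0 x t l * star (wt hρ 1 x t) l := by
      have h1 : (adExp (-(l * x)) (jump (evolve t ρ) l)) 0 0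
        = 1 - l * (‖evolve t ρ l‖ : ℂ) ^ 2 := rfl
      rw [h1, ← neg_neg (star (wt hρ 1 x t) l), ← exp_mul_conj_evolve, ← exp_mul_evolve,
        ← Complex.mul_conj']
      rw [show ∀ a b c d e : ℂ, 1 - a * b * -(c * -(d * e)) = 1 - a * c * (d * (b * e)) by
        intros; ring, ← Complex.exp_add, add_neg_cancel, Complex.exp_zero, one_mul]
    have e01 : (adExp (-(l * x)) (jump (evolve t ρ) l)) 0 1 = wt hρ 0 x t l :=
      exp_mul_evolve hρ x t l
    have e10 : (adExp (-(l * x)) (jump (evolve t ρ) l)) 1 0 = -star (wt hρ 1 x t) l :=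
      exp_mul_conj_evolve hρ x t l
    have e11 : (adExp (-(l * x)) (jump (evolve t ρ) l)) 1 1 = 1 := rfl
    rw [funext_iff, Fin.forall_fin_two]
    simp only [Matrix.vecMul, dotProduct, Fin.sum_univ_two, e00, e01, e10, e11, e1,
      Matrix.cons_val_zero, Matrix.cons_val_one, zero_add, mul_one, mul_neg, ← sub_eq_add_neg]
  change (∀ᵐ l : ℝ, (fun j => e1 j + Cp (h j) l) =
      Matrix.vecMul (fun j => e1 j + Cm (h j) l) (adExp (-(l * x)) (jump (evolve t ρ) l))) ↔ _
  simp only [key]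
  constructor
  · intro H
    constructor
    · apply Lp.ext
      filter_upwards [H, hsub (h 0), Lp.coeFn_neg (mulL (star (wt hρ 1 x t)) (Cp (h 1))),
        mulL_coeFn (star (wt hρ 1 x t)) (Cp (h 1))] with l ⟨a, b⟩ d1 d2 d3
      rw [d2, Pi.neg_apply, d3, b, ← d1]
      linear_combination a
    · apply Lp.ext
      filter_upwards [H, hsub (h 1), Lp.coeFn_add (wtL hρ 0 x t) (mulL (wt hρ 0 x t) (Cm (h 0))),
        mulL_coeFn (wt hρ 0 x t) (Cm (h 0)), wtL_coeFn hρ 0 x t] with l ⟨a, b⟩ d1 d2 d3 d4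
      rw [d2, Pi.add_apply, d3, d4, ← d1]
      linear_combination b
  · rintro ⟨h0, h1⟩
    have c0 : ∀ᵐ l, h 0 l = (-mulL (star (wt hρ 1 x t)) (Cp (h 1))) l := by rw [← h0]; simp
    have c1 : ∀ᵐ l, h 1 l = (wtL hρ 0 x t + mulL (wt hρ 0 x t) (Cm (h 0))) l := by
      rw [← h1]; simp
    filter_upwards [c0, c1, hsub (h 0), hsub (h 1),
      Lp.coeFn_neg (mulL (star (wt hρ 1 x t)) (Cp (h 1))),
      mulL_coeFn (star (wt hρ 1 x t)) (Cp (h 1)),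
      Lp.coeFn_add (wtL hρ 0 x t) (mulL (wt hρ 0 x t) (Cm (h 0))),
      mulL_coeFn (wt hρ 0 x t) (Cm (h 0)), wtL_coeFn hρ 0 x t]
      with l a b d1 d2 d3 d4 d5 d6 d7
    rw [d3, Pi.neg_apply, d4] at a
    rw [d5, Pi.add_apply, d6, d7] at b
    constructor
    · linear_combination d1 + a - star (wt hρ 1 x t) l * (d2 + b)
    · linear_combination d2 + b

lemma isRHPSolution_hS (x t : ℝ) :
    IsRHPSolution (evolve t ρ) x ![-vS hρ 0 x t, hS hρ 0 x t] := by
  rw [isRHPSolution_iff hρ]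
  refine ⟨rfl, ?_⟩
  change hS hρ 0 x t = wtL hρ 0 x t + mulL (wt hρ 0 x t) (Cm (-vS hρ 0 x t))
  rw [map_neg, ← fS_eq, hS]

/-- For any solution, `C⁻h₀` solves the equation of `fS`, and `T` is injective; the entry that
determines the potential is therefore unique. -/
lemma eq_hS_of_isRHPSolution {x t : ℝ} {h : Fin 2 → L2} (H : IsRHPSolution (evolve t ρ) x h) :
    h 1 = hS hρ 0 x t := by
  rw [isRHPSolution_iff hρ] at H
  obtain ⟨h0, h1⟩ := H
  have h2 : Cm (h 0) = fS hρ x t := by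
    apply (isWeightPair_wt hρ x t).injective
    rw [fS, rhOp_rhSol (isWeightPair_wt hρ x t), rhOp_apply]
    conv_lhs => enter [1]; rw [h0, h1]
    simp only [map_add, map_neg]
    abel
  rw [h1, h2, hS]

lemma tendsto_rhpFunction {x t : ℝ} {h : Fin 2 → L2} (H : IsRHPSolution (evolve t ρ) x h) :
    Tendsto (fun z : ℂ => 2 * I * (z * rhpFunction h z 1))
      (Bornology.cobounded ℂ ⊓ 𝓟 {z : ℂ | z.im ≠ 0}) (𝓝 (-(2 * I) * kS hρ 0 x t)) := by
  obtain ⟨M, hM⟩ := exists_norm_pair_hS_le hρ 2 x t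
  have h1 := (tendsto_mul_cauchyIntegral (isMulX_hS hρ 0 x t) (isMulX_hS hρ 1 x t) hM).const_mul
    (2 * I)
  rw [show -(2 * I) * kS hρ 0 x t = 2 * I * -kap (hS hρ 0 x t) by rw [kS]; ring]
  refine h1.congr fun z => ?_
  rw [rhpFunction, eq_hS_of_isRHPSolution hρ H]
  simp [e1]

lemma isInverseScattering_iff (t : ℝ) (r : ℝ → ℂ) : IsInverseScattering (evolve t ρ) r ↔
    r = fun x => -(2 * I) * kS hρ 0 x t := by
  constructor
  · intro H
    funext x
    obtain ⟨h, h1, h2⟩ := H x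
    exact tendsto_nhds_unique h2 (tendsto_rhpFunction hρ h1)
  · rintro rfl x
    exact ⟨_, isRHPSolution_hS hρ x t, tendsto_rhpFunction hρ (isRHPSolution_hS hρ x t)⟩

lemma existsUnique_isInverseScattering (hρ : Rapid ρ) (t : ℝ) :
    ∃! r : ℝ → ℂ, IsInverseScattering (evolve t ρ) r :=
  ⟨_, (isInverseScattering_iff hρ t _).mpr rfl, fun r hr => (isInverseScattering_iff hρ t r).mp hr⟩

lemma inverseScattering_eq (t : ℝ) :
    inverseScattering (evolve t ρ) = fun x => -(2 * I) * kS hρ 0 x t :=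
  (isInverseScattering_iff hρ t _).mp
    (Classical.epsilon_spec (existsUnique_isInverseScattering hρ t).exists)

theorem isClassicalSolution_inverseScattering (hρ : Rapid ρ) :
    IsClassicalSolution fun x t => inverseScattering (evolve t ρ) x := by
  simp only [inverseScattering_eq hρ]
  exact isClassicalSolution_kS hρ

end rhp

/-! ### Linear systems with integrable coefficients -/

section field

variable {E : Type*} [NormedAddCommGroup E]

/-- `F` is a time-dependent vector field which vanishes at the origin, with Lipschitz constant
`C (1 + s²)⁻¹` at time `s`. -/
structure IsDecayingField (C : ℝ) (F : ℝ → E → E) : Prop where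
  pos : 0 < C
  cont : Continuous (Function.uncurry F)
  zero : ∀ s, F s 0 = 0
  lip : ∀ s Y Z, ‖F s Y - F s Z‖ ≤ C * (1 + s ^ 2)⁻¹ * ‖Y - Z‖

variable {C : ℝ} {F : ℝ → E → E}

lemma IsDecayingField.norm_le (hF : IsDecayingField C F) (s : ℝ) (Y : E) :
    ‖F s Y‖ ≤ C * (1 + s ^ 2)⁻¹ * ‖Y‖ := by
  simpa [hF.zero] using hF.lip s Y 0

lemma IsDecayingField.continuous_comp (hF : IsDecayingField C F) {Y : ℝ → E}
    (hY : Continuous Y) : Continuous fun s => F s (Y s) :=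
  hF.cont.comp (continuous_id.prodMk hY)

lemma integrable_mul_norm_of_bdd (C : ℝ) {Y : ℝ → E} (hY : Continuous Y)
    (hb : ∃ B, ∀ y, ‖Y y‖ ≤ B) : Integrable fun s => C * (1 + s ^ 2)⁻¹ * ‖Y s‖ := by
  obtain ⟨B, hB⟩ := hb
  refine (integrable_inv_one_add_sq.const_mul C).mul_bdd (c := B)
    hY.norm.aestronglyMeasurable (Eventually.of_forall fun s => ?_)
  rw [norm_norm]
  exact hB s

lemma IsDecayingField.integrable (hF : IsDecayingField C F) {Y : ℝ → E} (hY : Continuous Y)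
    (hb : ∃ B, ∀ y, ‖Y y‖ ≤ B) : Integrable fun s => F s (Y s) :=
  (integrable_mul_norm_of_bdd C hY hb).mono' (hF.continuous_comp hY).aestronglyMeasurable
    (Eventually.of_forall fun s => hF.norm_le s (Y s))

end field

section volterra

variable {E : Type*} [NormedAddCommGroup E] [NormedSpace ℝ E]

lemma hasDerivAt_integral_Ioi [CompleteSpace E] {f : ℝ → E} (hf : Continuous f)
    (hi : Integrable f) (y : ℝ) : HasDerivAt (fun y => ∫ s in Set.Ioi y, f s) (-f y) y := by
  have h : (fun y => ∫ s in Set.Ioi y, f s)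
      = fun y => (∫ s in Set.Ioi 0, f s) - ∫ s in (0 : ℝ)..y, f s := by
    funext y
    rw [← intervalIntegral.integral_interval_add_Ioi (a := 0) (b := y) hi.integrableOn
      hi.integrableOn, add_sub_cancel_left]
  rw [h]
  exact (intervalIntegral.integral_hasDerivAt_right (hf.intervalIntegrable _ _)
    (hf.stronglyMeasurableAtFilter _ _) hf.continuousAt).const_sub _

lemma tendsto_integral_Ioi_atTop {f : ℝ → E} (hi : Integrable f) :
    Tendsto (fun y => ∫ s in Set.Ioi y, f s) atTop (𝓝 0) := by
  have h : (fun y => ∫ s in Set.Ioi y, f s)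
      = fun y => (∫ s in Set.Ioi 0, f s) - ∫ s in (0 : ℝ)..y, f s := by
    funext y
    rw [← intervalIntegral.integral_interval_add_Ioi (a := 0) (b := y) hi.integrableOn
      hi.integrableOn, add_sub_cancel_left]
  rw [h]
  have := (intervalIntegral_tendsto_integral_Ioi 0 (hi.integrableOn) tendsto_id).const_sub
    (∫ s in Set.Ioi 0, f s)
  rwa [sub_self] at this

lemma tendsto_integral_Ioi_atBot {f : ℝ → E} (hi : Integrable f) :
    Tendsto (fun y => ∫ s in Set.Ioi y, f s) atBot (𝓝 (∫ s, f s)) := by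
  have h : (fun y => ∫ s in Set.Ioi y, f s)
      = fun y => (∫ s in y..(0 : ℝ), f s) + ∫ s in Set.Ioi 0, f s := by
    funext y
    rw [intervalIntegral.integral_interval_add_Ioi (a := y) (b := 0) hi.integrableOn
      hi.integrableOn]
  rw [h, ← intervalIntegral.integral_Iic_add_Ioi (b := 0) hi.integrableOn hi.integrableOn]
  exact (intervalIntegral_tendsto_integral_Iic 0 (hi.integrableOn) tendsto_id).add_const _

/-- The weight of the contraction argument. -/
def arcExp (C s : ℝ) : ℝ := Real.exp (-(2 * C * Real.arctan s))

lemma arcExp_pos (C s : ℝ) : 0 < arcExp C s := Real.exp_pos _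

lemma continuous_arcExp (C : ℝ) : Continuous (arcExp C) := by
  unfold arcExp
  fun_prop

lemma arcExp_le {C : ℝ} (hC : 0 < C) (s : ℝ) : arcExp C s ≤ Real.exp (C * Real.pi) := by
  apply Real.exp_le_exp.mpr
  nlinarith [Real.neg_pi_div_two_lt_arctan s]

lemma inv_arcExp_le {C : ℝ} (hC : 0 < C) (s : ℝ) : (arcExp C s)⁻¹ ≤ Real.exp (C * Real.pi) := by
  rw [arcExp, ← Real.exp_neg, neg_neg]
  apply Real.exp_le_exp.mpr
  nlinarith [Real.arctan_lt_pi_div_two s]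

lemma integrable_arcExp {C : ℝ} (hC : 0 < C) :
    Integrable fun s : ℝ => C * (1 + s ^ 2)⁻¹ * arcExp C s := by
  refine (integrable_inv_one_add_sq.const_mul C).mul_bdd (c := Real.exp (C * Real.pi))
    (continuous_arcExp C).aestronglyMeasurable (Eventually.of_forall fun s => ?_)
  rw [Real.norm_of_nonneg (arcExp_pos C s).le]
  exact arcExp_le hC s

/-- The integrand is exactly the derivative of `-arcExp/2`; the factor `2C` in the exponent was
chosen to produce the contraction constant `1/2`. -/
lemma integral_arcExp_le {C : ℝ} (hC : 0 < C) (y : ℝ) :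
    ∫ s in Set.Ioi y, C * (1 + s ^ 2)⁻¹ * arcExp C s ≤ arcExp C y / 2 := by
  have hd : ∀ s : ℝ, HasDerivAt (fun s => -(arcExp C s / 2))
      (C * (1 + s ^ 2)⁻¹ * arcExp C s) s := by
    intro s
    have h1 := (((Real.hasDerivAt_arctan' s).const_mul (2 * C)).fun_neg.exp.div_const 2).fun_neg
    refine h1.congr_deriv ?_
    rw [arcExp]
    ring
  have ht : Tendsto (fun s => -(arcExp C s / 2)) atTop
      (𝓝 (-(Real.exp (-(2 * C * (Real.pi / 2))) / 2))) := by
    have h2 := tendsto_nhds_of_tendsto_nhdsWithin Real.tendsto_arctan_atTop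
    exact (((Real.continuous_exp.tendsto _).comp (h2.const_mul (2 * C)).neg).div_const 2).neg
  rw [integral_Ioi_of_hasDerivAt_of_tendsto' (fun s _ => hd s)
    (integrable_arcExp hC).integrableOn ht]
  have := Real.exp_pos (-(2 * C * (Real.pi / 2)))
  linarith

/-- `Y` is the bounded solution of `Y' = F(s, Y)` with limit `Y₀` at `+∞`. -/
structure IsTailSol (F : ℝ → E → E) (Y₀ : E) (Y : ℝ → E) : Prop where
  cont : Continuous Y
  bdd : ∃ B, ∀ y, ‖Y y‖ ≤ B
  eq : ∀ y, Y y = Y₀ - ∫ s in Set.Ioi y, F s (Y s)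

variable {C : ℝ} {F : ℝ → E → E}

/-- Grönwall's inequality started at `+∞`: in the sup norm weighted by `arcExp`, the integral term
is at most half the left side and can be absorbed. -/
lemma norm_le_of_tail_le (hC : 0 < C) {D : ℝ → E} (hD : Continuous D) (hb : ∃ B, ∀ y, ‖D y‖ ≤ B)
    {ε : ℝ} (h : ∀ y, ‖D y‖ ≤ ε + ∫ s in Set.Ioi y, C * (1 + s ^ 2)⁻¹ * ‖D s‖) (y : ℝ) :
    ‖D y‖ ≤ 2 * Real.exp (C * Real.pi) ^ 2 * ε := by
  have hε : 0 ≤ ε := by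
    have h1 := (tendsto_integral_Ioi_atTop (integrable_mul_norm_of_bdd C hD hb)).const_add ε
    rw [add_zero] at h1
    exact ge_of_tendsto h1 (Eventually.of_forall fun y => (norm_nonneg _).trans (h y))
  obtain ⟨B, hB⟩ := hb
  have hcont : Continuous fun y => (arcExp C y)⁻¹ • D y :=
    ((continuous_arcExp C).inv₀ fun y => (arcExp_pos C y).ne').smul hD
  let w : ℝ →ᵇ E := BoundedContinuousFunction.ofNormedAddCommGroup _ hcont
    (Real.exp (C * Real.pi) * B) fun y => by
      rw [norm_smul, norm_inv, Real.norm_of_nonneg (arcExp_pos C y).le]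
      exact mul_le_mul (inv_arcExp_le hC y) (hB y) (norm_nonneg _) (Real.exp_pos _).le
  have hw : ∀ y, ‖D y‖ ≤ arcExp C y * ‖w‖ := fun y => by
    have h1 : D y = arcExp C y • w y := by
      change D y = arcExp C y • (arcExp C y)⁻¹ • D y
      rw [smul_smul, mul_inv_cancel₀ (arcExp_pos C y).ne', one_smul]
    rw [h1, norm_smul, Real.norm_of_nonneg (arcExp_pos C y).le]
    exact mul_le_mul_of_nonneg_left (w.norm_coe_le_norm y) (arcExp_pos C y).le
  have h2 : ∀ y, ‖D y‖ ≤ ε + arcExp C y / 2 * ‖w‖ := fun y => by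
    refine (h y).trans (add_le_add_right ?_ ε)
    calc ∫ s in Set.Ioi y, C * (1 + s ^ 2)⁻¹ * ‖D s‖
        ≤ ∫ s in Set.Ioi y, C * (1 + s ^ 2)⁻¹ * arcExp C s * ‖w‖ := by
          refine integral_mono (integrable_mul_norm_of_bdd C hD ⟨B, hB⟩).integrableOn
            ((integrable_arcExp hC).mul_const _).integrableOn fun s => ?_
          dsimp only
          rw [mul_assoc (C * _)]
          refine mul_le_mul_of_nonneg_left (hw s) ?_
          have := hC.le
          positivity
      _ ≤ _ := by
          rw [integral_mul_const]
          exact mul_le_mul_of_nonneg_right (integral_arcExp_le hC y) (norm_nonneg _)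
  have h3 : ‖w‖ ≤ Real.exp (C * Real.pi) * ε + ‖w‖ / 2 := by
    refine (BoundedContinuousFunction.norm_le (by positivity)).mpr fun y => ?_
    change ‖(arcExp C y)⁻¹ • D y‖ ≤ _
    rw [norm_smul, norm_inv, Real.norm_of_nonneg (arcExp_pos C y).le]
    calc (arcExp C y)⁻¹ * ‖D y‖ ≤ (arcExp C y)⁻¹ * (ε + arcExp C y / 2 * ‖w‖) :=
          mul_le_mul_of_nonneg_left (h2 y) (inv_pos.mpr (arcExp_pos C y)).le
      _ = (arcExp C y)⁻¹ * ε + ‖w‖ / 2 := by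
          have := (arcExp_pos C y).ne'
          field_simp
      _ ≤ _ := by
          gcongr
          exact inv_arcExp_le hC y
  calc ‖D y‖ ≤ arcExp C y * ‖w‖ := hw y
    _ ≤ Real.exp (C * Real.pi) * (2 * (Real.exp (C * Real.pi) * ε)) := by
        refine mul_le_mul (arcExp_le hC y) (by linarith) (norm_nonneg _) (Real.exp_pos _).le
    _ = _ := by ring

lemma norm_integral_tail_le (hF : IsDecayingField C F) {Y : ℝ → E} (hY : Continuous Y)
    (hb : ∃ B, ∀ y, ‖Y y‖ ≤ B) (y : ℝ) :
    ‖∫ s in Set.Ioi y, F s (Y s)‖ ≤ ∫ s in Set.Ioi y, C * (1 + s ^ 2)⁻¹ * ‖Y s‖ :=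
  norm_integral_le_of_norm_le (integrable_mul_norm_of_bdd C hY hb).integrableOn
    (Eventually.of_forall fun s => hF.norm_le s (Y s))

lemma IsTailSol.norm_le {Y₀ : E} {Y : ℝ → E} (h : IsTailSol F Y₀ Y) (hF : IsDecayingField C F)
    (y : ℝ) : ‖Y y‖ ≤ 2 * Real.exp (C * Real.pi) ^ 2 * ‖Y₀‖ := by
  refine norm_le_of_tail_le hF.pos h.cont h.bdd (fun y => ?_) y
  rw [h.eq y]
  exact (norm_sub_le _ _).trans (add_le_add_right (norm_integral_tail_le hF h.cont h.bdd y) _)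

lemma IsTailSol.norm_sub_le {Y₀ : E} {Y Z : ℝ → E} {G : ℝ → E → E} (h : IsTailSol F Y₀ Y)
    (hF : IsDecayingField C F) (h' : IsTailSol G Y₀ Z) (hG : IsDecayingField C G) {δ : ℝ}
    (hδ : 0 ≤ δ) (hFG : ∀ s X, ‖F s X - G s X‖ ≤ δ * (1 + s ^ 2)⁻¹ * ‖X‖) (y : ℝ) :
    ‖Y y - Z y‖ ≤ 2 * Real.exp (C * Real.pi) ^ 2
      * (δ * Real.pi * (2 * Real.exp (C * Real.pi) ^ 2 * ‖Y₀‖)) := by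
  set B := 2 * Real.exp (C * Real.pi) ^ 2 * ‖Y₀‖
  have hb : ∃ B, ∀ y, ‖Y y - Z y‖ ≤ B := ⟨B + B, fun y =>
    (_root_.norm_sub_le _ _).trans (add_le_add (h.norm_le hF y) (h'.norm_le hG y))⟩
  have hc : Continuous fun y => Y y - Z y := h.cont.sub h'.cont
  refine norm_le_of_tail_le hF.pos hc hb (fun y => ?_) y
  have i1 := hF.integrable h.cont h.bdd
  have i2 := hG.integrable h'.cont h'.bdd
  have h1 : Y y - Z y = -∫ s in Set.Ioi y, (F s (Y s) - G s (Z s)) := by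
    rw [integral_sub i1.integrableOn i2.integrableOn]
    conv_lhs => rw [h.eq y, h'.eq y]
    abel
  have j1 : Integrable fun s : ℝ => δ * (1 + s ^ 2)⁻¹ * B :=
    (integrable_inv_one_add_sq.const_mul δ).mul_const B
  have j2 := integrable_mul_norm_of_bdd C hc hb
  rw [h1, norm_neg]
  calc ‖∫ s in Set.Ioi y, (F s (Y s) - G s (Z s))‖
      ≤ ∫ s in Set.Ioi y, (δ * (1 + s ^ 2)⁻¹ * B + C * (1 + s ^ 2)⁻¹ * ‖Y s - Z s‖) := by
        refine norm_integral_le_of_norm_le (j1.add j2).integrableOn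
          (Eventually.of_forall fun s => ?_)
        have e1 : F s (Y s) - G s (Z s) = (F s (Z s) - G s (Z s)) + (F s (Y s) - F s (Z s)) := by
          abel
        rw [e1]
        refine (norm_add_le _ _).trans (add_le_add ((hFG s (Z s)).trans ?_) (hF.lip s _ _))
        gcongr
        exact h'.norm_le hG s
    _ = (∫ s in Set.Ioi y, δ * (1 + s ^ 2)⁻¹ * B)
          + ∫ s in Set.Ioi y, C * (1 + s ^ 2)⁻¹ * ‖Y s - Z s‖ :=
        integral_add j1.integrableOn j2.integrableOn
    _ ≤ _ := by
        refine add_le_add_left ?_ _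
        rw [integral_mul_const, integral_const_mul, integral_Ioi_inv_one_add_sq]
        gcongr
        have := Real.neg_pi_div_two_lt_arctan y
        linarith

lemma IsTailSol.hasDerivAt [CompleteSpace E] {Y₀ : E} {Y : ℝ → E} (h : IsTailSol F Y₀ Y)
    (hF : IsDecayingField C F) (y : ℝ) : HasDerivAt Y (F y (Y y)) y := by
  have h1 := (hasDerivAt_integral_Ioi (hF.continuous_comp h.cont)
    (hF.integrable h.cont h.bdd) y).const_sub Y₀
  rw [neg_neg, ← funext h.eq] at h1
  exact h1

lemma IsTailSol.tendsto_atTop {Y₀ : E} {Y : ℝ → E} (h : IsTailSol F Y₀ Y)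
    (hF : IsDecayingField C F) : Tendsto Y atTop (𝓝 Y₀) := by
  have h1 := (tendsto_integral_Ioi_atTop (hF.integrable h.cont h.bdd)).const_sub Y₀
  rw [sub_zero] at h1
  rwa [funext h.eq]

lemma IsTailSol.tendsto_atBot {Y₀ : E} {Y : ℝ → E} (h : IsTailSol F Y₀ Y)
    (hF : IsDecayingField C F) : Tendsto Y atBot (𝓝 (Y₀ - ∫ s, F s (Y s))) := by
  have h1 := (tendsto_integral_Ioi_atBot (hF.integrable h.cont h.bdd)).const_sub Y₀
  rwa [← funext h.eq] at h1

/-- The unknown is `w = Y / arcExp`. In this weighted norm the integral operator contracts by `1/2`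
on the whole line, however large `C` is. -/
theorem IsDecayingField.exists_isTailSol [CompleteSpace E] (hF : IsDecayingField C F) (Y₀ : E) :
    ∃ Y, IsTailSol F Y₀ Y := by
  have hC := hF.pos
  have hsc : ∀ w : ℝ →ᵇ E, Continuous fun s => arcExp C s • w s := fun w =>
    (continuous_arcExp C).smul w.continuous
  have hsb : ∀ w : ℝ →ᵇ E, ∃ B, ∀ s, ‖arcExp C s • w s‖ ≤ B := fun w =>
    ⟨Real.exp (C * Real.pi) * ‖w‖, fun s => by
      rw [norm_smul, Real.norm_of_nonneg (arcExp_pos C s).le]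
      exact mul_le_mul (arcExp_le hC s) (w.norm_coe_le_norm s) (norm_nonneg _)
        (Real.exp_pos _).le⟩
  have hi := fun w => hF.integrable (hsc w) (hsb w)
  have hdiff : ∀ (w w' : ℝ →ᵇ E) y, ‖∫ s in Set.Ioi y,
      (F s (arcExp C s • w s) - F s (arcExp C s • w' s))‖ ≤ arcExp C y / 2 * ‖w - w'‖ := by
    intro w w' y
    refine (norm_integral_le_of_norm_le ((integrable_arcExp hC).mul_const ‖w - w'‖).integrableOn
      (Eventually.of_forall fun s => (hF.lip s _ _).trans ?_)).trans ?_
    · rw [← smul_sub, norm_smul, Real.norm_of_nonneg (arcExp_pos C s).le, ← mul_assoc]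
      have h1 := (w - w').norm_coe_le_norm s
      have h2 := (arcExp_pos C s).le
      gcongr
      exact h1
    · rw [integral_mul_const]
      exact mul_le_mul_of_nonneg_right (integral_arcExp_le hC y) (norm_nonneg _)
  have hcont : ∀ w : ℝ →ᵇ E, Continuous fun y =>
      (arcExp C y)⁻¹ • (Y₀ - ∫ s in Set.Ioi y, F s (arcExp C s • w s)) := fun w =>
    ((continuous_arcExp C).inv₀ fun y => (arcExp_pos C y).ne').smul
      (continuous_const.sub (continuous_iff_continuousAt.mpr fun y =>
        (hasDerivAt_integral_Ioi (hF.continuous_comp (hsc w)) (hi w) y).continuousAt))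
  have hbd : ∀ (w : ℝ →ᵇ E) y,
      ‖(arcExp C y)⁻¹ • (Y₀ - ∫ s in Set.Ioi y, F s (arcExp C s • w s))‖
        ≤ Real.exp (C * Real.pi) * (‖Y₀‖ + Real.exp (C * Real.pi) / 2 * ‖w‖) := by
    intro w y
    have h1 := hdiff w 0 y
    simp only [BoundedContinuousFunction.coe_zero, Pi.zero_apply, smul_zero, hF.zero,
      sub_zero] at h1
    rw [norm_smul, norm_inv, Real.norm_of_nonneg (arcExp_pos C y).le]
    refine mul_le_mul (inv_arcExp_le hC y) ((_root_.norm_sub_le _ _).trans ?_) (norm_nonneg _)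
      (Real.exp_pos _).le
    have h2 := arcExp_le hC y
    refine add_le_add_right (h1.trans ?_) _
    gcongr
  let Φ : (ℝ →ᵇ E) → (ℝ →ᵇ E) := fun w =>
    BoundedContinuousFunction.ofNormedAddCommGroup _ (hcont w) _ (hbd w)
  have hΦ : ContractingWith (1 / 2) Φ := by
    refine ⟨by norm_num, LipschitzWith.of_dist_le_mul fun w w' => ?_⟩
    rw [dist_eq_norm, dist_eq_norm]
    refine (BoundedContinuousFunction.norm_le (by positivity)).mpr fun y => ?_
    have e1 : (Φ w - Φ w') y = -((arcExp C y)⁻¹ • ∫ s in Set.Ioi y,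
        (F s (arcExp C s • w s) - F s (arcExp C s • w' s))) := by
      rw [integral_sub (hi w).integrableOn (hi w').integrableOn]
      change (arcExp C y)⁻¹ • (Y₀ - ∫ s in Set.Ioi y, F s (arcExp C s • w s))
        - (arcExp C y)⁻¹ • (Y₀ - ∫ s in Set.Ioi y, F s (arcExp C s • w' s)) = _
      module
    rw [e1, norm_neg, norm_smul, norm_inv, Real.norm_of_nonneg (arcExp_pos C y).le]
    calc (arcExp C y)⁻¹ * _ ≤ (arcExp C y)⁻¹ * (arcExp C y / 2 * ‖w - w'‖) :=
          mul_le_mul_of_nonneg_left (hdiff w w' y) (inv_pos.mpr (arcExp_pos C y)).le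
      _ = ((1 / 2 : NNReal) : ℝ) * ‖w - w'‖ := by
          have := (arcExp_pos C y).ne'
          push_cast
          field_simp
  have hfix : Φ (hΦ.fixedPoint) = hΦ.fixedPoint := hΦ.fixedPoint_isFixedPt
  set w := hΦ.fixedPoint
  refine ⟨fun s => arcExp C s • w s, hsc w, hsb w, fun y => ?_⟩
  have h1 : w y = (arcExp C y)⁻¹ • (Y₀ - ∫ s in Set.Ioi y, F s (arcExp C s • w s)) := by
    conv_lhs => rw [← hfix]
    rfl
  conv_lhs => rw [h1, smul_smul, mul_inv_cancel₀ (arcExp_pos C y).ne', one_smul]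

end volterra

/-! ### The gauged spectral problem -/

/-- The oscillating exponential `e^{2ils}`. -/
def osc (l s : ℝ) : ℂ := exp (2 * I * (l * s))

lemma osc_eq (l s : ℝ) : osc l s = exp ((2 * l * s : ℝ) * I) := by
  rw [osc]
  congr 1
  push_cast
  ring

lemma norm_osc (l s : ℝ) : ‖osc l s‖ = 1 := by
  rw [osc_eq, Complex.norm_exp_ofReal_mul_I]

lemma osc_mul_neg (l s : ℝ) : osc l s * osc (-l) s = 1 := by
  rw [osc, osc, ← Complex.exp_add, ← Complex.exp_zero]
  congr 1
  push_cast
  ring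

lemma conj_osc (l s : ℝ) : conj (osc l s) = osc (-l) s := by
  rw [osc, osc, ← Complex.exp_conj]
  simp only [map_mul, map_ofNat, conj_I, conj_ofReal, ofReal_neg]
  ring_nf

lemma osc_neg_neg (l s : ℝ) : osc (-l) (-s) = osc l s := by
  simp [osc]

lemma continuous_osc (l : ℝ) : Continuous (osc l) := by
  unfold osc
  fun_prop

lemma norm_osc_sub_le (l m s : ℝ) : ‖osc l s - osc m s‖ ≤ 2 * |s| * |l - m| := by
  rw [osc_eq, osc_eq]
  refine (norm_exp_mul_I_sub_le _ _).trans (le_of_eq ?_)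
  rw [show 2 * l * s - 2 * m * s = 2 * s * (l - m) by ring, abs_mul, abs_mul, abs_two]

lemma hasDerivAt_osc (l s : ℝ) : HasDerivAt (osc l) (2 * I * l * osc l s) s := by
  have h1 : HasDerivAt (fun s : ℝ => 2 * I * (l * (s : ℂ))) (2 * I * (l * 1)) s :=
    (((hasDerivAt_id s).ofReal_comp).const_mul (l : ℂ)).const_mul (2 * I)
  refine h1.cexp.congr_deriv ?_
  rw [osc]
  ring

/-- The coefficients `a`, `b` decay, together with their first moments. -/
structure IsAdmissible (C : ℝ) (a b : ℝ → ℂ) : Prop where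
  pos : 0 < C
  conta : Continuous a
  contb : Continuous b
  lea : ∀ s, (1 + |s|) * ‖a s‖ ≤ C * (1 + s ^ 2)⁻¹
  leb : ∀ s, (1 + |s|) * ‖b s‖ ≤ C * (1 + s ^ 2)⁻¹

/-- The vector field `(P, v) ↦ (e^{2ils} a v, e^{-2ils} b P)`. -/
def field (a b : ℝ → ℂ) (l s : ℝ) (Y : ℂ × ℂ) : ℂ × ℂ :=
  (osc l s * a s * Y.2, osc (-l) s * b s * Y.1)

lemma le_of_one_add_abs_mul_le {s A B : ℝ} (hA : 0 ≤ A) (h : (1 + |s|) * A ≤ B) : A ≤ B := by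
  have := abs_nonneg s
  nlinarith

lemma abs_mul_le_of_one_add_abs_mul_le {s A B : ℝ} (hA : 0 ≤ A) (h : (1 + |s|) * A ≤ B) :
    |s| * A ≤ B := by
  linarith

section admissible

variable {C : ℝ} {a b : ℝ → ℂ}

lemma IsAdmissible.isDecayingField (h : IsAdmissible C a b) (l : ℝ) :
    IsDecayingField C (field a b l) where
  pos := h.pos
  cont := by
    have h1 := continuous_osc l
    have h2 := continuous_osc (-l)
    have h3 := h.conta
    have h4 := h.contb
    unfold Function.uncurry field
    fun_prop
  zero s := by simp [field]
  lip s Y Z := by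
    have h1 : field a b l s Y - field a b l s Z
        = (osc l s * a s * (Y - Z).2, osc (-l) s * b s * (Y - Z).1) := by
      ext <;> simp [field] <;> ring
    rw [h1, Prod.norm_def]
    refine max_le ?_ ?_ <;> rw [norm_mul, norm_mul, norm_osc, one_mul]
    · exact mul_le_mul (le_of_one_add_abs_mul_le (norm_nonneg _) (h.lea s)) (norm_snd_le _)
        (norm_nonneg _) (by have := h.pos; positivity)
    · exact mul_le_mul (le_of_one_add_abs_mul_le (norm_nonneg _) (h.leb s)) (norm_fst_le _)
        (norm_nonneg _) (by have := h.pos; positivity)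

/-- Varying `l` in the phase costs a factor `|s|`, which the first-moment bound of `IsAdmissible`
pays for. -/
lemma IsAdmissible.norm_field_sub_le (h : IsAdmissible C a b) (l m s : ℝ) (Y : ℂ × ℂ) :
    ‖field a b l s Y - field a b m s Y‖ ≤ 2 * C * |l - m| * (1 + s ^ 2)⁻¹ * ‖Y‖ := by
  have h1 : field a b l s Y - field a b m s Y
      = ((osc l s - osc m s) * a s * Y.2, (osc (-l) s - osc (-m) s) * b s * Y.1) := by
    ext <;> simp [field] <;> ring
  have h2 := norm_osc_sub_le (-l) (-m) s
  rw [show -l - -m = -(l - m) by ring, abs_neg] at h2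
  rw [h1, Prod.norm_def]
  refine max_le ?_ ?_ <;> rw [norm_mul, norm_mul]
  · calc ‖osc l s - osc m s‖ * ‖a s‖ * ‖Y.2‖ ≤ (2 * |s| * |l - m|) * ‖a s‖ * ‖Y‖ := by
          gcongr
          · exact norm_osc_sub_le l m s
          · exact norm_snd_le Y
      _ = 2 * |l - m| * (|s| * ‖a s‖) * ‖Y‖ := by ring
      _ ≤ 2 * |l - m| * (C * (1 + s ^ 2)⁻¹) * ‖Y‖ := by
          refine mul_le_mul_of_nonneg_right (mul_le_mul_of_nonneg_left
            (abs_mul_le_of_one_add_abs_mul_le (norm_nonneg _) (h.lea s)) ?_) (norm_nonneg _)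
          positivity
      _ = _ := by ring
  · calc ‖osc (-l) s - osc (-m) s‖ * ‖b s‖ * ‖Y.1‖ ≤ (2 * |s| * |l - m|) * ‖b s‖ * ‖Y‖ := by
          gcongr
          exact norm_fst_le Y
      _ = 2 * |l - m| * (|s| * ‖b s‖) * ‖Y‖ := by ring
      _ ≤ 2 * |l - m| * (C * (1 + s ^ 2)⁻¹) * ‖Y‖ := by
          refine mul_le_mul_of_nonneg_right (mul_le_mul_of_nonneg_left
            (abs_mul_le_of_one_add_abs_mul_le (norm_nonneg _) (h.leb s)) ?_) (norm_nonneg _)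
          positivity
      _ = _ := by ring

/-- The constant `C` of the vector field does not depend on `l`, so neither do the bounds on the
solutions. -/
lemma IsAdmissible.exists_family (h : IsAdmissible C a b) : ∃ Y : ℝ → ℝ → ℂ × ℂ,
    (∀ l, IsTailSol (field a b l) (0, 1) (Y l)) ∧ ∃ K, (∀ l y, ‖Y l y‖ ≤ K) ∧
      ∀ l m y, ‖Y l y - Y m y‖ ≤ K * |l - m| := by
  choose Y hY using fun l => (h.isDecayingField l).exists_isTailSol (0, 1)
  set K := 2 * Real.exp (C * Real.pi) ^ 2 * ‖((0, 1) : ℂ × ℂ)‖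
  have hC := h.pos
  refine ⟨Y, hY, max K (2 * Real.exp (C * Real.pi) ^ 2 * (2 * C * Real.pi * K)), fun l y =>
    ((hY l).norm_le (h.isDecayingField l) y).trans (le_max_left _ _), fun l m y => ?_⟩
  refine ((hY l).norm_sub_le (h.isDecayingField l) (hY m) (h.isDecayingField m)
    (δ := 2 * C * |l - m|) (by positivity) (h.norm_field_sub_le l m) y).trans ?_
  calc _ = 2 * Real.exp (C * Real.pi) ^ 2 * (2 * C * Real.pi * K) * |l - m| := by ring
    _ ≤ _ := by
        gcongr
        exact le_max_right _ _

lemma IsAdmissible.comp_neg (h : IsAdmissible C a b) :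
    IsAdmissible C (fun s => -a (-s)) (fun s => -b (-s)) where
  pos := h.pos
  conta := (h.conta.comp continuous_neg).neg
  contb := (h.contb.comp continuous_neg).neg
  lea s := by simpa using h.lea (-s)
  leb s := by simpa using h.leb (-s)

/-- The solution normalized at `-∞`. -/
lemma IsAdmissible.exists_atBot (h : IsAdmissible C a b) (l : ℝ) : ∃ Y : ℝ → ℂ × ℂ,
    (∀ x, HasDerivAt Y (field a b l x (Y x)) x) ∧ Tendsto Y atBot (𝓝 (0, 1)) := by
  -- The reflection `x ↦ -x` moves the normalization from `-∞` to `+∞` and changes the signs of `l`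
  -- and of both coefficients.
  obtain ⟨Z, hZ⟩ := (h.comp_neg.isDecayingField (-l)).exists_isTailSol (0, 1)
  refine ⟨fun x => Z (-x), fun x => ?_, (hZ.tendsto_atTop
    (h.comp_neg.isDecayingField (-l))).comp tendsto_neg_atBot_atTop⟩
  have h1 := (hZ.hasDerivAt (h.comp_neg.isDecayingField (-l)) (-x)).scomp x (hasDerivAt_neg x)
  refine h1.congr_deriv ?_
  have h2 : osc l (-x) = osc (-l) x := by rw [← osc_neg_neg (-l) x, neg_neg]
  ext <;> simp [field, osc_neg_neg, h2]

end admissible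

/-! ### Schwartz coefficients -/

/-- The complex conjugate of a Schwartz function. -/
def conjS (f : 𝓢(ℝ, ℂ)) : 𝓢(ℝ, ℂ) :=
  f.postcompCLM (𝕜 := ℝ) (conjCLE : ℂ →L[ℝ] ℂ)

@[simp] lemma conjS_apply (f : 𝓢(ℝ, ℂ)) (x : ℝ) : conjS f x = conj (f x) := rfl

/-- The product of a Schwartz function and a function of temperate growth. -/
def mulS (g : ℝ → ℂ) (f : 𝓢(ℝ, ℂ)) : 𝓢(ℝ, ℂ) := SchwartzMap.smulLeftCLM ℂ g f

lemma mulS_apply {g : ℝ → ℂ} (hg : g.HasTemperateGrowth) (f : 𝓢(ℝ, ℂ)) (x : ℝ) :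
    mulS g f x = g x * f x := SchwartzMap.smulLeftCLM_apply_apply hg f x

/-- The second coefficient `q̄' / (2i) - |q|² q̄ / 4` of the gauged spectral problem. -/
def gaugeCoeff (q : 𝓢(ℝ, ℂ)) : 𝓢(ℝ, ℂ) :=
  (2 * I : ℂ)⁻¹ • conjS (SchwartzMap.derivCLM ℂ ℂ q)
    - (4 : ℂ)⁻¹ • mulS q (mulS (conjS q) (conjS q))

lemma gaugeCoeff_apply (q : 𝓢(ℝ, ℂ)) (x : ℝ) : gaugeCoeff q x
    = (2 * I)⁻¹ * conj (deriv q x) - 4⁻¹ * (q x * (conj (q x) * conj (q x))) := by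
  have h1 : gaugeCoeff q x = (2 * I)⁻¹ * conj (deriv q x)
    - 4⁻¹ * mulS q (mulS (conjS q) (conjS q)) x := rfl
  rw [h1, mulS_apply q.hasTemperateGrowth, mulS_apply (conjS q).hasTemperateGrowth, conjS_apply]

lemma exists_schwartz_le (f : 𝓢(ℝ, ℂ)) :
    ∃ C, 0 < C ∧ ∀ s, (1 + |s|) * ‖f s‖ ≤ C * (1 + s ^ 2)⁻¹ := by
  have h : ∀ k, ∃ C, 0 < C ∧ ∀ s : ℝ, |s| ^ k * ‖f s‖ ≤ C := fun k => by
    obtain ⟨C, hC, h⟩ := f.decay k 0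
    exact ⟨C, hC, fun s => by simpa using h s⟩
  obtain ⟨C₀, p₀, h₀⟩ := h 0
  obtain ⟨C₁, p₁, h₁⟩ := h 1
  obtain ⟨C₂, p₂, h₂⟩ := h 2
  obtain ⟨C₃, p₃, h₃⟩ := h 3
  refine ⟨C₀ + C₁ + C₂ + C₃, by positivity, fun s => ?_⟩
  have hs : (0 : ℝ) < 1 + s ^ 2 := by positivity
  rw [← div_eq_mul_inv, le_div_iff₀ hs]
  have e0 := h₀ s
  have e1 := h₁ s
  have e2 := h₂ s
  have e3 := h₃ s
  calc (1 + |s|) * ‖f s‖ * (1 + s ^ 2)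
      = |s| ^ 0 * ‖f s‖ + |s| ^ 1 * ‖f s‖ + |s| ^ 2 * ‖f s‖ + |s| ^ 3 * ‖f s‖ := by
        rw [← sq_abs s]
        ring
    _ ≤ _ := by linarith

lemma exists_isAdmissible (f g : 𝓢(ℝ, ℂ)) : ∃ C, IsAdmissible C f g := by
  obtain ⟨C, hC, h⟩ := exists_schwartz_le f
  obtain ⟨D, hD, h'⟩ := exists_schwartz_le g
  refine ⟨C + D, by positivity, f.continuous, g.continuous, fun s => (h s).trans ?_, fun s =>
    (h' s).trans ?_⟩
  · gcongr
    linarith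
  · gcongr
    linarith

lemma tendsto_schwartz (f : 𝓢(ℝ, ℂ)) {l : Filter ℝ} (hl : l ≤ cocompact ℝ) :
    Tendsto f l (𝓝 0) :=
  (f.toZeroAtInfty.zero_at_infty').mono_left hl

/-! ### Solutions of the spectral problem -/

/-- `n` solves the spectral problem at `l`. -/
def IsSol (q : ℝ → ℂ) (l : ℝ) (n : ℝ → Matrix (Fin 2) (Fin 2) ℂ) : Prop :=
  ∀ x i j, HasDerivAt (fun y => n y i j) (spectralRHS q l x (n x) i j) x

section wronskian

variable {q : ℝ → ℂ} {l : ℝ} {n m : ℝ → Matrix (Fin 2) (Fin 2) ℂ}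

lemma spectralRHS_zero_zero (x : ℝ) (A : Matrix (Fin 2) (Fin 2) ℂ) : spectralRHS q l x A 0 0
    = q x * A 1 0 - I / 2 * (q x * conj (q x)) * A 0 0 := by
  simp [spectralRHS, sigma, Matrix.mul_apply, Fin.sum_univ_two, Complex.mul_conj', Matrix.vecMul,
    dotProduct]
  ring

lemma spectralRHS_zero_one (x : ℝ) (A : Matrix (Fin 2) (Fin 2) ℂ) : spectralRHS q l x A 0 1
    = -(2 * I * l) * A 0 1 + q x * A 1 1 - I / 2 * (q x * conj (q x)) * A 0 1 := by
  simp [spectralRHS, sigma, Matrix.mul_apply, Fin.sum_univ_two, Complex.mul_conj', Matrix.vecMul,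
    dotProduct]
  ring

lemma spectralRHS_one_zero (x : ℝ) (A : Matrix (Fin 2) (Fin 2) ℂ) : spectralRHS q l x A 1 0
    = 2 * I * l * A 1 0 + l * conj (q x) * A 0 0 + I / 2 * (q x * conj (q x)) * A 1 0 := by
  simp [spectralRHS, sigma, Matrix.mul_apply, Fin.sum_univ_two, Complex.mul_conj', Matrix.vecMul,
    dotProduct]
  ring

lemma spectralRHS_one_one (x : ℝ) (A : Matrix (Fin 2) (Fin 2) ℂ) : spectralRHS q l x A 1 1
    = l * conj (q x) * A 0 1 + I / 2 * (q x * conj (q x)) * A 1 1 := by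
  simp [spectralRHS, sigma, Matrix.mul_apply, Fin.sum_univ_two, Complex.mul_conj', Matrix.vecMul,
    dotProduct]

lemma eq_of_hasDerivAt_zero {f : ℝ → ℂ} (h : ∀ x, HasDerivAt f 0 x) (x y : ℝ) : f x = f y :=
  is_const_of_deriv_eq_zero (fun x => (h x).differentiableAt) (fun x => (h x).deriv) x y

/-- The four Wronskians are the entries of `adj(n) m`. The coefficient matrices are trace-free, so
the diagonal entries are constant and the off-diagonal ones are constant up to `e^{±2ilx}`. -/
lemma IsSol.wronskian_zero_zero (hn : IsSol q l n) (hm : IsSol q l m) (x y : ℝ) :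
    n x 1 1 * m x 0 0 - n x 0 1 * m x 1 0 = n y 1 1 * m y 0 0 - n y 0 1 * m y 1 0 := by
  refine eq_of_hasDerivAt_zero (f := fun x => n x 1 1 * m x 0 0 - n x 0 1 * m x 1 0)
    (fun x => ?_) x y
  refine (((hn x 1 1).mul (hm x 0 0)).sub ((hn x 0 1).mul (hm x 1 0))).congr_deriv ?_
  rw [spectralRHS_zero_zero, spectralRHS_zero_one, spectralRHS_one_zero, spectralRHS_one_one]
  ring

lemma IsSol.wronskian_one_one (hn : IsSol q l n) (hm : IsSol q l m) (x y : ℝ) :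
    n x 0 0 * m x 1 1 - n x 1 0 * m x 0 1 = n y 0 0 * m y 1 1 - n y 1 0 * m y 0 1 := by
  refine eq_of_hasDerivAt_zero (f := fun x => n x 0 0 * m x 1 1 - n x 1 0 * m x 0 1)
    (fun x => ?_) x y
  refine (((hn x 0 0).mul (hm x 1 1)).sub ((hn x 1 0).mul (hm x 0 1))).congr_deriv ?_
  rw [spectralRHS_zero_zero, spectralRHS_zero_one, spectralRHS_one_zero, spectralRHS_one_one]
  ring

lemma IsSol.wronskian_zero_one (hn : IsSol q l n) (hm : IsSol q l m) (x y : ℝ) :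
    osc l x * (n x 1 1 * m x 0 1 - n x 0 1 * m x 1 1)
      = osc l y * (n y 1 1 * m y 0 1 - n y 0 1 * m y 1 1) := by
  refine eq_of_hasDerivAt_zero (f := fun x => osc l x * (n x 1 1 * m x 0 1 - n x 0 1 * m x 1 1))
    (fun x => ?_) x y
  refine ((hasDerivAt_osc l x).mul
    (((hn x 1 1).mul (hm x 0 1)).sub ((hn x 0 1).mul (hm x 1 1)))).congr_deriv ?_
  rw [spectralRHS_zero_one, spectralRHS_one_one, spectralRHS_zero_one, spectralRHS_one_one]
  simp only [Pi.sub_apply, Pi.mul_apply]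
  ring

lemma IsSol.wronskian_one_zero (hn : IsSol q l n) (hm : IsSol q l m) (x y : ℝ) :
    osc (-l) x * (n x 0 0 * m x 1 0 - n x 1 0 * m x 0 0)
      = osc (-l) y * (n y 0 0 * m y 1 0 - n y 1 0 * m y 0 0) := by
  refine eq_of_hasDerivAt_zero
    (f := fun x => osc (-l) x * (n x 0 0 * m x 1 0 - n x 1 0 * m x 0 0)) (fun x => ?_) x y
  refine ((hasDerivAt_osc (-l) x).mul
    (((hn x 0 0).mul (hm x 1 0)).sub ((hn x 1 0).mul (hm x 0 0)))).congr_deriv ?_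
  rw [spectralRHS_zero_zero, spectralRHS_one_zero, spectralRHS_zero_zero, spectralRHS_one_zero,
    ofReal_neg]
  simp only [Pi.sub_apply, Pi.mul_apply]
  ring

variable {F : Filter ℝ}

lemma tendsto_entry (h : Tendsto n F (𝓝 1)) (i j : Fin 2) :
    Tendsto (fun x => n x i j) F (𝓝 ((1 : Matrix (Fin 2) (Fin 2) ℂ) i j)) :=
  tendsto_pi_nhds.mp (tendsto_pi_nhds.mp h i) j

lemma eq_of_forall_eq_of_tendsto [F.NeBot] {f : ℝ → ℂ} {c : ℂ} (h : ∀ x y, f x = f y)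
    (ht : Tendsto f F (𝓝 c)) (x : ℝ) : f x = c :=
  tendsto_nhds_unique (tendsto_const_nhds.congr fun y => h x y) ht

lemma tendsto_osc_mul_zero {f : ℝ → ℂ} (l : ℝ) (h : Tendsto f F (𝓝 0)) :
    Tendsto (fun x => osc l x * f x) F (𝓝 0) := by
  rw [tendsto_zero_iff_norm_tendsto_zero] at h ⊢
  refine h.congr fun x => ?_
  rw [norm_mul, norm_osc, one_mul]

lemma osc_ne_zero (l x : ℝ) : osc l x ≠ 0 := Complex.exp_ne_zero _

lemma IsJost.det_eq_one [F.NeBot] (hn : IsJost q F l n) (x : ℝ) :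
    n x 1 1 * n x 0 0 - n x 0 1 * n x 1 0 = 1 := by
  refine eq_of_forall_eq_of_tendsto (F := F)
    (f := fun x => n x 1 1 * n x 0 0 - n x 0 1 * n x 1 0)
    (IsSol.wronskian_zero_zero (q := q) (l := l) hn.1 hn.1) ?_ x
  have := ((tendsto_entry hn.2 1 1).mul (tendsto_entry hn.2 0 0)).sub
    ((tendsto_entry hn.2 0 1).mul (tendsto_entry hn.2 1 0))
  simpa using this

/-- Jost solutions are unique. -/
theorem IsJost.unique [F.NeBot] (hn : IsJost q F l n) (hm : IsJost q F l m) : m = n := by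
  have t := fun i j => tendsto_entry hn.2 i j
  have s := fun i j => tendsto_entry hm.2 i j
  funext x
  have h00 : n x 1 1 * m x 0 0 - n x 0 1 * m x 1 0 = 1 :=
    eq_of_forall_eq_of_tendsto (F := F) (f := fun x => n x 1 1 * m x 0 0 - n x 0 1 * m x 1 0)
      (IsSol.wronskian_zero_zero (q := q) (l := l) hn.1 hm.1)
      (by simpa using ((t 1 1).mul (s 0 0)).sub ((t 0 1).mul (s 1 0))) x
  have h11 : n x 0 0 * m x 1 1 - n x 1 0 * m x 0 1 = 1 :=
    eq_of_forall_eq_of_tendsto (F := F) (f := fun x => n x 0 0 * m x 1 1 - n x 1 0 * m x 0 1)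
      (IsSol.wronskian_one_one (q := q) (l := l) hn.1 hm.1)
      (by simpa using ((t 0 0).mul (s 1 1)).sub ((t 1 0).mul (s 0 1))) x
  have h01 : n x 1 1 * m x 0 1 - n x 0 1 * m x 1 1 = 0 := by
    have := eq_of_forall_eq_of_tendsto (F := F)
      (f := fun x => osc l x * (n x 1 1 * m x 0 1 - n x 0 1 * m x 1 1))
      (IsSol.wronskian_zero_one (q := q) (l := l) hn.1 hm.1)
      (tendsto_osc_mul_zero l (by simpa using ((t 1 1).mul (s 0 1)).sub ((t 0 1).mul (s 1 1)))) x
    exact (mul_eq_zero.mp this).resolve_left (osc_ne_zero l x)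
  have h10 : n x 0 0 * m x 1 0 - n x 1 0 * m x 0 0 = 0 := by
    have := eq_of_forall_eq_of_tendsto (F := F)
      (f := fun x => osc (-l) x * (n x 0 0 * m x 1 0 - n x 1 0 * m x 0 0))
      (IsSol.wronskian_one_zero (q := q) (l := l) hn.1 hm.1)
      (tendsto_osc_mul_zero (-l)
        (by simpa using ((t 0 0).mul (s 1 0)).sub ((t 1 0).mul (s 0 0)))) x
    exact (mul_eq_zero.mp this).resolve_left (osc_ne_zero (-l) x)
  -- At this point `adj(n) m = 1`; multiplying by `n`, whose determinant is one, gives `m = n`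
  -- entrywise.
  have hd := hn.det_eq_one x
  ext i j
  fin_cases i <;> fin_cases j <;> simp only [Fin.zero_eta, Fin.mk_one, Fin.isValue]
  · linear_combination n x 0 0 * h00 + n x 0 1 * h10 - m x 0 0 * hd
  · linear_combination n x 0 0 * h01 + n x 0 1 * h11 - m x 0 1 * hd
  · linear_combination n x 1 0 * h00 + n x 1 1 * h10 - m x 1 0 * hd
  · linear_combination n x 1 0 * h01 + n x 1 1 * h11 - m x 1 1 * hd

end wronskian

/-! ### Jost solutions and scattering data -/

/-- The matrix solution of the spectral problem associated with a solution `Y` of the gauged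
problem. -/
def jostMatrix (q : ℝ → ℂ) (l : ℝ) (Y : ℝ → ℂ × ℂ) (x : ℝ) : Matrix (Fin 2) (Fin 2) ℂ :=
  !![conj ((Y x).2 - (2 * I)⁻¹ * conj (q x) * (osc (-l) x * (Y x).1)), osc (-l) x * (Y x).1;
    l * conj (osc (-l) x * (Y x).1), (Y x).2 - (2 * I)⁻¹ * conj (q x) * (osc (-l) x * (Y x).1)]

section jost

variable {q : 𝓢(ℝ, ℂ)} {l : ℝ} {Y : ℝ → ℂ × ℂ}

/-- The symmetry `(p, v) ↦ (v̄, l p̄)` of the system produces the first column from the second, so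
only one column has to be constructed. -/
lemma isSol_of_hasDerivAt {q : ℝ → ℂ} {p v : ℝ → ℂ}
    (hp : ∀ x, HasDerivAt p (-(2 * I * l) * p x + q x * v x
      - I / 2 * (q x * conj (q x)) * p x) x)
    (hv : ∀ x, HasDerivAt v (l * conj (q x) * p x + I / 2 * (q x * conj (q x)) * v x) x) :
    IsSol q l fun x => !![conj (v x), p x; l * conj (p x), v x] := by
  intro x i j
  fin_cases i <;> fin_cases j <;> simp only [Fin.zero_eta, Fin.mk_one, Fin.isValue]
  · rw [spectralRHS_zero_zero]
    refine (hv x).star.congr_deriv ?_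
    simp only [RCLike.star_def, map_add, map_mul, map_div₀, conj_I, map_ofNat, conj_ofReal,
      Complex.conj_conj, Matrix.of_apply, Matrix.cons_val_zero, Matrix.cons_val_one,
      Matrix.cons_val', Matrix.cons_val_fin_one]
    ring
  · rw [spectralRHS_zero_one]
    exact hp x
  · rw [spectralRHS_one_zero]
    refine ((hp x).star.const_mul (l : ℂ)).congr_deriv ?_
    simp only [RCLike.star_def, map_add, map_sub, map_neg, map_mul, map_div₀, conj_I, map_ofNat,
      conj_ofReal, Complex.conj_conj, Matrix.of_apply, Matrix.cons_val_zero, Matrix.cons_val_one,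
      Matrix.cons_val', Matrix.cons_val_fin_one]
    ring
  · rw [spectralRHS_one_one]
    exact hv x

/-- With `p` and `v` the entries of the second column, the derivative of `q̄p/(2i)` contains `-l q̄
p`, which cancels the only term of `v'` with an explicit `l`. What remains for `v + q̄p/(2i)` is
`gaugeCoeff q` times `p`. -/
lemma isSol_jostMatrix (hY : ∀ x, HasDerivAt Y (field q (gaugeCoeff q) l x (Y x)) x) :
    IsSol q l (jostMatrix q l Y) := by
  have h1 : ∀ x, HasDerivAt (fun y => (Y y).1) (osc l x * q x * (Y x).2) x := fun x =>
    (hY x).fst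
  have h2 : ∀ x, HasDerivAt (fun y => (Y y).2) (osc (-l) x * gaugeCoeff q x * (Y x).1) x :=
    fun x => (hY x).snd
  have hp : ∀ x, HasDerivAt (fun y => osc (-l) y * (Y y).1)
      (-(2 * I * l) * (osc (-l) x * (Y x).1) + q x * (Y x).2) x := fun x => by
    refine ((hasDerivAt_osc (-l) x).mul (h1 x)).congr_deriv ?_
    rw [ofReal_neg]
    linear_combination q x * (Y x).2 * osc_mul_neg l x
  have hq : ∀ x, HasDerivAt (fun y => conj (q y)) (conj (deriv q x)) x := fun x =>
    q.differentiableAt.hasDerivAt.star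
  refine isSol_of_hasDerivAt (fun x => (hp x).congr_deriv ?_) fun x =>
    ((h2 x).sub (((hq x).const_mul (2 * I)⁻¹).mul (hp x))).congr_deriv ?_
  · rw [mul_inv, Complex.inv_I]
    ring
  · rw [gaugeCoeff_apply, mul_inv, Complex.inv_I]
    ring_nf
    rw [I_sq]
    ring

lemma tendsto_jostMatrix_one_one {F : Filter ℝ} (hF : F ≤ cocompact ℝ) {β γ : ℂ}
    (h : Tendsto Y F (𝓝 (β, γ))) : Tendsto (fun x => jostMatrix q l Y x 1 1) F (𝓝 γ) := by
  have hc : Tendsto (fun x => conj (q x)) F (𝓝 0) := by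
    have := (continuous_conj.tendsto 0).comp (tendsto_schwartz q hF)
    rwa [map_zero] at this
  have h1 := (hc.const_mul (2 * I)⁻¹).mul h.fst_nhds
  rw [mul_zero, zero_mul] at h1
  have h2 := h.snd_nhds.sub (tendsto_osc_mul_zero (-l) h1)
  rw [sub_zero] at h2
  refine h2.congr fun x => ?_
  change _ = (Y x).2 - (2 * I)⁻¹ * conj (q x) * (osc (-l) x * (Y x).1)
  ring

lemma isJost_jostMatrix {F : Filter ℝ} (hF : F ≤ cocompact ℝ)
    (hY : ∀ x, HasDerivAt Y (field q (gaugeCoeff q) l x (Y x)) x)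
    (h : Tendsto Y F (𝓝 (0, 1))) : IsJost q F l (jostMatrix q l Y) := by
  refine ⟨isSol_jostMatrix hY, ?_⟩
  have h11 : Tendsto (fun x => jostMatrix q l Y x 1 1) F (𝓝 1) := tendsto_jostMatrix_one_one hF h
  have h01 : Tendsto (fun x => jostMatrix q l Y x 0 1) F (𝓝 0) :=
    tendsto_osc_mul_zero (-l) h.fst_nhds
  refine tendsto_pi_nhds.mpr fun i => tendsto_pi_nhds.mpr fun j => ?_
  fin_cases i <;> fin_cases j
  · have := (continuous_conj.tendsto _).comp h11
    change Tendsto (fun x => conj (jostMatrix q l Y x 1 1)) F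
      (𝓝 ((1 : Matrix (Fin 2) (Fin 2) ℂ) 0 0))
    simpa [Function.comp_def] using this
  · simpa using h01
  · have := ((continuous_conj.tendsto _).comp h01).const_mul (l : ℂ)
    change Tendsto (fun x => l * conj (jostMatrix q l Y x 0 1)) F
      (𝓝 ((1 : Matrix (Fin 2) (Fin 2) ℂ) 1 0))
    simpa using this
  · simpa using h11

/-- The Wronskians of the two solutions are constant up to the phase, so they can be evaluated at
`-∞`, where the solution built from `Z` is normalized. -/
lemma jostMatrix_mul_adExp {Z : ℝ → ℂ × ℂ}
    (hY : ∀ x, HasDerivAt Y (field q (gaugeCoeff q) l x (Y x)) x)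
    (hZ : ∀ x, HasDerivAt Z (field q (gaugeCoeff q) l x (Z x)) x)
    (hZ0 : Tendsto Z atBot (𝓝 (0, 1))) {β γ : ℂ} (hY0 : Tendsto Y atBot (𝓝 (β, γ))) (x : ℝ) :
    jostMatrix q l Y x = jostMatrix q l Z x
      * adExp (-(l * x)) !![conj γ, β; l * conj β, conj (conj γ)] := by
  have hY1 := isSol_jostMatrix hY
  have hJ := isJost_jostMatrix atBot_le_cocompact hZ hZ0
  have t11 : Tendsto (fun x => jostMatrix q l Z x 1 1) atBot (𝓝 1) :=
    tendsto_jostMatrix_one_one atBot_le_cocompact hZ0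
  have s11 : Tendsto (fun x => jostMatrix q l Y x 1 1) atBot (𝓝 γ) :=
    tendsto_jostMatrix_one_one atBot_le_cocompact hY0
  have hα : ∀ x, jostMatrix q l Z x 1 1 * jostMatrix q l Y x 0 0
      - jostMatrix q l Z x 0 1 * jostMatrix q l Y x 1 0 = conj γ := by
    refine eq_of_forall_eq_of_tendsto (F := atBot) (IsSol.wronskian_zero_zero hJ.1 hY1) ?_
    have h1 := t11.mul ((continuous_conj.tendsto γ).comp s11)
    have h2 := (hZ0.fst_nhds.mul ((continuous_conj.tendsto β).comp hY0.fst_nhds)).const_mul (l : ℂ)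
    rw [zero_mul, mul_zero] at h2
    have h3 := h1.sub h2
    rw [one_mul, sub_zero] at h3
    refine h3.congr fun x => ?_
    change _ - l * ((Z x).1 * conj (Y x).1)
      = _ - osc (-l) x * (Z x).1 * (l * conj (osc (-l) x * (Y x).1))
    rw [map_mul, conj_osc, neg_neg]
    congr 1
    linear_combination (-(l * (Z x).1 * conj (Y x).1)) * osc_mul_neg l x
  have hβ : ∀ x, osc l x * (jostMatrix q l Z x 1 1 * jostMatrix q l Y x 0 1
      - jostMatrix q l Z x 0 1 * jostMatrix q l Y x 1 1) = β := by
    refine eq_of_forall_eq_of_tendsto (F := atBot) (IsSol.wronskian_zero_one hJ.1 hY1) ?_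
    have h3 := (t11.mul hY0.fst_nhds).sub (hZ0.fst_nhds.mul s11)
    rw [one_mul, zero_mul, sub_zero] at h3
    refine h3.congr fun x => ?_
    change _ = osc l x * (_ * (osc (-l) x * (Y x).1) - (osc (-l) x * (Z x).1) * _)
    linear_combination (-(jostMatrix q l Z x 1 1 * (Y x).1
      - (Z x).1 * jostMatrix q l Y x 1 1)) * osc_mul_neg l x
  have hd := hJ.det_eq_one x
  have ha := hα x
  have hb : jostMatrix q l Z x 1 1 * jostMatrix q l Y x 0 1
      - jostMatrix q l Z x 0 1 * jostMatrix q l Y x 1 1 = osc (-l) x * β := by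
    rw [← hβ x]
    linear_combination (-(jostMatrix q l Z x 1 1 * jostMatrix q l Y x 0 1
      - jostMatrix q l Z x 0 1 * jostMatrix q l Y x 1 1)) * osc_mul_neg l x
  have e1 : exp (2 * I * ((-(l * x) : ℝ) : ℂ)) = osc (-l) x := by
    rw [osc]
    congr 1
    push_cast
    ring
  have e2 : exp (-(2 * I * ((-(l * x) : ℝ) : ℂ))) = osc l x := by
    rw [osc]
    congr 1
    push_cast
    ring
  have ha' := congrArg conj ha
  have hb' := congrArg conj hb
  have z0 : ∀ W, jostMatrix q l W x 0 0 = conj (jostMatrix q l W x 1 1) := fun W => rfl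
  have z1 : ∀ W, jostMatrix q l W x 1 0 = l * conj (jostMatrix q l W x 0 1) := fun W => rfl
  simp only [z0, z1] at hd ha hb ha' hb'
  simp only [map_sub, map_mul, Complex.conj_conj, conj_ofReal, conj_osc, neg_neg] at ha' hb'
  ext i j
  rw [Matrix.mul_apply, Fin.sum_univ_two]
  fin_cases i <;> fin_cases j <;> simp only [Fin.zero_eta, Fin.mk_one, Fin.isValue, adExp, e1, e2,
    Matrix.of_apply, Matrix.cons_val_zero, Matrix.cons_val_one, Matrix.cons_val',
    Matrix.cons_val_fin_one, z0, z1, Complex.conj_conj]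
  · linear_combination (-conj (jostMatrix q l Y x 1 1)) * hd
      + conj (jostMatrix q l Z x 1 1) * ha + l * jostMatrix q l Z x 0 1 * hb'
  · linear_combination (-(jostMatrix q l Y x 0 1)) * hd
      + conj (jostMatrix q l Z x 1 1) * hb + jostMatrix q l Z x 0 1 * ha'
  · linear_combination (-(l * conj (jostMatrix q l Y x 0 1))) * hd
      + l * conj (jostMatrix q l Z x 0 1) * ha + l * jostMatrix q l Z x 1 1 * hb'
  · linear_combination (-(jostMatrix q l Y x 1 1)) * hd
      + l * conj (jostMatrix q l Z x 0 1) * hb + jostMatrix q l Z x 1 1 * ha'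

/-- The left side is the limit at `-∞` of the determinant, which the normalization at `+∞` fixes to
be one. -/
lemma norm_sq_sub_eq_one (hY : ∀ x, HasDerivAt Y (field q (gaugeCoeff q) l x (Y x)) x)
    (hY1 : Tendsto Y atTop (𝓝 (0, 1))) {β γ : ℂ} (hY0 : Tendsto Y atBot (𝓝 (β, γ))) :
    ‖γ‖ ^ 2 - l * ‖β‖ ^ 2 = 1 := by
  have hJ := isJost_jostMatrix atTop_le_cocompact hY hY1
  have s11 : Tendsto (fun x => jostMatrix q l Y x 1 1) atBot (𝓝 γ) :=
    tendsto_jostMatrix_one_one atBot_le_cocompact hY0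
  have h1 := (s11.norm.pow 2).sub ((hY0.fst_nhds.norm.pow 2).const_mul l)
  refine tendsto_nhds_unique h1 (tendsto_const_nhds.congr fun x => ?_)
  have hd := hJ.det_eq_one x
  have z0 : jostMatrix q l Y x 0 0 = conj (jostMatrix q l Y x 1 1) := rfl
  have z1 : jostMatrix q l Y x 1 0 = l * conj (jostMatrix q l Y x 0 1) := rfl
  have z2 : jostMatrix q l Y x 0 1 = osc (-l) x * (Y x).1 := rfl
  have hn : ‖jostMatrix q l Y x 0 1‖ = ‖(Y x).1‖ := by rw [z2, norm_mul, norm_osc, one_mul]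
  rw [z0, z1, mul_left_comm, Complex.mul_conj', Complex.mul_conj', hn] at hd
  exact_mod_cast hd.symm

end jost

/-! ### Decay of the scattering data -/

/-- The primitive does not decay at `+∞`, but its product with a Schwartz function is again
Schwartz. -/
lemma hasTemperateGrowth_primitive (g : 𝓢(ℝ, ℂ)) :
    (fun y => (∫ s, g s) - ∫ s in Set.Ioi y, g s).HasTemperateGrowth := by
  have hd : ∀ y, HasDerivAt (fun y => (∫ s, g s) - ∫ s in Set.Ioi y, g s) (g y) y := fun y => by
    simpa using (hasDerivAt_integral_Ioi g.continuous g.integrable y).const_sub (∫ s, g s)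
  have hf : fderiv ℝ (fun y => (∫ s, g s) - ∫ s in Set.Ioi y, g s)
      = g.postcompCLM (𝕜 := ℝ) (ContinuousLinearMap.toSpanSingletonCLE (𝕜 := ℝ) (E := ℂ) :
        ℂ →L[ℝ] ℝ →L[ℝ] ℂ) := by
    funext y
    rw [(hd y).hasFDerivAt.fderiv]
    ext
    simp
  refine Function.HasTemperateGrowth.of_fderiv (k := 0) (C := 2 * ∫ s, ‖g s‖) ?_
    (fun y => (hd y).differentiableAt) fun y => ?_
  · rw [hf]
    exact SchwartzMap.hasTemperateGrowth _
  · rw [pow_zero, mul_one, two_mul]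
    refine (norm_sub_le _ _).trans (add_le_add (norm_integral_le_integral_norm _) ?_)
    exact (norm_integral_le_integral_norm _).trans (setIntegral_le_integral g.integrable.norm
      (Eventually.of_forall fun s => norm_nonneg _))

section transform

variable {q : 𝓢(ℝ, ℂ)} {Y : ℝ → ℝ → ℂ × ℂ} {K : ℝ}

/-- The oscillatory integral `∫ e^{2ils} a(s) v(s,l) ds`. -/
def oscInt (Y : ℝ → ℝ → ℂ × ℂ) (a : 𝓢(ℝ, ℂ)) (l : ℝ) : ℂ :=
  ∫ s, a s * (osc l s * (Y l s).2)

lemma integrable_oscInt (hc : ∀ l, Continuous (Y l)) (hK : ∀ l y, ‖Y l y‖ ≤ K) (a : 𝓢(ℝ, ℂ))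
    (l : ℝ) : Integrable fun s => a s * (osc l s * (Y l s).2) := by
  refine a.integrable.mul_bdd (c := K)
    ((continuous_osc l).mul (hc l).snd).aestronglyMeasurable (Eventually.of_forall fun s => ?_)
  rw [norm_mul, norm_osc, one_mul]
  exact (norm_snd_le _).trans (hK l s)

lemma tendsto_zero_mul_of_bdd {F : Filter ℝ} {f g : ℝ → ℂ} (hf : Tendsto f F (𝓝 0))
    (hg : ∀ s, ‖g s‖ ≤ K) : Tendsto (fun s => f s * g s) F (𝓝 0) :=
  hf.zero_mul_isBoundedUnder_le (isBoundedUnder_of ⟨K, hg⟩)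

/-- Write `Y = (P, v)`. Integrating `e^{2ils}` by parts, the term with `v'` loses its phase and
becomes `a r P`. A second integration by parts, with a primitive `A` of `a r`, brings in `P' =
e^{2ils} q v` and restores the original form, with amplitude `(A q - a')/(2i)`. -/
lemma exists_mul_oscInt (hc : ∀ l, Continuous (Y l)) (hK : ∀ l y, ‖Y l y‖ ≤ K)
    (hY : ∀ l x, HasDerivAt (Y l) (field q (gaugeCoeff q) l x (Y l x)) x)
    (ht : ∀ l, Tendsto (Y l) atTop (𝓝 (0, 1))) (a : 𝓢(ℝ, ℂ)) :
    ∃ b : 𝓢(ℝ, ℂ), ∀ l : ℝ, (l : ℂ) * oscInt Y a l = oscInt Y b l := by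
  set r := gaugeCoeff q
  set g := mulS a r
  set A : ℝ → ℂ := fun y => (∫ s, g s) - ∫ s in Set.Ioi y, g s
  have hAt : A.HasTemperateGrowth := hasTemperateGrowth_primitive g
  have hAd : ∀ y, HasDerivAt A (g y) y := fun y => by
    simpa using (hasDerivAt_integral_Ioi g.continuous g.integrable y).const_sub (∫ s, g s)
  have hA0 : Tendsto A atBot (𝓝 0) := by
    simpa using (tendsto_integral_Ioi_atBot g.integrable).const_sub (∫ s, g s)
  have hAb : ∀ y, ‖A y‖ ≤ (∫ s, ‖g s‖) + ∫ s, ‖g s‖ := fun y =>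
    (norm_sub_le _ _).trans (add_le_add (norm_integral_le_integral_norm _)
      ((norm_integral_le_integral_norm _).trans (setIntegral_le_integral g.integrable.norm
        (Eventually.of_forall fun s => norm_nonneg _))))
  refine ⟨(2 * I : ℂ)⁻¹ • (mulS A q - SchwartzMap.derivCLM ℂ ℂ a), fun l => ?_⟩
  have hE : ∀ s, ‖osc l s * (Y l s).2‖ ≤ K := fun s => by
    rw [norm_mul, norm_osc, one_mul]
    exact (norm_snd_le _).trans (hK l s)
  have hP : ∀ s, ‖(Y l s).1‖ ≤ K := fun s => (norm_fst_le _).trans (hK l s)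
  have i1 := integrable_oscInt hc hK a l
  have i2 := integrable_oscInt hc hK (mulS A q - SchwartzMap.derivCLM ℂ ℂ a) l
  have hder : ∀ s, HasDerivAt (fun s => a s * (osc l s * (Y l s).2) - A s * (Y l s).1)
      (2 * I * l * (a s * (osc l s * (Y l s).2))
        - (mulS A q - SchwartzMap.derivCLM ℂ ℂ a) s * (osc l s * (Y l s).2)) s := fun s => by
    have h1 : HasDerivAt (fun y => (Y l y).1) (osc l s * q s * (Y l s).2) s := (hY l s).fst
    have h2 : HasDerivAt (fun y => (Y l y).2) (osc (-l) s * r s * (Y l s).1) s := (hY l s).snd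
    have h3 : HasDerivAt a (deriv a s) s := a.differentiableAt.hasDerivAt
    refine ((h3.mul ((hasDerivAt_osc l s).mul h2)).sub ((hAd s).mul h1)).congr_deriv ?_
    have e1 : g s = a s * r s := mulS_apply a.hasTemperateGrowth r s
    have e2 : (mulS A q - SchwartzMap.derivCLM ℂ ℂ a) s = mulS A q s - deriv a s := rfl
    rw [e1, e2, mulS_apply hAt]
    simp only [Pi.mul_apply]
    linear_combination a s * r s * (Y l s).1 * osc_mul_neg l s
  -- The boundary terms vanish for different reasons: at `-∞` because `A` was chosen to vanish
  -- there, at `+∞` because `P → 0`.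
  have hbot : Tendsto (fun s => a s * (osc l s * (Y l s).2) - A s * (Y l s).1) atBot (𝓝 0) := by
    simpa using (tendsto_zero_mul_of_bdd (tendsto_schwartz a atBot_le_cocompact) hE).sub
      (tendsto_zero_mul_of_bdd hA0 hP)
  have htop : Tendsto (fun s => a s * (osc l s * (Y l s).2) - A s * (Y l s).1) atTop (𝓝 0) := by
    have := (tendsto_zero_mul_of_bdd (tendsto_schwartz a atTop_le_cocompact) hE).sub
      (tendsto_zero_mul_of_bdd (ht l).fst_nhds hAb)
    rw [sub_zero] at this
    refine this.congr fun s => ?_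
    ring
  have h := integral_of_hasDerivAt_of_tendsto hder ((i1.const_mul (2 * I * l)).sub i2) hbot htop
  rw [integral_sub (i1.const_mul (2 * I * l)) i2, integral_const_mul, sub_zero, sub_eq_zero] at h
  have e3 : oscInt Y ((2 * I : ℂ)⁻¹ • (mulS A q - SchwartzMap.derivCLM ℂ ℂ a)) l
      = (2 * I)⁻¹ * ∫ s, (mulS A q - SchwartzMap.derivCLM ℂ ℂ a) s * (osc l s * (Y l s).2) := by
    rw [oscInt, ← integral_const_mul]
    refine integral_congr_ae (Eventually.of_forall fun s => ?_)
    change (2 * I)⁻¹ * (mulS A q - SchwartzMap.derivCLM ℂ ℂ a) s * _ = _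
    ring
  rw [e3, ← h, oscInt]
  have : (2 * I : ℂ) ≠ 0 := by simp
  field_simp

lemma oscInt_eq_neg (hc : ∀ l, Continuous (Y l)) (hK : ∀ l y, ‖Y l y‖ ≤ K)
    (hY : ∀ l x, HasDerivAt (Y l) (field q (gaugeCoeff q) l x (Y l x)) x)
    (ht : ∀ l, Tendsto (Y l) atTop (𝓝 (0, 1))) {l : ℝ} {β γ : ℂ}
    (hb : Tendsto (Y l) atBot (𝓝 (β, γ))) : β = oscInt Y (-q) l := by
  have h1 : ∀ s, HasDerivAt (fun y => (Y l y).1) (-((-q) s * (osc l s * (Y l s).2))) s :=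
    fun s => by
      have h2 : HasDerivAt (fun y => (Y l y).1) (osc l s * q s * (Y l s).2) s := (hY l s).fst
      refine h2.congr_deriv ?_
      change osc l s * q s * (Y l s).2 = -(-q s * (osc l s * (Y l s).2))
      ring
  have h := integral_of_hasDerivAt_of_tendsto h1 (integrable_oscInt hc hK (-q) l).neg
    hb.fst_nhds (ht l).fst_nhds
  rw [integral_neg, zero_sub] at h
  exact (neg_injective h).symm

lemma exists_norm_oscInt_le (hc : ∀ l, Continuous (Y l)) (hK : ∀ l y, ‖Y l y‖ ≤ K)
    (hL : ∀ l m y, ‖Y l y - Y m y‖ ≤ K * |l - m|) (a : 𝓢(ℝ, ℂ)) :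
    ∃ M, (∀ l, ‖oscInt Y a l‖ ≤ M) ∧ ∀ l m, ‖oscInt Y a l - oscInt Y a m‖ ≤ M * |l - m| := by
  obtain ⟨C, hC, h⟩ := exists_schwartz_le a
  have hK0 : 0 ≤ K := (norm_nonneg _).trans (hK 0 0)
  have hi : Integrable fun s : ℝ => C * (1 + s ^ 2)⁻¹ := integrable_inv_one_add_sq.const_mul C
  refine ⟨2 * C * Real.pi * K, fun l => ?_, fun l m => ?_⟩
  · calc ‖oscInt Y a l‖ ≤ ∫ s, C * (1 + s ^ 2)⁻¹ * K := by
          refine norm_integral_le_of_norm_le (hi.mul_const K) (Eventually.of_forall fun s => ?_)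
          rw [norm_mul, norm_mul, norm_osc, one_mul]
          have := le_of_one_add_abs_mul_le (norm_nonneg _) (h s)
          exact mul_le_mul this ((norm_snd_le _).trans (hK l s)) (norm_nonneg _) (by positivity)
      _ = C * Real.pi * K := by
          rw [integral_mul_const, integral_const_mul, integral_univ_inv_one_add_sq]
      _ ≤ _ := by
          have : 0 ≤ C * Real.pi * K := by positivity
          linarith
  · rw [oscInt, oscInt, ← integral_sub (integrable_oscInt hc hK a l)
      (integrable_oscInt hc hK a m)]
    calc _ ≤ ∫ s, C * (1 + s ^ 2)⁻¹ * (2 * K * |l - m|) := by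
          refine norm_integral_le_of_norm_le (hi.mul_const _) (Eventually.of_forall fun s => ?_)
          have e1 : a s * (osc l s * (Y l s).2) - a s * (osc m s * (Y m s).2)
              = a s * ((osc l s - osc m s) * (Y l s).2 + osc m s * (Y l s - Y m s).2) := by
            rw [Prod.snd_sub]
            ring
          have e2 : ‖(osc l s - osc m s) * (Y l s).2 + osc m s * (Y l s - Y m s).2‖
              ≤ (1 + |s|) * (2 * K * |l - m|) := by
            refine (norm_add_le _ _).trans ?_
            rw [norm_mul, norm_mul, norm_osc, one_mul]
            have f1 := mul_le_mul (norm_osc_sub_le l m s) ((norm_snd_le _).trans (hK l s))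
              (norm_nonneg _) (by positivity)
            have f2 := (norm_snd_le _).trans (hL l m s)
            have f3 : 0 ≤ K * |l - m| := by positivity
            linarith
          rw [e1, norm_mul]
          calc ‖a s‖ * _ ≤ ‖a s‖ * ((1 + |s|) * (2 * K * |l - m|)) := by gcongr
            _ = (1 + |s|) * ‖a s‖ * (2 * K * |l - m|) := by ring
            _ ≤ _ := mul_le_mul_of_nonneg_right (h s) (by positivity)
      _ = _ := by
          rw [integral_mul_const, integral_const_mul, integral_univ_inv_one_add_sq]
          ring

end transform

lemma Rapid.div {β α : ℝ → ℂ} (hβ : Rapid β) {c L : ℝ} (hc : 0 < c) (hα : ∀ l, c ≤ ‖α l‖)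
    (hL : ∀ l m, ‖α l - α m‖ ≤ L * |l - m|) : Rapid fun l => β l / α l := by
  have hi : ∀ l, ‖(α l)⁻¹‖ ≤ c⁻¹ := fun l => by
    rw [norm_inv]
    exact inv_anti₀ hc (hα l)
  have h0 : ∀ l, α l ≠ 0 := fun l => norm_pos_iff.mp (hc.trans_le (hα l))
  refine ⟨fun k => ?_, fun k => ?_⟩
  · obtain ⟨B, hB⟩ := hβ.bdd k
    refine ⟨B * c⁻¹, fun l => ?_⟩
    rw [div_eq_mul_inv, ← mul_assoc, norm_mul]
    exact mul_le_mul (hB l) (hi l) (norm_nonneg _) ((norm_nonneg _).trans (hB l))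
  · obtain ⟨B, hB⟩ := hβ.bdd k
    obtain ⟨M, hM⟩ := hβ.lip k
    have hB0 := (norm_nonneg _).trans (hB 0)
    refine ⟨M * c⁻¹ + B * L * c⁻¹ * c⁻¹, fun l m => ?_⟩
    have e1 : (l : ℂ) ^ k * (β l / α l) - (m : ℂ) ^ k * (β m / α m)
        = ((l : ℂ) ^ k * β l - (m : ℂ) ^ k * β m) * (α l)⁻¹
          - (m : ℂ) ^ k * β m * (α l - α m) * (α l)⁻¹ * (α m)⁻¹ := by
      have := h0 l
      have := h0 m
      field_simp
      ring
    rw [e1]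
    refine (norm_sub_le _ _).trans ?_
    rw [norm_mul, norm_mul, norm_mul, norm_mul ((m : ℂ) ^ k * β m)]
    have n1 := mul_le_mul (hM l m) (hi l) (norm_nonneg _) ((norm_nonneg _).trans (hM l m))
    have n2 := mul_le_mul (hB m) (hL l m) (norm_nonneg _) hB0
    have n3 : 0 ≤ B * (L * |l - m|) :=
      (mul_nonneg (norm_nonneg _) (norm_nonneg _)).trans n2
    have n4 := mul_le_mul n2 (hi l) (norm_nonneg _) n3
    have n5 := mul_le_mul n4 (hi m) (norm_nonneg _) (mul_nonneg n3 (inv_pos.mpr hc).le)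
    calc _ ≤ _ := add_le_add n1 n5
      _ = _ := by ring

/-- If `|lβ| ≤ B`, then `|l||β|² ≤ B²/|l| ≤ 1/2` for `|l| > 2B² + 1`, whence `|γ|² ≥ 1/2`; on the
remaining compact interval the minimum is positive. -/
lemma exists_pos_le_norm {β γ : ℝ → ℂ} (hβ : Rapid β) (hγ : Continuous γ) (h0 : ∀ l, γ l ≠ 0)
    (h : ∀ l, ‖γ l‖ ^ 2 - l * ‖β l‖ ^ 2 = 1) : ∃ c, 0 < c ∧ ∀ l, c ≤ ‖γ l‖ := by
  obtain ⟨B, hB⟩ := hβ.bdd 1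
  have hB0 := (norm_nonneg _).trans (hB 0)
  obtain ⟨l₀, -, hl₀⟩ := (isCompact_Icc (a := -(2 * B ^ 2 + 1)) (b := 2 * B ^ 2 + 1)).exists_isMinOn
    ⟨0, by constructor <;> nlinarith⟩ hγ.norm.continuousOn
  refine ⟨min (1 / 2) ‖γ l₀‖, lt_min (by norm_num) (norm_pos_iff.mpr (h0 l₀)), fun l => ?_⟩
  by_cases hl : |l| ≤ 2 * B ^ 2 + 1
  · exact (min_le_right _ _).trans (hl₀ (abs_le.mp hl))
  · push Not at hl
    refine (min_le_left _ _).trans ?_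
    have h1 := hB l
    rw [pow_one, norm_mul, Complex.norm_real, Real.norm_eq_abs] at h1
    have h2 : |l| * (|l| * ‖β l‖ ^ 2) ≤ B ^ 2 := by
      have := pow_le_pow_left₀ (by positivity) h1 2
      nlinarith
    have h3 : |l| * ‖β l‖ ^ 2 ≤ 1 / 2 := by
      by_contra hcon
      push Not at hcon
      nlinarith [sq_nonneg B]
    have h4 : -(|l| * ‖β l‖ ^ 2) ≤ l * ‖β l‖ ^ 2 := by
      have := mul_le_mul_of_nonneg_right (neg_abs_le l) (sq_nonneg ‖β l‖)
      linarith
    have h5 := h l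
    nlinarith [norm_nonneg (γ l)]

/-! ### Existence and uniqueness of the scattering data -/

lemma adExp_injective (θ : ℝ) : Function.Injective (adExp θ) := by
  intro A B h
  have e := fun i j => congrFun (congrFun h i) j
  have h00 := e 0 0
  have h01 := e 0 1
  have h10 := e 1 0
  have h11 := e 1 1
  simp only [adExp, Matrix.of_apply, Matrix.cons_val_zero, Matrix.cons_val_one, Matrix.cons_val',
    Matrix.cons_val_fin_one] at h00 h01 h10 h11
  ext i j
  fin_cases i <;> fin_cases j <;> simp only [Fin.zero_eta, Fin.mk_one, Fin.isValue]
  · exact h00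
  · exact mul_left_cancel₀ (Complex.exp_ne_zero _) h01
  · exact mul_left_cancel₀ (Complex.exp_ne_zero _) h10
  · exact h11

lemma IsScatteringData.unique {q α β α' β' : ℝ → ℂ} (h : IsScatteringData q α β)
    (h' : IsScatteringData q α' β') : α' = α ∧ β' = β := by
  have key : ∀ l, !![α' l, β' l; l * conj (β' l), conj (α' l)]
      = !![α l, β l; l * conj (β l), conj (α l)] := by
    intro l
    obtain ⟨np, nm, h1, h2, h3⟩ := h l
    obtain ⟨np', nm', h1', h2', h3'⟩ := h' l
    have e1 := h1.unique h1'
    have e2 := h2.unique h2'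
    subst e1 e2
    have hu : IsUnit (nm' 0) := by
      rw [Matrix.isUnit_iff_isUnit_det, Matrix.det_fin_two]
      have hd := h2.det_eq_one 0
      rw [show nm' 0 0 0 * nm' 0 1 1 - nm' 0 0 1 * nm' 0 1 0 = 1 by linear_combination hd]
      exact isUnit_one
    exact adExp_injective _ (hu.mul_left_cancel ((h3' 0).symm.trans (h3 0)))
  constructor <;> funext l
  · exact congrFun (congrFun (key l) 0) 0
  · exact congrFun (congrFun (key l) 0) 1

/-- The scattering data of a Schwartz function. -/
theorem exists_scatteringData (q : 𝓢(ℝ, ℂ)) : ∃ (α β : ℝ → ℂ) (L : ℝ), IsScatteringData q α β ∧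
    Rapid β ∧ (∀ l m, ‖α l - α m‖ ≤ L * |l - m|) ∧ ∀ l, ‖α l‖ ^ 2 - l * ‖β l‖ ^ 2 = 1 := by
  obtain ⟨C, hA⟩ := exists_isAdmissible q (gaugeCoeff q)
  obtain ⟨Y, hY, K, hK, hL⟩ := hA.exists_family
  have hc := fun l => (hY l).cont
  have hd := fun l => (hY l).hasDerivAt (hA.isDecayingField l)
  have ht := fun l => (hY l).tendsto_atTop (hA.isDecayingField l)
  choose Z hZ hZ0 using fun l => hA.exists_atBot l
  obtain ⟨W, hW⟩ : ∃ W : ℝ → ℂ × ℂ, ∀ l, Tendsto (Y l) atBot (𝓝 (W l)) :=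
    ⟨_, fun l => (hY l).tendsto_atBot (hA.isDecayingField l)⟩
  have hWL : ∀ l m, ‖W l - W m‖ ≤ K * |l - m| := fun l m =>
    le_of_tendsto ((hW l).sub (hW m)).norm (Eventually.of_forall fun y => hL l m y)
  -- Starting from `β = -∫ e^{2ils} q v`, every `l^k β` is an oscillatory integral with Schwartz
  -- amplitude, and all of these are bounded and Lipschitz.
  have hrep : ∀ k : ℕ, ∃ a : 𝓢(ℝ, ℂ), ∀ l : ℝ, (l : ℂ) ^ k * (W l).1 = oscInt Y a l := by
    intro k
    induction k with
    | zero => exact ⟨-q, fun l => by rw [pow_zero, one_mul, oscInt_eq_neg hc hK hd ht (hW l)]⟩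
    | succ k ih =>
      obtain ⟨a, ha⟩ := ih
      obtain ⟨b, hb⟩ := exists_mul_oscInt hc hK hd ht a
      exact ⟨b, fun l => by rw [pow_succ', mul_assoc, ha, hb]⟩
  refine ⟨fun l => conj (W l).2, fun l => (W l).1, K, fun l => ?_, ⟨fun k => ?_, fun k => ?_⟩,
    fun l m => ?_, fun l => ?_⟩
  · exact ⟨_, _, isJost_jostMatrix atTop_le_cocompact (hd l) (ht l),
      isJost_jostMatrix atBot_le_cocompact (hZ l) (hZ0 l),
      jostMatrix_mul_adExp (hd l) (hZ l) (hZ0 l) (hW l)⟩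
  · obtain ⟨a, ha⟩ := hrep k
    obtain ⟨M, hM, -⟩ := exists_norm_oscInt_le hc hK hL a
    exact ⟨M, fun l => by rw [ha]; exact hM l⟩
  · obtain ⟨a, ha⟩ := hrep k
    obtain ⟨M, -, hM⟩ := exists_norm_oscInt_le hc hK hL a
    exact ⟨M, fun l m => by rw [ha, ha]; exact hM l m⟩
  · rw [← map_sub, Complex.norm_conj]
    exact (norm_snd_le (W l - W m)).trans (hWL l m)
  · rw [Complex.norm_conj]
    exact norm_sq_sub_eq_one (hd l) (ht l) (hW l)

theorem existsUnique_scatteringData (q : 𝓢(ℝ, ℂ)) :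
    ∃! p : (ℝ → ℂ) × (ℝ → ℂ), IsScatteringData q p.1 p.2 := by
  obtain ⟨α, β, -, h, -⟩ := exists_scatteringData q
  refine ⟨(α, β), h, fun p hp => ?_⟩
  obtain ⟨h1, h2⟩ := h.unique hp
  exact Prod.ext h1 h2

lemma scatteringData_eq {q : 𝓢(ℝ, ℂ)} {α β : ℝ → ℂ} (h : IsScatteringData q α β) :
    scatteringData q = (α, β) := by
  have h1 : IsScatteringData q (scatteringData q).1 (scatteringData q).2 :=
    Classical.epsilon_spec (p := fun p : (ℝ → ℂ) × (ℝ → ℂ) => IsScatteringData q p.1 p.2)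
      ⟨(α, β), h⟩
  obtain ⟨h2, h3⟩ := h.unique h1
  exact Prod.ext h2 h3

/-- The reflection coefficient of a Schwartz function whose scattering datum `α` has no zeros. -/
theorem rapid_directScattering {q : 𝓢(ℝ, ℂ)} (hq : ∀ l, (scatteringData q).1 l ≠ 0) :
    Rapid (directScattering q) := by
  obtain ⟨α, β, L, h, hβ, hL, hdet⟩ := exists_scatteringData q
  have hs := scatteringData_eq h
  rw [hs] at hq
  have hcont : Continuous α := by
    have : LipschitzWith (Real.toNNReal L) α := LipschitzWith.of_dist_le_mul fun l m => by
      rw [dist_eq_norm, Real.dist_eq]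
      exact (hL l m).trans (mul_le_mul_of_nonneg_right (Real.le_coe_toNNReal L) (abs_nonneg _))
    exact this.continuous
  obtain ⟨c, hc, hα⟩ := exists_pos_le_norm hβ hcont hq hdet
  have := hβ.div hc hα hL
  unfold directScattering
  rw [hs]
  exact this

end DNLS

end

theorem mainTheorem5 (q₀ : 𝓢(ℝ, ℂ)) (hq₀ : q₀ ∈ DNLS.schwartzU) :
    (∃! p : (ℝ → ℂ) × (ℝ → ℂ), DNLS.IsScatteringData q₀ p.1 p.2) ∧
    (∀ t : ℝ, ∃! r : ℝ → ℂ,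
      DNLS.IsInverseScattering (DNLS.evolve t (DNLS.directScattering q₀)) r) ∧
    DNLS.IsClassicalSolution fun x t =>
      DNLS.inverseScattering (DNLS.evolve t (DNLS.directScattering q₀)) x := by
  obtain ⟨hα, -⟩ := hq₀
  have hρ := DNLS.rapid_directScattering hα
  exact ⟨DNLS.existsUnique_scatteringData q₀, DNLS.existsUnique_isInverseScattering hρ,
    DNLS.isClassicalSolution_inverseScattering hρ⟩
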